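/- **Setting.** Let $(Y_i,Z_i,W_i)_{i\ge 1}$ be i.i.d. with values in $\mathbb R\times\mathbb R^p\times\mathbb R^q$, $E[Y^2]<\infty$, $W$ bounded. Let $Y=\phi_0(Z)+U$ with $E\{U\mid W\}=0$ and $U_i=Y_i-\phi_0(Z_i)$. Let $\mathbb K\in\{\mathbb R,\mathbb C\}$, let $\omega:\mathbb R\to\mathbb K$ be analytic, not a polynomial, with $\omega^{(l)}(0)\ne0$ for all $l\ge 0$. Let $\mathcal T\subset\mathbb R^q$ contain a neighbourhood of $0$, with $\sup_{t\in\mathcal T}|\omega(W^Tt)|\le C$ almost surely for a constant $C$, and let $\mu$ be a finite measure concentrated on $\mathcal T$. Let $\pi$ be a probability density on $\mathbb R^p$ that is strictly positive on the support of $Z$, and let $Z$ have density $f_Z$. All function spaces are over $\mathbb K$; $\langle\phi,\varphi\rangle=\int\phi\bar\varphi\,\pi\,dz$ on $L^2_\pi(\mathbb R^p)$, similarly on $L^2_\mu(\mathcal T)$; $\phi_0\in L^2_\pi(\mathbb R^p)$. Quotients by $\pi$ below are taken in $[0,\infty]$, with $c/0=\infty$ for $c>0$ and $0/0=0$. Define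 $A_Z:L^2_\pi(\mathbb R^p)\to L^2_\mu(\mathcal T)$, $(A_Z\phi)(t)=E[\phi(Z)\omega(W^Tt)]=\int\phi(z)k(z,t)\,dz$, where $k(z,t)=E\{\omega(W^Tt)\mid Z=z\}f_Z(z)$. For a kernel $K$, bandwidths $h=h_n>0$, and $m=m_n\in\mathbb N$, let $$\hat s(t)=\frac1n\sum_{i=1}^nY_i\omega(W_i^Tt),\qquad \hat k(z,t)=\frac1{nh^p}\sum_{i=1}^n\omega(W_i^Tt)K\Big(\frac{z-Z_i}h\Big),\qquad \hat A_Z\phi=\int\phi(z)\hat k(z,\cdot)\,dz,$$ $$\hat\phi=a\sum_{l=0}^m(I-a\hat A_Z^*\hat A_Z)^l\hat A_Z^*\hat s ,$$ where $a$ is a fixed constant with $0<a<1/\|A_Z\|_{op}^2$ and $*$ denotes the Hilbert adjoint. For $\alpha\ge0$, $\upsilon>0$ with $b-1<\upsilon\le b$, $b\in\mathbb N$, let $\mathcal B^{\upsilon,\alpha}_\pi$ be the class of functions $g$ on $\mathbb R^p$ that are everywhere $b-1$ times differentiable and for which there are $R>0$ and a function $\eta\ge 0$ with $|g(y)-g(x)-Q_x(y-x)|\le\eta(x)\|y-x\|^\upsilon$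 whenever $\|y-x\|<R$, where $Q_x$ is the Taylor polynomial of $g$ at $x$ of degree $b-1$ without its constant term; here $\eta$ is bounded if $\alpha=0$, and $\int|g|^\alpha/\pi<\infty$, $\int\eta^\alpha/\pi<\infty$ if $\alpha>0$. A family is in the class uniformly if one $R$ and one bound on these quantities serve all its members. **Assumptions.** 1. $A_Z$ is injective. 2. $\rho\ge1$ is an integer; $f_Z\in\mathcal B^{1,2}_\pi\cap\mathcal B^{1,1}_\pi$; $\phi_0\in\mathcal B^{\upsilon,0}_\pi$ for some $\upsilon>\rho$; a version of $k(\cdot,t)$ is in $\mathcal B^{\upsilon',2}_\pi$ uniformly in $t\in\mathcal T$ for some $\upsilon'>\rho$. 3. $K$ is symmetric about $0$ and of order $\rho$ (that is, $\int K=1$, all monomial moments of $K$ of degree $1,\dots,\rho-1$ vanish, $\int\|u\|^\rho|K(u)|\,du<\infty$), $\int K(u)^2(1+\|u\|)\,du<\infty$, and, for all large $n$, almost surely $K((\cdot-Z_i)/h)/\pi\in L^2_\pi(\mathbb R^p)$ for $i\le n$. Moreover, for every $r>0$, $$E\int_{\|z-Z\|\ge r}\Big|h^{-p}K\Big(\frac{z-Z}h\Big)\Big|^2\frac{dz}{\pi(z)}=O(h^{2\rho})$$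 (which holds trivially if $K$ has compact support, since $h\to0$ under 4). 4. $m h^\rho\to0$, $n h^p/m^2\to\infty$, $n/m^3\to0$, and $n h^{2\rho}\to0$. 5. Let $(\lambda_j,\varphi_j,\psi_j)_j$ be a singular system of $A_Z$. For some $\iota\ge2$, $\sum_j|\langle\phi_0,\varphi_j\rangle|^2/\lambda_j^{2\iota}<\infty$. **Claim.** Let $g\in L^2_\pi(\mathbb R^p)$ satisfy $\sum_j|\langle g,\varphi_j\rangle|^2/\lambda_j^{2\gamma}<\infty$ for some $\gamma\ge2$. Then the equation $A_Z^*A_Z\psi=g$ has exactly one solution $\psi=(A_Z^*A_Z)^{-1}g$ in $L^2_\pi(\mathbb R^p)$, and $$\sqrt n\,\langle\hat\phi-\phi_0,g\rangle=n^{-1/2}\sum_{i=1}^nU_i\,\big\langle A_Z^*[\omega(W_i^T\cdot)],(A_Z^*A_Z)^{-1}g\big\rangle+o_P(1)\qquad(n\to\infty).$$ -/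

import Mathlib

open MeasureTheory ProbabilityTheory Filter Topology
open scoped ENNReal NNReal

noncomputable section

namespace NPIV

/-- The finite-dimensional Euclidean space `ℝ^d`. -/
abbrev Euc (d : ℕ) : Type := EuclideanSpace ℝ (Fin d)

/-- The measure `dens(z) dz` on `ℝ^d`, so that `L²_dens(ℝ^d)` is `Lp 𝕜 2 (densMeasure dens)`. -/
def densMeasure {d : ℕ} (dens : Euc d → ℝ) : Measure (Euc d) :=
  (volume : Measure (Euc d)).withDensity fun z => ENNReal.ofReal (dens z)

/-- A (measurable, nonnegative) probability density on `ℝ^d`. -/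
def IsProbDensity {d : ℕ} (dens : Euc d → ℝ) : Prop :=
  Measurable dens ∧ (∀ z, 0 ≤ dens z) ∧ ∫⁻ z, ENNReal.ofReal (dens z) = 1

/-- The functions `g : ℝ^d → F` of Hölder order `υ` with local radius `R`, remainder function `η`,
and bound `C` on the integrals of `|g|^α / γ` and `η^α / γ` (on the function `η` itself if `α = 0`).
With `b - 1 < υ ≤ b`, the first clause says that `g` is `b - 1` times differentiable, and the sum
is the Taylor polynomial of degree `b - 1` at `x` without its constant term.
Quotients by `γ` are taken in `[0, ∞]`: `c / 0 = ∞` if `c > 0`, and `0 / 0 = 0`. -/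
def HolderBound {d : ℕ} {F : Type*} [NormedAddCommGroup F] [NormedSpace ℝ F]
    (υ α : ℝ) (γ : Euc d → ℝ) (R : ℝ) (C : ℝ≥0) (g : Euc d → F) : Prop :=
  (∀ j : ℕ, (j : ℝ) + 1 < υ → Differentiable ℝ (iteratedFDeriv ℝ j g)) ∧
  ∃ η : Euc d → ℝ, AEMeasurable η volume ∧ (∀ x, 0 ≤ η x) ∧
    (∀ x y : Euc d, ‖y - x‖ < R →
      ‖g y - g x - ∑ j ∈ Finset.Ico 1 ⌈υ⌉₊,
          ((Nat.factorial j : ℝ)⁻¹) • iteratedFDeriv ℝ j g x (fun _ => y - x)‖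
        ≤ η x * ‖y - x‖ ^ υ) ∧
    (α = 0 → ∀ x, η x ≤ C) ∧
    (0 < α →
      ∫⁻ x, ENNReal.ofReal (‖g x‖ ^ α) / ENNReal.ofReal (γ x) ≤ C ∧
      ∫⁻ x, ENNReal.ofReal (η x ^ α) / ENNReal.ofReal (γ x) ≤ C)

/-- The class `𝓑^{υ,α}_γ(ℝ^d)`. -/
def HolderClass {d : ℕ} {F : Type*} [NormedAddCommGroup F] [NormedSpace ℝ F]
    (υ α : ℝ) (γ : Euc d → ℝ) (g : Euc d → F) : Prop :=
  ∃ R : ℝ, 0 < R ∧ ∃ C : ℝ≥0, HolderBound υ α γ R C g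

/-- `g t ∈ 𝓑^{υ,α}_γ(ℝ^d)` uniformly in `t ∈ S`. -/
def UniformHolderClass {d : ℕ} {ι F : Type*} [NormedAddCommGroup F] [NormedSpace ℝ F]
    (υ α : ℝ) (γ : Euc d → ℝ) (S : Set ι) (g : ι → Euc d → F) : Prop :=
  ∃ R : ℝ, 0 < R ∧ ∃ C : ℝ≥0, ∀ t ∈ S, HolderBound υ α γ R C (g t)

/-- A kernel on `ℝ^d` that is symmetric about `0` and of order `ρ`. -/
def IsKernelOfOrder {d : ℕ} (ρ : ℕ) (K : Euc d → ℝ) : Prop :=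
  (∀ u, K (-u) = K u) ∧ Integrable K volume ∧ ∫ u, K u = 1 ∧
  Integrable (fun u => ‖u‖ ^ ρ * |K u|) volume ∧
  ∀ s : Fin d → ℕ, 0 < ∑ i, s i → ∑ i, s i < ρ → ∫ u, (∏ i, u i ^ s i) * K u = 0

section Operators

variable {𝕜 : Type*} [RCLike 𝕜] {X T : Type*} [MeasurableSpace X] [MeasurableSpace T]

/-- The class in `L²(μ)` of a square integrable function (and `0` for other functions). -/
def toL2 (μ : Measure T) (f : T → 𝕜) : Lp 𝕜 2 μ :=
  open Classical in if h : MemLp f 2 μ then h.toLp f else 0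

/-- The bounded operator `A : L²(ν) → L²(μ)` with `(A φ)(t) = F φ t` for `μ`-almost all `t`.
There is at most one; the value is `0` if there is none. -/
def opOfFormula (ν : Measure X) (μ : Measure T) (F : (X → 𝕜) → T → 𝕜) :
    Lp 𝕜 2 ν →L[𝕜] Lp 𝕜 2 μ :=
  open Classical in
  if h : ∃ A : Lp 𝕜 2 ν →L[𝕜] Lp 𝕜 2 μ, ∀ φ : Lp 𝕜 2 ν, A φ =ᵐ[μ] F φ then h.choose else 0

theorem opOfFormula_spec {ν : Measure X} {μ : Measure T} {F : (X → 𝕜) → T → 𝕜}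
    (h : ∃ A : Lp 𝕜 2 ν →L[𝕜] Lp 𝕜 2 μ, ∀ φ : Lp 𝕜 2 ν, A φ =ᵐ[μ] F φ) (φ : Lp 𝕜 2 ν) :
    opOfFormula ν μ F φ =ᵐ[μ] F φ := by
  unfold opOfFormula
  rw [dif_pos h]
  exact h.choose_spec φ

theorem eLpNorm_two_sq {𝕜 : Type*} [RCLike 𝕜] {X : Type*} [MeasurableSpace X]
    (m : Measure X) (f : X → 𝕜) :
    eLpNorm f 2 m ^ (2 : ℝ) = ∫⁻ y, ‖f y‖ₑ ^ (2 : ℝ) ∂m := by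
  rw [eLpNorm_eq_lintegral_rpow_enorm_toReal (by norm_num) (by norm_num), ← ENNReal.rpow_mul]
  norm_num

/-- Integral operators with square integrable kernels exist, so `opOfFormula` is meaningful. -/
theorem exists_integralOperator {𝕜 : Type*} [RCLike 𝕜] {X T : Type*} [MeasurableSpace X]
    [MeasurableSpace T] {ν : Measure X} {μ : Measure T} [SFinite ν] [SFinite μ] (κ : X → T → 𝕜)
    (hκ : MemLp (fun x : T × X => κ x.2 x.1) 2 (μ.prod ν)) :
    ∃ A : Lp 𝕜 2 ν →L[𝕜] Lp 𝕜 2 μ, ∀ φ : Lp 𝕜 2 ν,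
      A φ =ᵐ[μ] fun t => ∫ z, φ z * κ z t ∂ν := by
  have hm := hκ.1
  have hsec : ∀ᵐ t ∂μ, MemLp (fun z => κ z t) 2 ν := by
    have h1 := hm.prodMk_left
    have h2 : ∫⁻ x, ‖κ x.2 x.1‖ₑ ^ (2 : ℝ) ∂(μ.prod ν) < ∞ := by
      rw [← eLpNorm_two_sq (μ.prod ν) (fun x : T × X => κ x.2 x.1)]
      exact ENNReal.rpow_lt_top_of_nonneg (by norm_num) hκ.2.ne
    rw [lintegral_prod _ (hm.enorm.pow_const _)] at h2
    have h3 := ae_lt_top' ((hm.enorm.pow_const (2 : ℝ)).lintegral_prod_right') h2.ne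
    filter_upwards [h1, h3] with t ht1 ht3
    refine ⟨ht1, ?_⟩
    rw [eLpNorm_lt_top_iff_lintegral_rpow_enorm_lt_top (by norm_num) (by norm_num)]
    simpa using ht3
  have hint : ∀ φ : Lp 𝕜 2 ν, ∀ᵐ t ∂μ, Integrable (fun z => φ z * κ z t) ν := by
    intro φ
    filter_upwards [hsec] with t ht
    exact (Lp.memLp φ).integrable_mul ht
  have hbd : ∀ φ : Lp 𝕜 2 ν, eLpNorm (fun t => ∫ z, φ z * κ z t ∂ν) 2 μ
      ≤ eLpNorm φ 2 ν * eLpNorm (fun x : T × X => κ x.2 x.1) 2 (μ.prod ν) := by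
    intro φ
    have e1 : ∀ᵐ t ∂μ, ‖∫ z, φ z * κ z t ∂ν‖ₑ ≤ eLpNorm φ 2 ν * eLpNorm (fun z => κ z t) 2 ν := by
      filter_upwards [hsec] with t ht
      refine (enorm_integral_le_lintegral_enorm _).trans ?_
      have := eLpNorm_smul_le_mul_eLpNorm (p := 2) (q := 2) (r := 1) ht.1 (Lp.memLp φ).1
      rw [eLpNorm_one_eq_lintegral_enorm] at this
      simpa [smul_eq_mul] using this
    rw [← ENNReal.rpow_le_rpow_iff (z := 2) (by norm_num),
      ENNReal.mul_rpow_of_nonneg _ _ (by norm_num), eLpNorm_two_sq, eLpNorm_two_sq (μ.prod ν),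
      lintegral_prod _ (hm.enorm.pow_const _),
      ← lintegral_const_mul'' _ ((hm.enorm.pow_const (2 : ℝ)).lintegral_prod_right')]
    refine lintegral_mono_ae ?_
    filter_upwards [e1] with t ht
    rw [← eLpNorm_two_sq ν (fun z => κ z t), ← ENNReal.mul_rpow_of_nonneg _ _ (by norm_num)]
    exact ENNReal.rpow_le_rpow ht (by norm_num)
  have hmeas : ∀ φ : Lp 𝕜 2 ν, AEStronglyMeasurable (fun t => ∫ z, φ z * κ z t ∂ν) μ := by
    intro φ
    exact AEStronglyMeasurable.integral_prod_right'
      (f := fun x : T × X => φ x.2 * κ x.2 x.1) ((Lp.memLp φ).1.comp_snd.mul hm)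
  have hmem : ∀ φ : Lp 𝕜 2 ν, MemLp (fun t => ∫ z, φ z * κ z t ∂ν) 2 μ := fun φ =>
    ⟨hmeas φ, (hbd φ).trans_lt (ENNReal.mul_lt_top (Lp.memLp φ).2 hκ.2)⟩
  let L : Lp 𝕜 2 ν →ₗ[𝕜] Lp 𝕜 2 μ :=
    { toFun := fun φ => (hmem φ).toLp _
      map_add' := by
        intro φ ψ
        rw [← MemLp.toLp_add]
        refine MemLp.toLp_congr _ _ ?_
        filter_upwards [hint φ, hint ψ] with t h1 h2
        simp only [Pi.add_apply]
        rw [← integral_add h1 h2]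
        refine integral_congr_ae ?_
        filter_upwards [Lp.coeFn_add φ ψ] with z hz
        rw [hz, Pi.add_apply, add_mul]
      map_smul' := by
        intro c φ
        rw [RingHom.id_apply, ← MemLp.toLp_const_smul]
        refine MemLp.toLp_congr _ _ (Eventually.of_forall fun t => ?_)
        simp only [Pi.smul_apply, smul_eq_mul]
        rw [← integral_const_mul]
        refine integral_congr_ae ?_
        filter_upwards [Lp.coeFn_smul c φ] with z hz
        rw [hz, Pi.smul_apply, smul_eq_mul, mul_assoc] }
  refine ⟨L.mkContinuous (eLpNorm (fun x : T × X => κ x.2 x.1) 2 (μ.prod ν)).toReal ?_, ?_⟩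
  · intro φ
    change ‖(hmem φ).toLp _‖ ≤ _
    rw [Lp.norm_toLp, Lp.norm_def, mul_comm, ← ENNReal.toReal_mul]
    exact ENNReal.toReal_mono (ENNReal.mul_lt_top (Lp.memLp φ).2 hκ.2).ne (hbd φ)
  · intro φ
    exact (hmem φ).coeFn_toLp

/-- The Landweber-Fridman scheme `R_m(A) = a ∑_{l=0}^m (I - a A* A)^l A*`. -/
def landweber {ν : Measure X} {μ : Measure T} (a : ℝ) (m : ℕ) (A : Lp 𝕜 2 ν →L[𝕜] Lp 𝕜 2 μ) :
    Lp 𝕜 2 μ →L[𝕜] Lp 𝕜 2 ν :=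
  (a : 𝕜) • ((∑ l ∈ Finset.range (m + 1),
    (ContinuousLinearMap.id 𝕜 (Lp 𝕜 2 ν)
      - (a : 𝕜) • (ContinuousLinearMap.adjoint A).comp A) ^ l).comp
    (ContinuousLinearMap.adjoint A))

/-- `(lam j, e j, f j)_j` is a singular system of `A`. -/
structure IsSingularSystem {ν : Measure X} {μ : Measure T} {J : Type*}
    (A : Lp 𝕜 2 ν →L[𝕜] Lp 𝕜 2 μ) (lam : J → ℝ) (e : J → Lp 𝕜 2 ν) (f : J → Lp 𝕜 2 μ) :
    Prop where
  pos : ∀ j, 0 < lam j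
  orthonormal_left : Orthonormal 𝕜 e
  orthonormal_right : Orthonormal 𝕜 f
  apply_left : ∀ j, A (e j) = (lam j : 𝕜) • f j
  adjoint_apply_right : ∀ j, ContinuousLinearMap.adjoint A (f j) = (lam j : 𝕜) • e j
  hasSum_apply : ∀ φ, HasSum (fun j => ((lam j : 𝕜) * inner 𝕜 (e j) φ) • f j) (A φ)

end Operators

section Model

variable {𝕜 : Type*} [RCLike 𝕜] {Ω : Type*} [MeasurableSpace Ω] {p q : ℕ}

/-- `A_Z : L²_dens(ℝ^p) → L²(μ)`, `(A_Z φ)(t) = E[φ(Z) w(Wᵀt)]`. -/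
def opAZ (P : Measure Ω) (Z : Ω → Euc p) (W : Ω → Euc q) (w : ℝ → 𝕜)
    (dens : Euc p → ℝ) (μ : Measure (Euc q)) :
    Lp 𝕜 2 (densMeasure dens) →L[𝕜] Lp 𝕜 2 μ :=
  opOfFormula (densMeasure dens) μ fun φ t => ∫ s, φ (Z s) * w (inner ℝ (W s) t) ∂P

/-- `E[w(Wᵀt) | Z = z] f_Z(z)`, through the regular conditional distribution of `W` given `Z`. -/
def condKernel (P : Measure Ω) [IsFiniteMeasure P] (Z : Ω → Euc p) (W : Ω → Euc q) (w : ℝ → 𝕜)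
    (fZ : Euc p → ℝ) (z : Euc p) (t : Euc q) : 𝕜 :=
  (∫ v, w (inner ℝ v t) ∂(condDistrib W Z P z)) * (fZ z : 𝕜)

/-- `ŝ(t) = n⁻¹ ∑_{i<n} Y_i w(W_iᵀt)`. -/
def sHat (w : ℝ → 𝕜) (n : ℕ) (Y : ℕ → ℝ) (W : ℕ → Euc q) (t : Euc q) : 𝕜 :=
  (n : 𝕜)⁻¹ * ∑ i ∈ Finset.range n, (Y i : 𝕜) * w (inner ℝ (W i) t)

/-- `k̂(z,t) = (n h^p)⁻¹ ∑_{i<n} w(W_iᵀt) K((z - Z_i)/h)`. -/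
def kHat (w : ℝ → 𝕜) (K : Euc p → ℝ) (h : ℝ) (n : ℕ) (Z : ℕ → Euc p) (W : ℕ → Euc q)
    (z : Euc p) (t : Euc q) : 𝕜 :=
  ((n : 𝕜) * ((h ^ p : ℝ) : 𝕜))⁻¹ *
    ∑ i ∈ Finset.range n, w (inner ℝ (W i) t) * (K (h⁻¹ • (z - Z i)) : 𝕜)

/-- `Â_Z φ = ∫ φ(z) k̂(z,·) dz`. -/
def opAZHat (w : ℝ → 𝕜) (K : Euc p → ℝ) (dens : Euc p → ℝ) (μ : Measure (Euc q))
    (h : ℝ) (n : ℕ) (Z : ℕ → Euc p) (W : ℕ → Euc q) :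
    Lp 𝕜 2 (densMeasure dens) →L[𝕜] Lp 𝕜 2 μ :=
  opOfFormula (densMeasure dens) μ fun φ t => ∫ z, φ z * kHat w K h n Z W z t

/-- The estimator `φ̂ = R_m(Â_Z) ŝ` computed from the first `n` observations. -/
def phiHat (w : ℝ → 𝕜) (K : Euc p → ℝ) (dens : Euc p → ℝ) (μ : Measure (Euc q))
    (a : ℝ) (m : ℕ) (h : ℝ) (n : ℕ) (Y : ℕ → ℝ) (Z : ℕ → Euc p) (W : ℕ → Euc q) :
    Lp 𝕜 2 (densMeasure dens) :=
  landweber a m (opAZHat w K dens μ h n Z W) (toL2 μ (sHat w n Y W))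

end Model

end NPIV

end

/-! Write `A` for `A_Z`, `B` for its estimate, `T = I - a B*B` and `R_m(B) = a ∑_{l ≤ m} T^l B*`.
Since `A` is injective and both source exponents are at least 2, `φ₀ = A*Aχ` and `g = A*Aψ` for some
`χ` and `ψ` (`IsSingularSystem.exists_normal_eq`). As `Y_i = φ₀(Z_i) + U_i`, and `Bφ₀` is a
combination of the functions `ω(W_iᵀ·)` whose coefficients are kernel-smoothed values of `φ₀` at the
`Z_i`, there is an exact identity `ŝ = Bφ₀ + ε + b`. Here `ε = n⁻¹ ∑ U_i ω(W_iᵀ·)` is centred noise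
and `b` carries the smoothing bias of `φ₀` (`toL2_sHat_eq`). The linear term of the claim is the
pairing of `√n A*ε` with `ψ`.

The deterministic core is `norm_landweberOp_error_le`. In `g = A*Aψ` the operator `A*A` is replaced
by `B*B` at a cost of order `δ = ‖B - A‖`. Geometric sums give `B*B R_m(B) y = B*y - T^{m+1} B*y`
and `R_m(B) B φ - φ = -T^{m+1} φ`, and an energy inequality gives `‖T^k B*‖ ≤ (a(k+1))^{-1/2}`
without functional calculus. So `ε` contributes its pairing `⟨ψ, A*ε⟩` up to `O(mδ + m^{-1/2}) ‖ε‖`,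
`b` contributes `O(‖b‖)`, and the regularization bias `⟨A*Aψ, T^{m+1} A*Aχ⟩` is `O(m⁻²)`, all as
long as `mδ` stays below a fixed threshold.

In expectation `n‖ε‖²` is `O(1)`, `‖b‖` is `O(h^ρ)`, and `δ²` is `O(1/(n h^p) + h^{2ρ})`, the last
through the Hilbert-Schmidt distance of the kernels (`exists_lintegral_kernelDist_le`). The rates
then give `mδ → 0` in mean square, `√n h^ρ → 0` and `√n / m² → 0`, and
`tendstoInMeasure_of_product_bound` concludes.

The smoothing biases need care because the classes `𝓑` control a function and its Taylor remainder
but not the derivatives in between. Interpolation along a ray recovers the Taylor terms from nearby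
function values (`exists_taylorTerm_le`), so the remainder of degree `ρ - 1` is `O(‖y‖^ρ)` for every
displacement `y`, apart from the value `g(x + y)` itself when `y` is long
(`exists_taylor_remainder_le`). Long displacements are paid for by the tail hypothesis on `K`,
nearby values by an envelope of `f_Z` (`HolderClass.exists_envelope`), and the weight `1/π` is
handled by a Cauchy-Schwarz inequality whose weight may vanish. -/

namespace NPIV

/-! ### Landweber iteration for a perturbed operator. -/

section Landweber

variable {𝕜 : Type*} [RCLike 𝕜] {H₁ H₂ : Type*} [NormedAddCommGroup H₁] [InnerProductSpace 𝕜 H₁]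
  [CompleteSpace H₁] [NormedAddCommGroup H₂] [InnerProductSpace 𝕜 H₂] [CompleteSpace H₂]

/-- The residual operator `I - a B* B` of the Landweber-Fridman iteration. -/
noncomputable def residual (a : ℝ) (B : H₁ →L[𝕜] H₂) : H₁ →L[𝕜] H₁ :=
  ContinuousLinearMap.id 𝕜 H₁ - (a : 𝕜) • (ContinuousLinearMap.adjoint B).comp B

local notation "adj" => ContinuousLinearMap.adjoint

theorem residual_apply (a : ℝ) (B : H₁ →L[𝕜] H₂) (x : H₁) :
    residual a B x = x - (a : 𝕜) • adj B (B x) := rfl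

/-- Energy inequality: expanding the square gives `‖x‖² - 2a‖Bx‖² + a²‖B*Bx‖²`, and `a‖B‖² ≤ 1` lets
one of the two negative terms absorb the last one. All decay rates below are consequences. -/
theorem norm_residual_sq_le {a : ℝ} (ha : 0 < a) {B : H₁ →L[𝕜] H₂} (hB : a * ‖B‖ ^ 2 ≤ 1)
    (x : H₁) : a * ‖B x‖ ^ 2 + ‖residual a B x‖ ^ 2 ≤ ‖x‖ ^ 2 := by
  rw [residual_apply, @norm_sub_sq 𝕜, inner_smul_right, ContinuousLinearMap.adjoint_inner_right,
    norm_smul, inner_self_eq_norm_sq_to_K, RCLike.norm_ofReal, abs_of_pos ha]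
  have h1 : RCLike.re ((a : 𝕜) * (‖B x‖ : 𝕜) ^ 2) = a * ‖B x‖ ^ 2 := by
    norm_cast
  rw [h1]
  have h2 : ‖adj B (B x)‖ ≤ ‖B‖ * ‖B x‖ := by
    simpa using (adj B).le_opNorm (B x)
  have h3 : (a * ‖adj B (B x)‖) ^ 2 ≤ a * ‖B x‖ ^ 2 := by
    calc (a * ‖adj B (B x)‖) ^ 2 ≤ (a * (‖B‖ * ‖B x‖)) ^ 2 := by gcongr
      _ = (a * ‖B‖ ^ 2) * (a * ‖B x‖ ^ 2) := by ring
      _ ≤ 1 * (a * ‖B x‖ ^ 2) := by gcongr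
      _ = _ := one_mul _
  linarith

theorem norm_residual_apply_le {a : ℝ} (ha : 0 < a) {B : H₁ →L[𝕜] H₂} (hB : a * ‖B‖ ^ 2 ≤ 1)
    (x : H₁) : ‖residual a B x‖ ≤ ‖x‖ := by
  have := norm_residual_sq_le ha hB x
  refine (pow_le_pow_iff_left₀ (norm_nonneg _) (norm_nonneg _) two_ne_zero).1 ?_
  nlinarith [sq_nonneg ‖B x‖]

theorem norm_residual_pow_apply_le {a : ℝ} (ha : 0 < a) {B : H₁ →L[𝕜] H₂}
    (hB : a * ‖B‖ ^ 2 ≤ 1) (k : ℕ) (x : H₁) : ‖(residual a B ^ k) x‖ ≤ ‖x‖ := by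
  induction k with
  | zero => simp
  | succ k ih =>
    rw [pow_succ', mul_apply_eq_comp]
    exact (norm_residual_apply_le ha hB _).trans ih

theorem apply_residual (a : ℝ) (B : H₁ →L[𝕜] H₂) (x : H₁) :
    B (residual a B x) = residual a (adj B) (B x) := by
  simp [residual_apply]

theorem adjoint_residual (a : ℝ) (B : H₁ →L[𝕜] H₂) : adj (residual a B) = residual a B := by
  refine Eq.symm ((ContinuousLinearMap.eq_adjoint_iff _ _).2 fun x y => ?_)
  simp [residual_apply, inner_sub_left, inner_sub_right, inner_smul_left, inner_smul_right,
    ContinuousLinearMap.adjoint_inner_left, ContinuousLinearMap.adjoint_inner_right]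

theorem inner_residual_pow (a : ℝ) (B : H₁ →L[𝕜] H₂) (k : ℕ) (x y : H₁) :
    inner 𝕜 x ((residual a B ^ k) y) = inner 𝕜 ((residual a B ^ k) x) y := by
  induction k generalizing x y with
  | zero => simp
  | succ k ih =>
    rw [pow_succ, mul_apply_eq_comp, ih, ← pow_succ, pow_succ',
      mul_apply_eq_comp,
      ← ContinuousLinearMap.adjoint_inner_left, adjoint_residual]

/-- Decay of the iterated residuals under one application of the operator. -/
theorem norm_apply_residual_pow_sq_le {a : ℝ} (ha : 0 < a) {B : H₁ →L[𝕜] H₂}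
    (hB : a * ‖B‖ ^ 2 ≤ 1) (k : ℕ) (x : H₁) :
    a * (k + 1) * ‖B ((residual a B ^ k) x)‖ ^ 2 ≤ ‖x‖ ^ 2 := by
  have hB' : a * ‖adj B‖ ^ 2 ≤ 1 := by simpa using hB
  -- The energy inequality telescopes along the iterates. Since `‖B T^j x‖` decreases in `j`,
  -- because `B T = T' B` with `T'` the contraction built from `B*`, the `k + 1` accumulated terms
  -- are each at least the last one.
  have key : a * (k + 1) * ‖B ((residual a B ^ k) x)‖ ^ 2
      + ‖(residual a B ^ (k + 1)) x‖ ^ 2 ≤ ‖x‖ ^ 2 := by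
    induction k with
    | zero => simpa using norm_residual_sq_le ha hB x
    | succ k ih =>
      have h1 := norm_residual_sq_le ha hB ((residual a B ^ (k + 1)) x)
      rw [← mul_apply_eq_comp, ← pow_succ'] at h1
      have h2 : ‖B ((residual a B ^ (k + 1)) x)‖ ^ 2 ≤ ‖B ((residual a B ^ k) x)‖ ^ 2 := by
        rw [pow_succ' (residual a B), mul_apply_eq_comp, apply_residual]
        gcongr
        exact norm_residual_apply_le ha hB' _
      rw [Nat.cast_succ]
      nlinarith [mul_le_mul_of_nonneg_left h2 (by positivity : 0 ≤ a * ((k : ℝ) + 1))]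
  nlinarith [sq_nonneg ‖(residual a B ^ (k + 1)) x‖]

theorem norm_apply_residual_pow_le {a : ℝ} (ha : 0 < a) {B : H₁ →L[𝕜] H₂}
    (hB : a * ‖B‖ ^ 2 ≤ 1) (k : ℕ) (x : H₁) :
    ‖B ((residual a B ^ k) x)‖ ≤ √(1 / (a * (k + 1))) * ‖x‖ := by
  have h := norm_apply_residual_pow_sq_le ha hB k x
  refine (pow_le_pow_iff_left₀ (norm_nonneg _) (by positivity) two_ne_zero).1 ?_
  rw [mul_pow, Real.sq_sqrt (by positivity), one_div, ← div_eq_inv_mul,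
    le_div_iff₀ (by positivity)]
  linarith

/-- Dual form of the previous decay: `T^k` is self-adjoint, so pairing `T^k B* y` with itself moves
`B T^k` to the other side, and one factor of the norm cancels. -/
theorem norm_residual_pow_adjoint_le {a : ℝ} (ha : 0 < a) {B : H₁ →L[𝕜] H₂}
    (hB : a * ‖B‖ ^ 2 ≤ 1) (k : ℕ) (y : H₂) :
    ‖(residual a B ^ k) (adj B y)‖ ≤ √(1 / (a * (k + 1))) * ‖y‖ := by
  set v := (residual a B ^ k) (adj B y) with hv
  have h1 : ‖v‖ ^ 2 ≤ √(1 / (a * (k + 1))) * ‖v‖ * ‖y‖ := by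
    have h2 : inner 𝕜 v v = inner 𝕜 (B ((residual a B ^ k) v)) y := by
      conv_lhs => rw [hv]
      rw [← hv, inner_residual_pow, ContinuousLinearMap.adjoint_inner_right]
    have h3 : ‖v‖ ^ 2 = ‖inner 𝕜 v v‖ := by
      rw [inner_self_eq_norm_sq_to_K]; simp
    rw [h3, h2]
    exact (norm_inner_le_norm _ _).trans (by gcongr; exact norm_apply_residual_pow_le ha hB k v)
  rcases eq_or_lt_of_le (norm_nonneg v) with h0 | h0
  · rw [← h0]; positivity
  · have : ‖v‖ * ‖v‖ ≤ ‖v‖ * (√(1 / (a * (k + 1))) * ‖y‖) := by nlinarith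
    exact le_of_mul_le_mul_left this h0

/-- One block `T^k` on each side of `B*B` yields a factor `(a(k+1))^{-1/2}` from `B*` and another
from `B`. -/
theorem norm_normal_residual_pow_le {a : ℝ} (ha : 0 < a) {B : H₁ →L[𝕜] H₂}
    (hB : a * ‖B‖ ^ 2 ≤ 1) (k : ℕ) (x : H₁) :
    ‖(residual a B ^ k) (adj B (B ((residual a B ^ k) x)))‖ ≤ 1 / (a * (k + 1)) * ‖x‖ := by
  have h0 : 0 ≤ 1 / (a * ((k : ℝ) + 1)) := by positivity
  calc _ ≤ √(1 / (a * (k + 1))) * ‖B ((residual a B ^ k) x)‖ :=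
        norm_residual_pow_adjoint_le ha hB k _
    _ ≤ √(1 / (a * (k + 1))) * (√(1 / (a * (k + 1))) * ‖x‖) := by
        gcongr; exact norm_apply_residual_pow_le ha hB k x
    _ = _ := by rw [← mul_assoc, Real.mul_self_sqrt h0]

theorem normal_residual_pow_comm (a : ℝ) (B : H₁ →L[𝕜] H₂) (k : ℕ) (x : H₁) :
    adj B (B ((residual a B ^ k) x)) = (residual a B ^ k) (adj B (B x)) := by
  have h1 : ∀ y, adj B (B (residual a B y)) = residual a B (adj B (B y)) := fun y => by
    simp [residual_apply]
  induction k with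
  | zero => simp
  | succ k ih =>
    rw [pow_succ', mul_apply_eq_comp, h1, ih, mul_apply_eq_comp]

/-- The Landweber-Fridman scheme for a general bounded operator. -/
noncomputable def landweberOp (a : ℝ) (m : ℕ) (B : H₁ →L[𝕜] H₂) : H₂ →L[𝕜] H₁ :=
  (a : 𝕜) • ((∑ l ∈ Finset.range (m + 1), residual a B ^ l).comp (adj B))

/-- Telescoping of the geometric sum, with `a B*B = I - T`. This is why a functional in the range of
`B*B` sees the data only through `B*`, with no inversion. -/
theorem normal_landweberOp (a : ℝ) (m : ℕ) (B : H₁ →L[𝕜] H₂) (y : H₂) :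
    adj B (B (landweberOp a m B y)) = adj B y - (residual a B ^ (m + 1)) (adj B y) := by
  have h1 : ∀ z, (a : 𝕜) • adj B (B z) = z - residual a B z := fun z => by
    simp [residual_apply]
  have h2 := mul_neg_geom_sum (residual a B) (m + 1)
  have h3 := congrArg (fun L : H₁ →L[𝕜] H₁ => L (adj B y)) h2
  simp only [mul_apply_eq_comp, sub_apply,
    one_apply_eq_self] at h3
  rw [← h3]
  simp only [landweberOp, smul_apply, ContinuousLinearMap.comp_apply,
    map_smul]
  exact h1 _

theorem landweberOp_apply_sub (a : ℝ) (m : ℕ) (B : H₁ →L[𝕜] H₂) (x : H₁) :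
    landweberOp a m B (B x) - x = -(residual a B ^ (m + 1)) x := by
  have h2 := geom_sum_mul_neg (residual a B) (m + 1)
  have h3 := congrArg (fun L : H₁ →L[𝕜] H₁ => L x) h2
  simp only [mul_apply_eq_comp, sub_apply,
    one_apply_eq_self] at h3
  have h1 : (a : 𝕜) • adj B (B x) = x - residual a B x := by
    simp [residual_apply]
  have h4 : landweberOp a m B (B x)
      = (∑ l ∈ Finset.range (m + 1), residual a B ^ l) (x - residual a B x) := by
    rw [← h1]
    simp only [landweberOp, smul_apply, ContinuousLinearMap.comp_apply,
      map_smul]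
  rw [h4, h3]; abel

/-- Crude count of `m + 1` contractions. The growth in `m` is acceptable because the bound is only
paired with the perturbation of the normal operator, which has size `O(δ)`. -/
theorem norm_landweberOp_apply_le {a : ℝ} (ha : 0 < a) {B : H₁ →L[𝕜] H₂}
    (hB : a * ‖B‖ ^ 2 ≤ 1) (m : ℕ) (y : H₂) :
    ‖landweberOp a m B y‖ ≤ (m + 1) * a * ‖B‖ * ‖y‖ := by
  have h2 : ‖adj B y‖ ≤ ‖B‖ * ‖y‖ := by simpa using (adj B).le_opNorm y
  simp only [landweberOp, smul_apply, ContinuousLinearMap.comp_apply,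
    norm_smul, RCLike.norm_ofReal, abs_of_pos ha, sum_apply]
  have h3 : ‖∑ l ∈ Finset.range (m + 1), (residual a B ^ l) (adj B y)‖
      ≤ (m + 1 : ℕ) * (‖B‖ * ‖y‖) := by
    have := norm_sum_le_of_le (Finset.range (m + 1))
      (f := fun l => (residual a B ^ l) (adj B y)) (n := fun _ => ‖B‖ * ‖y‖)
      (fun l _ => (norm_residual_pow_apply_le ha hB l _).trans h2)
    simpa using this
  calc _ ≤ a * ((m + 1 : ℕ) * (‖B‖ * ‖y‖)) := by gcongr
    _ = _ := by push_cast; ring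

/-- Error of the regularized solution against a functional satisfying a source condition. -/
theorem norm_landweberOp_error_le {a : ℝ} (ha : 0 < a) (A : H₁ →L[𝕜] H₂) {B : H₁ →L[𝕜] H₂}
    (hB : a * ‖B‖ ^ 2 ≤ 1) {m k : ℕ} (hk : 4 * k ≤ m) (ψ χ : H₁) (ε b : H₂) {L δ d : ℝ}
    (hAL : ‖A‖ ≤ L) (hBL : ‖B‖ ≤ L) (hδ : ‖B - A‖ ≤ δ) (hd : d = 1 / (a * (k + 1))) :
    ‖inner 𝕜 (adj A (A ψ)) (landweberOp a m B (B (adj A (A χ)) + ε + b) - adj A (A χ))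
        - inner 𝕜 ψ (adj A ε)‖
      ≤ ‖ψ‖ * (δ + √d + 2 * a * L ^ 2 * (m + 1) * δ) * ‖ε‖
        + ‖ψ‖ * (2 * L + 2 * a * L ^ 2 * (m + 1) * δ) * ‖b‖
        + ‖ψ‖ * ‖χ‖ * (d + 2 * L * δ) ^ 2 := by
  have hδ0 : 0 ≤ δ := (norm_nonneg _).trans hδ
  have hL0 : 0 ≤ L := (norm_nonneg _).trans hAL
  have hd0 : 0 ≤ d := by rw [hd]; positivity
  have hBA : ∀ x, ‖B x - A x‖ ≤ δ * ‖x‖ := fun x =>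
    ((B - A).le_opNorm x).trans (by gcongr)
  have hBAadj : ∀ y, ‖adj B y - adj A y‖ ≤ δ * ‖y‖ := fun y => by
    have h1 : ‖adj B - adj A‖ = ‖B - A‖ := by rw [← map_sub, LinearIsometryEquiv.norm_map]
    have h2 := (adj B - adj A).le_opNorm y
    rw [h1] at h2
    exact h2.trans (by gcongr)
  have hBx : ∀ x, ‖B x‖ ≤ L * ‖x‖ := fun x => (B.le_opNorm x).trans (by gcongr)
  have hAadj : ∀ y, ‖adj A y‖ ≤ L * ‖y‖ := fun y =>
    ((adj A).le_opNorm y).trans (by rw [LinearIsometryEquiv.norm_map]; gcongr)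
  have hBadj : ∀ y, ‖adj B y‖ ≤ L * ‖y‖ := fun y =>
    ((adj B).le_opNorm y).trans (by rw [LinearIsometryEquiv.norm_map]; gcongr)
  -- the difference of the normal operators
  have hD : ∀ x, ∃ r : H₁, adj A (A x) = adj B (B x) + r ∧ ‖r‖ ≤ 2 * L * δ * ‖x‖ := by
    intro x
    refine ⟨adj A (A x) - adj B (B x), by abel, ?_⟩
    have : adj A (A x) - adj B (B x)
        = -(adj A (B x - A x)) - (adj B (B x) - adj A (B x)) := by
      rw [map_sub]; abel
    rw [this]
    calc _ ≤ ‖adj A (B x - A x)‖ + ‖adj B (B x) - adj A (B x)‖ := by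
          refine (norm_sub_le _ _).trans ?_; rw [norm_neg]
      _ ≤ L * (δ * ‖x‖) + δ * (L * ‖x‖) := by
          gcongr
          · exact (hAadj _).trans (by gcongr; exact hBA x)
          · exact (hBAadj _).trans (by gcongr; exact hBx x)
      _ = _ := by ring
  obtain ⟨r, hr, hrn⟩ := hD ψ
  obtain ⟨r', hr', hrn'⟩ := hD χ
  have hT : ∀ x, (residual a B ^ (m + 1)) x
      = (residual a B ^ (m + 1 - 4 * k)) ((residual a B ^ (4 * k)) x) := fun x => by
    rw [← mul_apply_eq_comp, ← pow_add]; congr 2; omega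
  have hTe : ∀ y, ‖(residual a B ^ (m + 1)) (adj B y)‖ ≤ √d * ‖y‖ := fun y => by
    have h1 : (residual a B ^ (m + 1)) (adj B y)
        = (residual a B ^ (m + 1 - k)) ((residual a B ^ k) (adj B y)) := by
      rw [← mul_apply_eq_comp, ← pow_add]; congr 2; omega
    rw [h1, hd]
    exact (norm_residual_pow_apply_le ha hB _ _).trans (norm_residual_pow_adjoint_le ha hB k y)
  -- the contribution of the data
  have hdata : ∀ y, inner 𝕜 (adj A (A ψ)) (landweberOp a m B y)
      = inner 𝕜 ψ (adj B y) - inner 𝕜 ψ ((residual a B ^ (m + 1)) (adj B y))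
        + inner 𝕜 r (landweberOp a m B y) := fun y => by
    rw [hr, inner_add_left, ContinuousLinearMap.adjoint_inner_left,
      ← ContinuousLinearMap.adjoint_inner_right, normal_landweberOp, inner_sub_right]
  have hR : ∀ y, ‖inner 𝕜 r (landweberOp a m B y)‖
      ≤ ‖ψ‖ * (2 * a * L ^ 2 * (m + 1) * δ) * ‖y‖ := fun y => by
    calc _ ≤ ‖r‖ * ‖landweberOp a m B y‖ := norm_inner_le_norm _ _
      _ ≤ (2 * L * δ * ‖ψ‖) * ((m + 1) * a * L * ‖y‖) := by
          gcongr
          exact (norm_landweberOp_apply_le ha hB m y).trans (by gcongr)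
      _ = _ := by ring
  -- the regularization bias
  have hSS : ∀ x, ‖(residual a B ^ (m + 1)) (adj B (B x))‖ ≤ d * ‖x‖ := fun x => by
    have h1 : (residual a B ^ (m + 1)) (adj B (B x)) = (residual a B ^ (m + 1 - 2 * k))
        ((residual a B ^ k) (adj B (B ((residual a B ^ k) x)))) := by
      rw [normal_residual_pow_comm]
      simp only [← mul_apply_eq_comp, ← pow_add]; congr 2; omega
    rw [h1, hd]
    exact (norm_residual_pow_apply_le ha hB _ _).trans (norm_normal_residual_pow_le ha hB k x)
  -- The condition `4k ≤ m` is used here: four blocks `T^k` are taken out of `T^{m+1}`, two around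
  -- each copy of `B*B`, and each copy then contributes a factor `d`.
  have hSSSS : ‖inner 𝕜 (adj B (B ψ)) ((residual a B ^ (m + 1)) (adj B (B χ)))‖
      ≤ d * ‖ψ‖ * (d * ‖χ‖) := by
    have h1 : inner 𝕜 (adj B (B ψ)) ((residual a B ^ (m + 1)) (adj B (B χ)))
        = inner 𝕜 ((residual a B ^ k) (adj B (B ((residual a B ^ k) ψ))))
          ((residual a B ^ (m + 1 - 4 * k))
            ((residual a B ^ k) (adj B (B ((residual a B ^ k) χ))))) := by
      rw [normal_residual_pow_comm, normal_residual_pow_comm, ← inner_residual_pow,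
        ← inner_residual_pow]
      simp only [← mul_apply_eq_comp, ← pow_add]; congr 3; omega
    rw [h1]
    refine (norm_inner_le_norm _ _).trans ?_
    have h2 := norm_normal_residual_pow_le ha hB k ψ
    have h3 := norm_normal_residual_pow_le ha hB k χ
    rw [← hd] at h2 h3
    gcongr
    exact (norm_residual_pow_apply_le ha hB _ _).trans h3
  -- Both copies of `A*A` are `B*B` plus a remainder of relative size `2Lδ`. The four products have
  -- the size of the terms of `(d + 2Lδ)²`.
  have hbias : ‖inner 𝕜 (adj A (A ψ)) ((residual a B ^ (m + 1)) (adj A (A χ)))‖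
      ≤ ‖ψ‖ * ‖χ‖ * (d + 2 * L * δ) ^ 2 := by
    rw [hr, hr', map_add, inner_add_left, inner_add_right, inner_add_right]
    have e1 : ‖inner 𝕜 (adj B (B ψ)) ((residual a B ^ (m + 1)) r')‖
        ≤ (d * ‖ψ‖) * (2 * L * δ * ‖χ‖) := by
      rw [inner_residual_pow]
      exact (norm_inner_le_norm _ _).trans (by gcongr; exact hSS ψ)
    have e2 : ‖inner 𝕜 r ((residual a B ^ (m + 1)) (adj B (B χ)))‖
        ≤ (2 * L * δ * ‖ψ‖) * (d * ‖χ‖) :=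
      (norm_inner_le_norm _ _).trans (by gcongr; exact hSS χ)
    have e3 : ‖inner 𝕜 r ((residual a B ^ (m + 1)) r')‖
        ≤ (2 * L * δ * ‖ψ‖) * (2 * L * δ * ‖χ‖) :=
      (norm_inner_le_norm _ _).trans (by
        gcongr; exact (norm_residual_pow_apply_le ha hB _ _).trans hrn')
    calc _ ≤ (‖inner 𝕜 (adj B (B ψ)) ((residual a B ^ (m + 1)) (adj B (B χ)))‖
          + ‖inner 𝕜 (adj B (B ψ)) ((residual a B ^ (m + 1)) r')‖)
          + (‖inner 𝕜 r ((residual a B ^ (m + 1)) (adj B (B χ)))‖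
          + ‖inner 𝕜 r ((residual a B ^ (m + 1)) r')‖) :=
          (norm_add_le _ _).trans (add_le_add (norm_add_le _ _) (norm_add_le _ _))
      _ ≤ (d * ‖ψ‖ * (d * ‖χ‖) + (d * ‖ψ‖) * (2 * L * δ * ‖χ‖))
          + ((2 * L * δ * ‖ψ‖) * (d * ‖χ‖) + (2 * L * δ * ‖ψ‖) * (2 * L * δ * ‖χ‖)) := by
          gcongr
      _ = _ := by ring
  -- The centring `⟨ψ, A*ε⟩` cancels against `⟨ψ, B*ε⟩` up to the difference of the adjoints.
  -- Nothing is subtracted for `b`, so its leading term `⟨ψ, B*b⟩` stays in the error.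
  have hsplit : inner 𝕜 (adj A (A ψ))
        (landweberOp a m B (B (adj A (A χ)) + ε + b) - adj A (A χ)) - inner 𝕜 ψ (adj A ε)
      = (inner 𝕜 ψ (adj B ε - adj A ε) - inner 𝕜 ψ ((residual a B ^ (m + 1)) (adj B ε))
          + inner 𝕜 r (landweberOp a m B ε))
        + (inner 𝕜 ψ (adj B b) - inner 𝕜 ψ ((residual a B ^ (m + 1)) (adj B b))
          + inner 𝕜 r (landweberOp a m B b))
        + -inner 𝕜 (adj A (A ψ)) ((residual a B ^ (m + 1)) (adj A (A χ))) := by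
    have h1 : landweberOp a m B (B (adj A (A χ)) + ε + b) - adj A (A χ)
        = landweberOp a m B ε + landweberOp a m B b
          + -(residual a B ^ (m + 1)) (adj A (A χ)) := by
      rw [← landweberOp_apply_sub, map_add, map_add]; abel
    rw [h1, inner_add_right, inner_add_right, hdata ε, hdata b, inner_neg_right, inner_sub_right]
    ring
  rw [hsplit]
  have f1 : ‖inner 𝕜 ψ (adj B ε - adj A ε)‖ ≤ ‖ψ‖ * (δ * ‖ε‖) :=
    (norm_inner_le_norm _ _).trans (by gcongr; exact hBAadj ε)
  have f2 : ‖inner 𝕜 ψ ((residual a B ^ (m + 1)) (adj B ε))‖ ≤ ‖ψ‖ * (√d * ‖ε‖) :=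
    (norm_inner_le_norm _ _).trans (by gcongr; exact hTe ε)
  have f3 : ‖inner 𝕜 ψ (adj B b)‖ ≤ ‖ψ‖ * (L * ‖b‖) :=
    (norm_inner_le_norm _ _).trans (by gcongr; exact hBadj b)
  have f4 : ‖inner 𝕜 ψ ((residual a B ^ (m + 1)) (adj B b))‖ ≤ ‖ψ‖ * (L * ‖b‖) :=
    (norm_inner_le_norm _ _).trans (by
      gcongr; exact (norm_residual_pow_apply_le ha hB _ _).trans (hBadj b))
  have f5 := hR ε
  have f6 := hR b
  refine (norm_add_le _ _).trans ?_
  rw [norm_neg]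
  refine add_le_add ((norm_add_le _ _).trans (add_le_add ?_ ?_)) hbias
  · refine (norm_add_le _ _).trans ((add_le_add_left (norm_sub_le _ _) _).trans ?_)
    calc _ ≤ ‖ψ‖ * (δ * ‖ε‖) + ‖ψ‖ * (√d * ‖ε‖)
        + ‖ψ‖ * (2 * a * L ^ 2 * (m + 1) * δ) * ‖ε‖ := by gcongr
      _ = _ := by ring
  · refine (norm_add_le _ _).trans ((add_le_add_left (norm_sub_le _ _) _).trans ?_)
    calc _ ≤ ‖ψ‖ * (L * ‖b‖) + ‖ψ‖ * (L * ‖b‖)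
        + ‖ψ‖ * (2 * a * L ^ 2 * (m + 1) * δ) * ‖b‖ := by gcongr
      _ = _ := by ring

end Landweber

/-! ### Source conditions and the range of the normal operator. -/

section Source

variable {𝕜 : Type*} [RCLike 𝕜] {X T : Type*} [MeasurableSpace X] [MeasurableSpace T]
  {ν : Measure X} {μ : Measure T}

theorem landweber_eq_landweberOp (a : ℝ) (m : ℕ) (A : Lp 𝕜 2 ν →L[𝕜] Lp 𝕜 2 μ) :
    landweber a m A = landweberOp a m A := rfl

/-- A source condition of order at least two puts a vector in the range of `A* A`. -/
theorem IsSingularSystem.exists_normal_eq {J : Type*} {A : Lp 𝕜 2 ν →L[𝕜] Lp 𝕜 2 μ}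
    {lam : J → ℝ} {e : J → Lp 𝕜 2 ν} {f : J → Lp 𝕜 2 μ} (h : IsSingularSystem A lam e f)
    (hA : Function.Injective A) {γ : ℝ} (hγ : 2 ≤ γ) (φ : Lp 𝕜 2 ν)
    (hφ : Summable fun j => ‖inner 𝕜 (e j) φ‖ ^ 2 / lam j ^ (2 * γ)) :
    ∃ ψ, ContinuousLinearMap.adjoint A (A ψ) = φ := by
  have hlam : ∀ j, lam j ≤ ‖A‖ := fun j => by
    have h1 := A.le_opNorm (e j)
    rw [h.apply_left, norm_smul, h.orthonormal_left.1, h.orthonormal_right.1,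
      RCLike.norm_ofReal, abs_of_pos (h.pos j)] at h1
    linarith
  -- The preimage has coefficients `⟨e_j, φ⟩ / λ_j²`. They are square summable because `λ_j ≤ ‖A‖`
  -- and `2γ - 4 ≥ 0` give `λ_j⁻⁴ ≤ ‖A‖^{2γ-4} λ_j^{-2γ}`.
  have hsq : Summable fun j => ‖inner 𝕜 (e j) φ / ((lam j : 𝕜) ^ 2)‖ ^ 2 := by
    refine Summable.of_nonneg_of_le (fun j => by positivity) (fun j => ?_)
      (hφ.mul_left (‖A‖ ^ (2 * γ - 4)))
    have hp := h.pos j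
    have h4 : lam j ^ (2 * γ) = lam j ^ (2 * γ - 4) * lam j ^ 4 := by
      rw [← Real.rpow_natCast, ← Real.rpow_add hp]; congr 1; push_cast; ring
    have h5 : lam j ^ (2 * γ - 4) ≤ ‖A‖ ^ (2 * γ - 4) :=
      Real.rpow_le_rpow hp.le (hlam j) (by linarith)
    have h6 : 0 < lam j ^ (2 * γ - 4) := Real.rpow_pos_of_pos hp _
    rw [norm_div, norm_pow, RCLike.norm_ofReal, abs_of_pos hp, div_pow, h4, ← pow_mul,
      ← mul_div_assoc, div_le_div_iff₀ (by positivity) (by positivity)]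
    have h7 := mul_le_mul_of_nonneg_left h5 (by positivity : 0 ≤ ‖inner 𝕜 (e j) φ‖ ^ 2 * lam j ^ 4)
    norm_num
    linarith
  have hsum : ∀ c : J → 𝕜, Summable (fun j => ‖c j‖ ^ 2) → Summable fun j => c j • e j := by
    intro c hc
    have := (h.orthonormal_left.orthogonalFamily.summable_iff_norm_sq_summable c).2 hc
    simpa using this
  have hψ := (hsum _ hsq).hasSum
  set ψ := ∑' j, (inner 𝕜 (e j) φ / ((lam j : 𝕜) ^ 2)) • e j with hψdef
  refine ⟨ψ, ?_⟩
  have h1 : HasSum (fun j => inner 𝕜 (e j) φ • e j) (ContinuousLinearMap.adjoint A (A ψ)) := by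
    have := ((ContinuousLinearMap.adjoint A).comp A).hasSum hψ
    refine this.congr_fun fun j => ?_
    have hp : (lam j : 𝕜) ≠ 0 := by exact_mod_cast (h.pos j).ne'
    simp only [map_smul, ContinuousLinearMap.comp_apply]
    rw [h.apply_left, map_smul, h.adjoint_apply_right, smul_smul, smul_smul]
    congr 1; field_simp
  set θ := ContinuousLinearMap.adjoint A (A ψ)
  have h2 : ∀ i, inner 𝕜 (e i) (φ - θ) = 0 := by
    intro i
    have h3 := h1.mapL (innerSL 𝕜 (e i))
    have h4 : HasSum (fun j => innerSL 𝕜 (e i) (inner 𝕜 (e j) φ • e j))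
        (innerSL 𝕜 (e i) (inner 𝕜 (e i) φ • e i)) := by
      refine hasSum_single i fun j hj => ?_
      simp [h.orthonormal_left.2 hj.symm]
    have h5 := h3.unique h4
    simp only [innerSL_apply_apply, inner_smul_right] at h5
    rw [inner_sub_right, h5, inner_self_eq_norm_sq_to_K, h.orthonormal_left.1]
    simp
  -- The system `e` is not assumed complete. The difference is orthogonal to every `e_j`, so the
  -- singular expansion of its image vanishes, and injectivity of `A` finishes.
  have h3 : A (φ - θ) = 0 := by
    refine (h.hasSum_apply (φ - θ)).unique ?_
    simp only [h2, mul_zero, zero_smul]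
    exact hasSum_zero
  have h4 := hA (h3.trans (map_zero A).symm)
  exact (sub_eq_zero.1 h4).symm

theorem normal_injective {A : Lp 𝕜 2 ν →L[𝕜] Lp 𝕜 2 μ} (hA : Function.Injective A) :
    Function.Injective fun ψ => ContinuousLinearMap.adjoint A (A ψ) := by
  intro x y hxy
  have h1 : ContinuousLinearMap.adjoint A (A (x - y)) = 0 := by
    simpa [sub_eq_zero] using hxy
  have h2 : inner 𝕜 (A (x - y)) (A (x - y)) = 0 := by
    rw [← ContinuousLinearMap.adjoint_inner_right, h1, inner_zero_right]
  have h3 := hA ((inner_self_eq_zero.1 h2).trans (map_zero A).symm)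
  exact sub_eq_zero.1 h3

end Source


/-! ### Taylor remainders controlled by function values. -/

section Taylor

variable {F : Type*} [NormedAddCommGroup F] [NormedSpace ℝ F] {d : ℕ}

/-- Interpolation nodes in the open unit interval. -/
noncomputable def node (b : ℕ) (k : Fin b) : ℝ := ((k : ℝ) + 1) / (b + 1)

theorem node_pos (b : ℕ) (k : Fin b) : 0 < node b k := by unfold node; positivity

theorem node_le_one (b : ℕ) (k : Fin b) : node b k ≤ 1 := by
  unfold node
  rw [div_le_one (by positivity)]
  have : (k : ℝ) ≤ b := by exact_mod_cast k.2.le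
  linarith

theorem node_injective (b : ℕ) : Function.Injective (node b) := by
  intro i j hij
  unfold node at hij
  have hb : ((b : ℝ) + 1) ≠ 0 := by positivity
  rw [div_left_inj' hb] at hij
  exact Fin.ext (by exact_mod_cast add_right_cancel hij)

variable (F) in
/-- The coefficients of a vector-valued polynomial are controlled by its values at the nodes. -/
theorem exists_coeff_le (b : ℕ) : ∃ Λ : ℝ, 0 ≤ Λ ∧ ∀ (c : ℕ → F) (j : ℕ), j < b →
    ‖c j‖ ≤ Λ * ∑ k : Fin b, ‖∑ i ∈ Finset.range b, node b k ^ i • c i‖ := by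
  -- Distinct nodes make the Vandermonde matrix invertible. The sum of the absolute entries of its
  -- inverse serves for every coefficient at once.
  set V := Matrix.vandermonde (node b) with hV
  have hdet : IsUnit V.det :=
    isUnit_iff_ne_zero.2 (Matrix.det_vandermonde_ne_zero_iff.2 (node_injective b))
  have hinv : V⁻¹ * V = 1 := Matrix.nonsing_inv_mul V hdet
  refine ⟨∑ i, ∑ k, |V⁻¹ i k|, by positivity, fun c j hj => ?_⟩
  have h1 : c j = ∑ k : Fin b, V⁻¹ ⟨j, hj⟩ k • ∑ i ∈ Finset.range b, node b k ^ i • c i := by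
    simp only [Finset.sum_range, Finset.smul_sum, smul_smul]
    rw [Finset.sum_comm]
    have h2 : ∀ i : Fin b, ∑ k, (V⁻¹ ⟨j, hj⟩ k * node b k ^ (i : ℕ)) • c i
        = (if (⟨j, hj⟩ : Fin b) = i then (1 : ℝ) else 0) • c i := fun i => by
      rw [← Finset.sum_smul]
      congr 1
      have := congrFun (congrFun hinv ⟨j, hj⟩) i
      rw [Matrix.mul_apply, Matrix.one_apply] at this
      exact this
    simp only [h2, ite_smul, one_smul, zero_smul]
    rw [Finset.sum_ite_eq]
    simp
  rw [h1]
  refine (norm_sum_le _ _).trans ?_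
  rw [Finset.mul_sum]
  refine Finset.sum_le_sum fun k _ => ?_
  rw [norm_smul, Real.norm_eq_abs]
  gcongr
  calc |V⁻¹ ⟨j, hj⟩ k| ≤ ∑ k, |V⁻¹ ⟨j, hj⟩ k| :=
        Finset.single_le_sum (f := fun k => |V⁻¹ ⟨j, hj⟩ k|) (fun _ _ => abs_nonneg _)
          (Finset.mem_univ k)
    _ ≤ _ := Finset.single_le_sum (f := fun i => ∑ k, |V⁻¹ i k|)
          (fun _ _ => Finset.sum_nonneg fun _ _ => abs_nonneg _) (Finset.mem_univ _)

/-- The term of degree `j` of the Taylor polynomial of `g` at `x`. -/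
noncomputable def taylorTerm (g : Euc d → F) (j : ℕ) (x v : Euc d) : F :=
  ((Nat.factorial j : ℝ)⁻¹) • iteratedFDeriv ℝ j g x (fun _ => v)

theorem taylorTerm_smul (g : Euc d → F) (j : ℕ) (x v : Euc d) (c : ℝ) :
    taylorTerm g j x (c • v) = c ^ j • taylorTerm g j x v := by
  unfold taylorTerm
  rw [ContinuousMultilinearMap.map_smul_univ (iteratedFDeriv ℝ j g x) (fun _ => c) (fun _ => v)]
  simp only [Finset.prod_const, Finset.card_univ, Fintype.card_fin]
  rw [smul_comm]

theorem taylorTerm_zero (g : Euc d → F) (x v : Euc d) : taylorTerm g 0 x v = g x := by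
  simp [taylorTerm]

theorem sum_range_taylorTerm {n : ℕ} (hn : 1 ≤ n) (g : Euc d → F) (x v : Euc d) :
    ∑ j ∈ Finset.range n, taylorTerm g j x v
      = g x + ∑ j ∈ Finset.Ico 1 n, taylorTerm g j x v := by
  rw [Finset.range_eq_Ico, Finset.sum_eq_sum_Ico_succ_bot (by omega), taylorTerm_zero]

/-- Taylor expansion of degree `b - 1` at `x` with remainder `η |y - x|^υ` on the `R`-ball. -/
def TaylorAt (b : ℕ) (υ R η : ℝ) (g : Euc d → F) (x : Euc d) : Prop :=
  ∀ y, ‖y - x‖ < R →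
    ‖g y - g x - ∑ j ∈ Finset.Ico 1 b, taylorTerm g j x (y - x)‖ ≤ η * ‖y - x‖ ^ υ

theorem TaylorAt.norm_sub_le {b : ℕ} (hb : 1 ≤ b) {υ R η : ℝ} {g : Euc d → F} {x : Euc d}
    (h : TaylorAt b υ R η g x) {v : Euc d} (hv : ‖v‖ < R) :
    ‖g (x + v) - ∑ j ∈ Finset.range b, taylorTerm g j x v‖ ≤ η * ‖v‖ ^ υ := by
  have h1 := h (x + v) (by simpa using hv)
  rw [add_sub_cancel_left] at h1
  rwa [Finset.range_eq_Ico, Finset.sum_eq_sum_Ico_succ_bot (by omega), taylorTerm_zero,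
    ← sub_sub]

variable (F) in
/-- Taylor coefficients are controlled by the values of the function at nearby points. -/
theorem exists_taylorTerm_le (b : ℕ) (hb : 1 ≤ b) {υ : ℝ} (hυ : 0 ≤ υ) {r : ℝ} (hr : 0 < r) :
    ∃ C : ℝ, 0 ≤ C ∧ ∀ (d : ℕ) (R η : ℝ) (g : Euc d → F) (x v : Euc d), r < R → 0 ≤ η →
      TaylorAt b υ R η g x → ‖v‖ ≤ r → ∀ j < b,
      ‖taylorTerm g j x v‖ ≤ C * (∑ k : Fin b, ‖g (x + node b k • v)‖ + η) := by
  obtain ⟨Λ, hΛ, hc⟩ := exists_coeff_le F b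
  -- Along the ray through `v` the Taylor polynomial is a polynomial in the parameter whose
  -- coefficients are the Taylor terms. At each of the `b` nodes it differs from `g` by at most `η
  -- r^υ`.
  refine ⟨Λ * (1 + b * r ^ υ), by positivity, fun d R η g x v hR hη hT hv j hj => ?_⟩
  have h1 : ∀ k : Fin b, ‖∑ i ∈ Finset.range b, node b k ^ i • taylorTerm g i x v‖
      ≤ ‖g (x + node b k • v)‖ + η * r ^ υ := fun k => by
    have hkv : ‖node b k • v‖ ≤ r := by
      rw [norm_smul, Real.norm_eq_abs, abs_of_pos (node_pos b k)]
      exact (mul_le_of_le_one_left (norm_nonneg _) (node_le_one b k)).trans hv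
    have h2 := hT.norm_sub_le hb (v := node b k • v) (hkv.trans_lt hR)
    simp only [taylorTerm_smul] at h2
    have h3 : η * ‖node b k • v‖ ^ υ ≤ η * r ^ υ := by gcongr
    have h4 := norm_sub_norm_le (∑ i ∈ Finset.range b, node b k ^ i • taylorTerm g i x v)
      (g (x + node b k • v))
    rw [norm_sub_rev] at h4
    linarith
  refine (hc (fun i => taylorTerm g i x v) j hj).trans ?_
  rw [mul_assoc]
  gcongr
  refine (Finset.sum_le_sum fun k _ => h1 k).trans ?_
  rw [Finset.sum_add_distrib]
  simp only [Finset.sum_const, Finset.card_univ, Fintype.card_fin, nsmul_eq_mul]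
  have h5 : 0 ≤ ∑ k : Fin b, ‖g (x + node b k • v)‖ := by positivity
  have h6 : 0 ≤ (b : ℝ) * r ^ υ := by positivity
  nlinarith [mul_nonneg h6 h5]

variable (F) in
/-- Taylor remainder of a lower degree, controlled everywhere by values of the function. -/
theorem exists_taylor_remainder_le {b ρ : ℕ} (hρ : 1 ≤ ρ) (hρb : ρ < b) {υ : ℝ}
    (hυ : (ρ : ℝ) < υ) {r : ℝ} (hr : 0 < r) :
    ∃ C : ℝ, 0 ≤ C ∧ ∀ (d : ℕ) (R η : ℝ) (g : Euc d → F) (x : Euc d), r < R → 0 ≤ η →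
      TaylorAt b υ R η g x → ∀ y,
      ‖g (x + y) - g x - ∑ j ∈ Finset.Ico 1 ρ, taylorTerm g j x y‖
        ≤ (if r ≤ ‖y‖ then ‖g (x + y)‖ else 0)
          + C * ‖y‖ ^ ρ * (∑ k : Fin b, ‖g (x + node b k • (r / ‖y‖) • y)‖ + η) := by
  have hυ0 : 0 ≤ υ := (Nat.cast_nonneg ρ).trans hυ.le
  obtain ⟨C, hC, hCt⟩ := exists_taylorTerm_le F b (by omega) hυ0 hr
  -- With `v` the vector of length `r` in the direction of `y` and `s = ‖y‖ / r`, the term of degree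
  -- `j` at `y` is at most `s^j C M`. It remains to compare `s^j` with `s^ρ`; dividing by `r^ρ`
  -- turns `s^ρ` into `‖y‖^ρ`.
  refine ⟨(b * C + r ^ υ) / r ^ ρ, by positivity, fun d R η g x hR hη hT y => ?_⟩
  set v := (r / ‖y‖) • y with hv
  set M := ∑ k : Fin b, ‖g (x + node b k • v)‖ + η with hM
  have hM0 : 0 ≤ M := by positivity
  have hηM : η ≤ M := by
    have : 0 ≤ ∑ k : Fin b, ‖g (x + node b k • v)‖ := by positivity
    linarith
  rcases eq_or_ne y 0 with rfl | hy
  · have h0 : ∑ j ∈ Finset.Ico 1 ρ, taylorTerm g j x 0 = 0 := by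
      refine Finset.sum_eq_zero fun j hj => ?_
      have := taylorTerm_smul g j x 0 0
      rw [zero_smul] at this
      rw [this, zero_pow (by have := (Finset.mem_Ico.1 hj).1; omega), zero_smul]
    rw [h0]
    have h1 : (0 : ℝ) ≤ if r ≤ ‖(0 : Euc d)‖ then ‖g (x + 0)‖ else 0 := by
      split_ifs <;> positivity
    simp only [add_zero, sub_self, norm_zero, ge_iff_le] at h1 ⊢
    have : (0 : ℝ) ^ ρ = 0 := zero_pow (by omega)
    rw [this]
    linarith [h1]
  have hy0 : 0 < ‖y‖ := norm_pos_iff.2 hy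
  have hvr : ‖v‖ ≤ r := by
    rw [hv, norm_smul, norm_div, norm_norm, Real.norm_eq_abs, abs_of_pos hr,
      div_mul_cancel₀ _ hy0.ne']
  set s := ‖y‖ / r with hs
  have hs0 : 0 < s := div_pos hy0 hr
  have hysv : y = s • v := by
    rw [hv, smul_smul, hs, div_mul_div_comm, mul_comm, div_self (by positivity), one_smul]
  have ht : ∀ j < b, ‖taylorTerm g j x y‖ ≤ s ^ j * (C * M) := fun j hj => by
    conv_lhs => rw [hysv, taylorTerm_smul]
    rw [norm_smul, norm_pow, Real.norm_eq_abs, abs_of_pos hs0]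
    gcongr
    exact hCt d R η g x v hR hη hT hvr j hj
  have hgoal : (b * C + r ^ υ) / r ^ ρ * ‖y‖ ^ ρ * M = s ^ ρ * ((b * C + r ^ υ) * M) := by
    rw [hs, div_pow]; ring
  rw [hgoal]
  have hru : 0 ≤ r ^ υ := by positivity
  split_ifs with hry
  -- Outside the `r`-ball the expansion says nothing about `g(x + y)`, which is kept as it is. The
  -- remaining terms have degree below `ρ`, so `s^j ≤ s^ρ`.
  · have hs1 : 1 ≤ s := by rwa [hs, one_le_div hr]
    have h1 : ‖∑ j ∈ Finset.range ρ, taylorTerm g j x y‖ ≤ s ^ ρ * (b * C * M) := by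
      refine (norm_sum_le_of_le _ (n := fun _ => s ^ ρ * (C * M)) fun j hj => ?_).trans ?_
      · have hj' := Finset.mem_range.1 hj
        refine (ht j (by omega)).trans ?_
        gcongr
      · rw [Finset.sum_const, Finset.card_range, nsmul_eq_mul]
        have : (ρ : ℝ) ≤ b := by exact_mod_cast hρb.le
        calc (ρ : ℝ) * (s ^ ρ * (C * M)) ≤ b * (s ^ ρ * (C * M)) := by gcongr
          _ = _ := by ring
    have h2 : g (x + y) - g x - ∑ j ∈ Finset.Ico 1 ρ, taylorTerm g j x y
        = g (x + y) - ∑ j ∈ Finset.range ρ, taylorTerm g j x y := by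
      rw [sum_range_taylorTerm hρ, ← sub_sub]
    rw [h2]
    refine (_root_.norm_sub_le _ _).trans ?_
    gcongr
    refine h1.trans ?_
    gcongr
    linarith
  -- Inside the ball the full expansion applies. What exceeds degree `ρ - 1` consists of terms of
  -- degree `j ≥ ρ`, for which `s^j ≤ s^ρ`, and of the remainder of order `υ > ρ`.
  · have hs1 : s ≤ 1 := by rw [hs, div_le_one hr]; linarith
    have h0 := hT.norm_sub_le (by omega) (v := y) (by linarith)
    have h1 : ‖∑ j ∈ Finset.Ico ρ b, taylorTerm g j x y‖ ≤ s ^ ρ * (b * C * M) := by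
      refine (norm_sum_le_of_le _ (n := fun _ => s ^ ρ * (C * M)) fun j hj => ?_).trans ?_
      · have hj' := Finset.mem_Ico.1 hj
        refine (ht j hj'.2).trans ?_
        gcongr ?_ * _
        exact pow_le_pow_of_le_one hs0.le hs1 hj'.1
      · rw [Finset.sum_const, Nat.card_Ico, nsmul_eq_mul]
        have : ((b - ρ : ℕ) : ℝ) ≤ b := by exact_mod_cast Nat.sub_le _ _
        calc ((b - ρ : ℕ) : ℝ) * (s ^ ρ * (C * M)) ≤ b * (s ^ ρ * (C * M)) := by gcongr
          _ = _ := by ring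
    have h2 : g (x + y) - g x - ∑ j ∈ Finset.Ico 1 ρ, taylorTerm g j x y
        = (g (x + y) - ∑ j ∈ Finset.range b, taylorTerm g j x y)
          + ∑ j ∈ Finset.Ico ρ b, taylorTerm g j x y := by
      rw [← Finset.sum_range_add_sum_Ico _ hρb.le, sum_range_taylorTerm hρ]
      abel
    have h3 : η * ‖y‖ ^ υ ≤ s ^ ρ * (r ^ υ * M) := by
      have h4 : ‖y‖ = s * r := by rw [hs, div_mul_cancel₀ _ hr.ne']
      rw [h4, Real.mul_rpow hs0.le hr.le]
      have h5 : s ^ υ ≤ s ^ ρ := by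
        rw [← Real.rpow_natCast]
        exact Real.rpow_le_rpow_of_exponent_ge hs0 hs1 hυ.le
      calc η * (s ^ υ * r ^ υ) ≤ M * (s ^ ρ * r ^ υ) := by gcongr
        _ = _ := by ring
    rw [h2, zero_add]
    refine (norm_add_le _ _).trans ?_
    calc _ ≤ s ^ ρ * (r ^ υ * M) + s ^ ρ * (b * C * M) := add_le_add (h0.trans h3) h1
      _ = _ := by ring

end Taylor

/-! ### Moment kernels and the pointwise smoothing bias. -/

section Kernel

variable {d : ℕ}

/-- A kernel with unit mass and vanishing moments of degree `1, …, ρ - 1`. -/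
structure MomentKernel (ρ : ℕ) (K : Euc d → ℝ) : Prop where
  integrable : Integrable K volume
  integral_eq_one : ∫ u, K u = 1
  integrable_pow : Integrable (fun u => ‖u‖ ^ ρ * |K u|) volume
  moment : ∀ s : Fin d → ℕ, 0 < ∑ i, s i → ∑ i, s i < ρ → ∫ u, (∏ i, u i ^ s i) * K u = 0

/-- Pointwise symmetry need not survive a change on a null set; the properties kept here depend only
on the almost everywhere class. This permits passing to a measurable version of the kernel. -/
theorem IsKernelOfOrder.momentKernel {ρ : ℕ} {K K' : Euc d → ℝ} (h : IsKernelOfOrder ρ K)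
    (hKK' : K =ᵐ[volume] K') : MomentKernel ρ K' where
  integrable := h.2.1.congr hKK'
  integral_eq_one := by rw [← h.2.2.1]; exact integral_congr_ae hKK'.symm
  integrable_pow := h.2.2.2.1.congr (by filter_upwards [hKK'] with u hu; rw [hu])
  moment s hs hs' := by
    rw [← h.2.2.2.2 s hs hs']
    exact integral_congr_ae (by filter_upwards [hKK'] with u hu; rw [hu])

variable {F : Type*} [NormedAddCommGroup F] [NormedSpace ℝ F]

theorem MomentKernel.integrable_pow_of_le {ρ : ℕ} {K : Euc d → ℝ} (hK : MomentKernel ρ K) {j : ℕ}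
    (hj : j ≤ ρ) : Integrable (fun u => ‖u‖ ^ j * |K u|) volume := by
  refine (hK.integrable.abs.add hK.integrable_pow).mono'
    ((continuous_norm.pow j).aestronglyMeasurable.mul hK.integrable.1.norm)
    (Eventually.of_forall fun u => ?_)
  rw [Real.norm_eq_abs, abs_of_nonneg (by positivity), Pi.add_apply]
  rcases le_total ‖u‖ 1 with h1 | h1
  · have h2 : ‖u‖ ^ j ≤ 1 := pow_le_one₀ (norm_nonneg _) h1
    nlinarith [abs_nonneg (K u), mul_le_mul_of_nonneg_right h2 (abs_nonneg (K u)),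
      (by positivity : 0 ≤ ‖u‖ ^ ρ * |K u|)]
  · have h2 : ‖u‖ ^ j ≤ ‖u‖ ^ ρ := pow_le_pow_right₀ h1 hj
    nlinarith [abs_nonneg (K u), mul_le_mul_of_nonneg_right h2 (abs_nonneg (K u))]

theorem MomentKernel.integrable_taylorTerm {ρ : ℕ} {K : Euc d → ℝ} (hK : MomentKernel ρ K) {j : ℕ}
    (hj : j ≤ ρ) (g : Euc d → F) (x : Euc d) (c : ℝ) :
    Integrable (fun u => K u • taylorTerm g j x (c • u)) volume := by
  have hcont : Continuous fun u => taylorTerm g j x (c • u) := by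
    unfold taylorTerm
    exact ((iteratedFDeriv ℝ j g x).cont.comp (by fun_prop)).const_smul _
  refine ((hK.integrable_pow_of_le hj).const_mul
    (|c| ^ j * ((Nat.factorial j : ℝ)⁻¹ * ‖iteratedFDeriv ℝ j g x‖))).mono'
    (hK.integrable.1.smul hcont.aestronglyMeasurable) (Eventually.of_forall fun u => ?_)
  rw [taylorTerm_smul, norm_smul, norm_smul, norm_pow, Real.norm_eq_abs, Real.norm_eq_abs]
  have h1 : ‖taylorTerm g j x u‖
      ≤ (Nat.factorial j : ℝ)⁻¹ * (‖iteratedFDeriv ℝ j g x‖ * ‖u‖ ^ j) := by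
    unfold taylorTerm
    rw [norm_smul, norm_inv, Real.norm_natCast]
    gcongr
    exact ((iteratedFDeriv ℝ j g x).le_opNorm _).trans (by simp)
  calc |K u| * (|c| ^ j * ‖taylorTerm g j x u‖)
      ≤ |K u| * (|c| ^ j * ((Nat.factorial j : ℝ)⁻¹ * (‖iteratedFDeriv ℝ j g x‖ * ‖u‖ ^ j))) := by
        gcongr
    _ = _ := by ring

/-- In coordinates the multilinear form is a sum over index maps `r : Fin j → Fin d`. Each summand
is a monomial whose exponents are the fibre sizes of `r`, of total degree `j`, so its moment against
`K` vanishes. -/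
theorem MomentKernel.integral_taylorTerm [CompleteSpace F] {ρ : ℕ} {K : Euc d → ℝ} (hK : MomentKernel ρ K) {j : ℕ}
    (hj0 : 0 < j) (hj : j < ρ) (g : Euc d → F) (x : Euc d) (c : ℝ) :
    ∫ u, K u • taylorTerm g j x (c • u) = 0 := by
  set D := iteratedFDeriv ℝ j g x
  have hexp : ∀ u : Euc d, D (fun _ => u) = ∑ r : Fin j → Fin d,
      (∏ i, u (r i)) • D (fun i => EuclideanSpace.single (r i) (1 : ℝ)) := fun u => by
    have h1 : (fun _ : Fin j => u)
        = fun _ : Fin j => ∑ l : Fin d, u l • EuclideanSpace.single l (1 : ℝ) := by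
      funext _
      have := (EuclideanSpace.basisFun (Fin d) ℝ).sum_repr u
      simpa using this.symm
    rw [h1, ContinuousMultilinearMap.map_sum]
    exact Finset.sum_congr rfl fun r _ =>
      ContinuousMultilinearMap.map_smul_univ D (fun i => u (r i)) _
  have hprod : ∀ (r : Fin j → Fin d) (u : Euc d),
      ∏ i, u (r i) = ∏ l, u l ^ (Finset.univ.filter fun i => r i = l).card := fun r u => by
    rw [← Finset.prod_fiberwise Finset.univ r]
    refine Finset.prod_congr rfl fun l _ => ?_
    rw [Finset.prod_congr rfl (g := fun _ => u l)
      (fun i hi => by rw [(Finset.mem_filter.1 hi).2]), Finset.prod_const]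
  have hcard : ∀ r : Fin j → Fin d,
      ∑ l, (Finset.univ.filter fun i => r i = l).card = j := fun r => by
    rw [← Finset.card_eq_sum_card_fiberwise (s := (Finset.univ : Finset (Fin j)))
      (t := Finset.univ) (f := r) (fun _ _ => Finset.mem_coe.2 (Finset.mem_univ _))]
    simp
  have hmono : ∀ r : Fin j → Fin d, Integrable (fun u : Euc d => K u * ∏ i, u (r i)) volume := by
    intro r
    refine (hK.integrable_pow_of_le hj.le).mono' (hK.integrable.1.mul
      (Continuous.aestronglyMeasurable (by fun_prop))) (Eventually.of_forall fun u => ?_)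
    rw [norm_mul, Real.norm_eq_abs, mul_comm, norm_prod]
    gcongr
    calc ∏ i, ‖u (r i)‖ ≤ ∏ _i : Fin j, ‖u‖ :=
          Finset.prod_le_prod (fun _ _ => norm_nonneg _) fun i _ => PiLp.norm_apply_le u (r i)
      _ = _ := by simp
  have hint : ∀ u, K u • taylorTerm g j x (c • u) = ∑ r : Fin j → Fin d,
      (K u * ∏ i, u (r i)) • ((c ^ j * (Nat.factorial j : ℝ)⁻¹) •
        D (fun i => EuclideanSpace.single (r i) (1 : ℝ))) := fun u => by
    rw [taylorTerm_smul]
    unfold taylorTerm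
    rw [hexp u]
    simp only [Finset.smul_sum, smul_smul]
    refine Finset.sum_congr rfl fun r _ => ?_
    congr 1; ring
  simp only [hint]
  rw [integral_finsetSum _ fun r _ => (hmono r).smul_const _]
  refine Finset.sum_eq_zero fun r _ => ?_
  rw [integral_smul_const]
  have h2 := hK.moment (fun l => (Finset.univ.filter fun i => r i = l).card)
    (by rw [hcard r]; exact hj0) (by rw [hcard r]; exact hj)
  have h3 : ∫ u, K u * ∏ i, u (r i) = 0 := by
    rw [← h2]
    refine integral_congr_ae (Eventually.of_forall fun u => ?_)
    simp only
    rw [hprod r u, mul_comm]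
  rw [h3, zero_smul]

/-- Pointwise bias of kernel smoothing. -/
theorem MomentKernel.enorm_smooth_sub_le [CompleteSpace F] {ρ b : ℕ} {K : Euc d → ℝ}
    (hK : MomentKernel ρ K) {r C η : ℝ} (hC : 0 ≤ C) (hη : 0 ≤ η) {g : Euc d → F} {x : Euc d}
    (hrem : ∀ y, ‖g (x + y) - g x - ∑ j ∈ Finset.Ico 1 ρ, taylorTerm g j x y‖
        ≤ (if r ≤ ‖y‖ then ‖g (x + y)‖ else 0)
          + C * ‖y‖ ^ ρ * (∑ k : Fin b, ‖g (x + node b k • (r / ‖y‖) • y)‖ + η)) (c : ℝ)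
    (hint : Integrable (fun u => K u • g (x + c • u)) volume) :
    ‖(∫ u, K u • g (x + c • u)) - g x‖ₑ ≤ ∫⁻ u, ‖K u‖ₑ *
      ((if r ≤ ‖c • u‖ then ‖g (x + c • u)‖ₑ else 0) + ENNReal.ofReal (C * |c| ^ ρ * ‖u‖ ^ ρ) *
        (∑ k : Fin b, ‖g (x + node b k • (r / ‖c • u‖) • (c • u))‖ₑ + ENNReal.ofReal η)) := by
  have hsum : Integrable (fun u => ∑ j ∈ Finset.Ico 1 ρ, K u • taylorTerm g j x (c • u)) volume :=
    integrable_finsetSum _ fun j hj =>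
      hK.integrable_taylorTerm (Finset.mem_Ico.1 hj).2.le g x c
  have hx : Integrable (fun u => K u • g x) volume := hK.integrable.smul_const _
  -- Unit mass and vanishing moments allow the whole Taylor polynomial of degree `ρ - 1` to be
  -- subtracted under the integral.
  have h1 : (∫ u, K u • g (x + c • u)) - g x = ∫ u, (K u • g (x + c • u) - K u • g x
      - ∑ j ∈ Finset.Ico 1 ρ, K u • taylorTerm g j x (c • u)) := by
    rw [integral_sub (f := fun u => K u • g (x + c • u) - K u • g x) (hint.sub hx) hsum,
      integral_sub hint hx, integral_smul_const,
      hK.integral_eq_one, one_smul, integral_finsetSum _ fun j hj =>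
        hK.integrable_taylorTerm (Finset.mem_Ico.1 hj).2.le g x c,
      Finset.sum_eq_zero fun j hj => hK.integral_taylorTerm (Finset.mem_Ico.1 hj).1
        (Finset.mem_Ico.1 hj).2 g x c, sub_zero]
  rw [h1]
  refine (enorm_integral_le_lintegral_enorm _).trans (lintegral_mono fun u => ?_)
  rw [← Finset.smul_sum, ← smul_sub, ← smul_sub, enorm_smul]
  gcongr
  rw [← ofReal_norm]
  refine (ENNReal.ofReal_le_ofReal (hrem (c • u))).trans ?_
  have hn : 0 ≤ ∑ k : Fin b, ‖g (x + node b k • (r / ‖c • u‖) • (c • u))‖ := by positivity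
  have e1 : C * ‖c • u‖ ^ ρ = C * |c| ^ ρ * ‖u‖ ^ ρ := by
    rw [norm_smul, mul_pow, Real.norm_eq_abs, mul_assoc]
  rw [e1, ENNReal.ofReal_add (by split_ifs <;> positivity) (by positivity),
    ENNReal.ofReal_mul (by positivity), ENNReal.ofReal_add hn hη,
    ENNReal.ofReal_sum_of_nonneg fun _ _ => norm_nonneg _]
  simp only [ofReal_norm]
  gcongr
  split_ifs <;> simp

end Kernel


/-! ### Second moments of sample means. -/

section Probability

variable {𝕜 : Type*} [RCLike 𝕜] {Ω : Type*} [MeasurableSpace Ω] {P : Measure Ω}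

theorem memLp_two_of_lintegral {f : Ω → 𝕜} (hf : AEStronglyMeasurable f P)
    (h : ∫⁻ s, ‖f s‖ₑ ^ 2 ∂P ≠ ∞) : MemLp f 2 P := by
  refine ⟨hf, ?_⟩
  rw [eLpNorm_lt_top_iff_lintegral_rpow_enorm_lt_top (by norm_num) (by norm_num)]
  simpa [lt_top_iff_ne_top] using h

theorem MemLp.lintegral_enorm_sq {f : Ω → 𝕜} (hf : MemLp f 2 P) :
    ∫⁻ s, ‖f s‖ₑ ^ 2 ∂P = ENNReal.ofReal (∫ s, ‖f s‖ ^ 2 ∂P) := by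
  rw [ofReal_integral_eq_lintegral_ofReal ((memLp_two_iff_integrable_sq_norm hf.1).1 hf)
    (Eventually.of_forall fun _ => by positivity)]
  refine lintegral_congr fun s => ?_
  rw [ENNReal.ofReal_pow (norm_nonneg _), ofReal_norm]

theorem lintegral_enorm_sq_ne_top {f : Ω → 𝕜} (hf : MemLp f 2 P) :
    ∫⁻ s, ‖f s‖ₑ ^ 2 ∂P ≠ ∞ := by
  rw [MemLp.lintegral_enorm_sq hf]; exact ENNReal.ofReal_ne_top

/-- Centred independent square integrable variables are orthogonal. -/
theorem integral_norm_sum_sq {X : ℕ → Ω → 𝕜} (hX : ∀ i, MemLp (X i) 2 P)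
    (hmean : ∀ i, ∫ s, X i s ∂P = 0)
    (hindep : ∀ i j, i ≠ j → IndepFun (X i) (X j) P) (n : ℕ) :
    ∫ s, ‖∑ i ∈ Finset.range n, X i s‖ ^ 2 ∂P
      = ∑ i ∈ Finset.range n, ∫ s, ‖X i s‖ ^ 2 ∂P := by
  have hconj : ∀ i, MemLp (fun s => starRingEnd 𝕜 (X i s)) 2 P := fun i => (hX i).star
  have hint : ∀ i j, Integrable (fun s => X i s * starRingEnd 𝕜 (X j s)) P := fun i j =>
    (hX i).integrable_mul (hconj j)
  have hcross : ∀ i j, i ≠ j → ∫ s, X i s * starRingEnd 𝕜 (X j s) ∂P = 0 := fun i j hij => by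
    have h1 : IndepFun (X i) (fun s => starRingEnd 𝕜 (X j s)) P :=
      (hindep i j hij).comp (φ := id) (ψ := starRingEnd 𝕜) measurable_id
        RCLike.continuous_conj.measurable
    rw [h1.integral_fun_mul_eq_mul_integral (hX i).1 (hconj j).1, hmean i, zero_mul]
  have hsq : ∀ z : 𝕜, ((‖z‖ ^ 2 : ℝ) : 𝕜) = z * starRingEnd 𝕜 z := fun z => by
    rw [RCLike.mul_conj]; push_cast; rfl
  have h1 : ((∫ s, ‖∑ i ∈ Finset.range n, X i s‖ ^ 2 ∂P : ℝ) : 𝕜)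
      = ((∑ i ∈ Finset.range n, ∫ s, ‖X i s‖ ^ 2 ∂P : ℝ) : 𝕜) := by
    rw [← integral_ofReal, RCLike.ofReal_sum]
    simp only [← integral_ofReal, hsq, map_sum, Finset.sum_mul_sum]
    rw [integral_finsetSum _ fun i _ => integrable_finsetSum _ fun j _ => hint i j]
    refine Finset.sum_congr rfl fun i hi => ?_
    rw [integral_finsetSum _ fun j _ => hint i j, Finset.sum_eq_single i
      (fun j _ hj => hcross i j hj.symm) (fun h => absurd hi h)]
  exact_mod_cast h1

theorem lintegral_enorm_sum_sq {X : ℕ → Ω → 𝕜} (hX : ∀ i, MemLp (X i) 2 P)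
    (hmean : ∀ i, ∫ s, X i s ∂P = 0)
    (hindep : ∀ i j, i ≠ j → IndepFun (X i) (X j) P) (n : ℕ) :
    ∫⁻ s, ‖∑ i ∈ Finset.range n, X i s‖ₑ ^ 2 ∂P
      = ∑ i ∈ Finset.range n, ∫⁻ s, ‖X i s‖ₑ ^ 2 ∂P := by
  have hS : MemLp (fun s => ∑ i ∈ Finset.range n, X i s) 2 P :=
    memLp_finsetSum _ fun i _ => hX i
  rw [MemLp.lintegral_enorm_sq hS, integral_norm_sum_sq hX hmean hindep,
    ENNReal.ofReal_sum_of_nonneg fun i _ => integral_nonneg fun s => by positivity]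
  exact Finset.sum_congr rfl fun i _ => (MemLp.lintegral_enorm_sq (hX i)).symm

theorem enorm_add_sq_le {E : Type*} [SeminormedAddCommGroup E] (x y : E) :
    ‖x + y‖ₑ ^ 2 ≤ 2 * ‖x‖ₑ ^ 2 + 2 * ‖y‖ₑ ^ 2 := by
  simp only [← ofReal_norm, ← ENNReal.ofReal_pow (norm_nonneg _)]
  rw [show (2 : ℝ≥0∞) = ENNReal.ofReal 2 by simp, ← ENNReal.ofReal_mul (by norm_num),
    ← ENNReal.ofReal_mul (by norm_num), ← ENNReal.ofReal_add (by positivity) (by positivity)]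
  refine ENNReal.ofReal_le_ofReal ?_
  have := norm_add_le x y
  nlinarith [sq_nonneg (‖x‖ - ‖y‖), norm_nonneg (x + y), norm_nonneg x, norm_nonneg y]

theorem add_sq_le_ennreal (x y : ℝ≥0∞) : (x + y) ^ 2 ≤ 2 * x ^ 2 + 2 * y ^ 2 := by
  rcases eq_or_ne x ∞ with rfl | hx
  · simp
  rcases eq_or_ne y ∞ with rfl | hy
  · simp
  lift x to ℝ≥0 using hx
  lift y to ℝ≥0 using hy
  norm_cast
  have : ((x : ℝ) + y) ^ 2 ≤ 2 * x ^ 2 + 2 * y ^ 2 := by nlinarith [sq_nonneg ((x : ℝ) - y)]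
  exact_mod_cast this

/-- Mean squared error of a sample mean. -/
theorem lintegral_enorm_mean_sub_sq_le [IsProbabilityMeasure P] {ξ : ℕ → Ω → 𝕜}
    (hmeas : ∀ i, Measurable (ξ i)) (hindep : ∀ i j, i ≠ j → IndepFun (ξ i) (ξ j) P)
    (hident : ∀ i, IdentDistrib (ξ i) (ξ 0) P P) {n : ℕ} (hn : n ≠ 0) (c : 𝕜) :
    ∫⁻ s, ‖(n : 𝕜)⁻¹ * ∑ i ∈ Finset.range n, ξ i s - c‖ₑ ^ 2 ∂P
      ≤ 8 * (n : ℝ≥0∞)⁻¹ * ∫⁻ s, ‖ξ 0 s‖ₑ ^ 2 ∂P + 2 * ‖∫ s, ξ 0 s ∂P - c‖ₑ ^ 2 := by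
  have hn' : (n : ℝ≥0∞) ≠ 0 := by exact_mod_cast hn
  -- No moment is assumed: an infinite second moment makes the right side infinite, since `n⁻¹` is
  -- not zero.
  rcases eq_or_ne (∫⁻ s, ‖ξ 0 s‖ₑ ^ 2 ∂P) ∞ with htop | hfin
  · rw [htop, ENNReal.mul_top (by simp)]
    simp
  have hL0 : MemLp (ξ 0) 2 P := memLp_two_of_lintegral (hmeas 0).aestronglyMeasurable hfin
  have hL : ∀ i, MemLp (ξ i) 2 P := fun i => (hident i).symm.memLp_snd hL0
  set e := ∫ s, ξ 0 s ∂P with he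
  have hmean : ∀ i, ∫ s, ξ i s ∂P = e := fun i => (hident i).integral_eq
  set X : ℕ → Ω → 𝕜 := fun i s => ξ i s - e with hXdef
  have hX : ∀ i, MemLp (X i) 2 P := fun i => (hL i).sub (memLp_const e)
  have hX0 : ∀ i, ∫ s, X i s ∂P = 0 := fun i => by
    simp only [hXdef]
    rw [integral_sub ((hL i).integrable (by norm_num)) (integrable_const _), hmean i]
    simp
  have hXind : ∀ i j, i ≠ j → IndepFun (X i) (X j) P := fun i j hij =>
    (hindep i j hij).comp (φ := fun x => x - e) (ψ := fun x => x - e)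
      (measurable_id.sub_const e) (measurable_id.sub_const e)
  -- Centring costs the factor 4, by `‖x - e‖² ≤ 2‖x‖² + 2‖e‖²` and Jensen for the mean `e`.
  -- Separating variance from bias costs another 2, whence the constant 8.
  have hXsq : ∀ i, ∫⁻ s, ‖X i s‖ₑ ^ 2 ∂P ≤ 4 * ∫⁻ s, ‖ξ 0 s‖ₑ ^ 2 ∂P := fun i => by
    have h1 : ∫⁻ s, ‖ξ i s‖ₑ ^ 2 ∂P = ∫⁻ s, ‖ξ 0 s‖ₑ ^ 2 ∂P :=
      ((hident i).comp (u := fun x : 𝕜 => ‖x‖ₑ ^ 2) (by fun_prop)).lintegral_eq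
    have h2 : ‖e‖ₑ ^ 2 ≤ ∫⁻ s, ‖ξ 0 s‖ₑ ^ 2 ∂P := by
      rw [MemLp.lintegral_enorm_sq hL0, ← ofReal_norm, ← ENNReal.ofReal_pow (norm_nonneg _)]
      refine ENNReal.ofReal_le_ofReal ?_
      have h3 := norm_integral_le_integral_norm (μ := P) (ξ 0)
      have h4 := (convexOn_pow 2).map_integral_le (μ := P) (f := fun s => ‖ξ 0 s‖)
        (continuous_pow 2).continuousOn isClosed_Ici
        (Eventually.of_forall fun s => norm_nonneg (ξ 0 s)) (hL0.integrable (by norm_num)).norm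
        ((memLp_two_iff_integrable_sq_norm hL0.1).1 hL0)
      refine (pow_le_pow_left₀ (norm_nonneg _) h3 2).trans h4
    calc ∫⁻ s, ‖X i s‖ₑ ^ 2 ∂P ≤ ∫⁻ s, (2 * ‖ξ i s‖ₑ ^ 2 + 2 * ‖e‖ₑ ^ 2) ∂P := by
          refine lintegral_mono fun s => ?_
          have := enorm_add_sq_le (ξ i s) (-e)
          rwa [enorm_neg, ← sub_eq_add_neg] at this
      _ = 2 * ∫⁻ s, ‖ξ i s‖ₑ ^ 2 ∂P + 2 * ‖e‖ₑ ^ 2 := by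
          rw [lintegral_add_right _ measurable_const, lintegral_const_mul _ (by fun_prop)]
          simp
      _ ≤ 2 * ∫⁻ s, ‖ξ 0 s‖ₑ ^ 2 ∂P + 2 * ∫⁻ s, ‖ξ 0 s‖ₑ ^ 2 ∂P := by rw [h1]; gcongr
      _ = _ := by ring
  have hpt : ∀ s, (n : 𝕜)⁻¹ * ∑ i ∈ Finset.range n, ξ i s - c
      = (n : 𝕜)⁻¹ * ∑ i ∈ Finset.range n, X i s + (e - c) := fun s => by
    have hnk : (n : 𝕜) ≠ 0 := by exact_mod_cast hn
    simp only [hXdef, Finset.sum_sub_distrib, Finset.sum_const, Finset.card_range, nsmul_eq_mul]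
    field_simp
    ring
  have hninv : ‖(n : 𝕜)⁻¹‖ₑ = (n : ℝ≥0∞)⁻¹ := by
    rw [enorm_inv (by exact_mod_cast hn), ← ofReal_norm, RCLike.norm_natCast,
      ENNReal.ofReal_natCast]
  have hXm : Measurable fun s => ∑ i ∈ Finset.range n, X i s :=
    Finset.measurable_sum _ fun i _ => (hmeas i).sub_const e
  calc _ ≤ ∫⁻ s, (2 * ((n : ℝ≥0∞)⁻¹ ^ 2 * ‖∑ i ∈ Finset.range n, X i s‖ₑ ^ 2)
          + 2 * ‖e - c‖ₑ ^ 2) ∂P := by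
        refine lintegral_mono fun s => ?_
        rw [hpt s]
        refine (enorm_add_sq_le _ _).trans ?_
        rw [enorm_mul, hninv, mul_pow]
    _ = 2 * ((n : ℝ≥0∞)⁻¹ ^ 2 * ∑ i ∈ Finset.range n, ∫⁻ s, ‖X i s‖ₑ ^ 2 ∂P)
          + 2 * ‖e - c‖ₑ ^ 2 := by
        rw [lintegral_add_right _ measurable_const, lintegral_const_mul _ (by fun_prop),
          lintegral_const_mul _ (by fun_prop), lintegral_enorm_sum_sq hX hX0 hXind]
        simp
    _ ≤ 2 * ((n : ℝ≥0∞)⁻¹ ^ 2 * (n * (4 * ∫⁻ s, ‖ξ 0 s‖ₑ ^ 2 ∂P))) + 2 * ‖e - c‖ₑ ^ 2 := by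
        gcongr
        refine (Finset.sum_le_sum fun i _ => hXsq i).trans ?_
        simp
    _ = _ := by
        congr 1
        have : (n : ℝ≥0∞)⁻¹ ^ 2 * n = (n : ℝ≥0∞)⁻¹ := by
          rw [sq, mul_assoc, ENNReal.inv_mul_cancel hn' (ENNReal.natCast_ne_top n), mul_one]
        rw [← mul_assoc, ← mul_assoc, mul_assoc 2, this]
        ring

end Probability

/-! ### Cauchy-Schwarz with a weight that may vanish. -/

section CauchySchwarz

variable {α : Type*} [MeasurableSpace α] {μ : Measure α}

theorem lintegral_mul_sq_le {f g : α → ℝ≥0∞} (hf : AEMeasurable f μ) (hg : AEMeasurable g μ) :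
    (∫⁻ x, f x * g x ∂μ) ^ 2 ≤ (∫⁻ x, f x ^ 2 ∂μ) * ∫⁻ x, g x ^ 2 ∂μ := by
  have h := ENNReal.lintegral_mul_le_Lp_mul_Lq μ Real.HolderConjugate.two_two hf hg
  simp only [Pi.mul_apply, ENNReal.rpow_ofNat] at h
  calc _ ≤ ((∫⁻ x, f x ^ 2 ∂μ) ^ (1 / 2 : ℝ) * (∫⁻ x, g x ^ 2 ∂μ) ^ (1 / 2 : ℝ)) ^ 2 := by gcongr
    _ = _ := by
      rw [mul_pow, ← ENNReal.rpow_natCast, ← ENNReal.rpow_natCast, ← ENNReal.rpow_mul,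
        ← ENNReal.rpow_mul]
      norm_num

/-- A function vanishes where the weight vanishes if its weighted square is integrable. -/
theorem ae_eq_zero_of_div {f ϖ : α → ℝ≥0∞} {j : ℕ} (hf : AEMeasurable f μ)
    (hϖ : AEMeasurable ϖ μ) (h : ∫⁻ x, f x ^ j / ϖ x ∂μ ≠ ∞) :
    ∀ᵐ x ∂μ, ϖ x = 0 → f x = 0 := by
  filter_upwards [ae_lt_top' ((hf.pow_const j).div hϖ) h] with x hx hx0
  by_contra hne
  simp only [Pi.div_apply] at hx
  rw [hx0, ENNReal.div_zero (pow_ne_zero _ hne)] at hx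
  exact lt_irrefl _ hx

/-- The Cauchy-Schwarz inequality with a weight that may vanish. -/
theorem lintegral_mul_sq_le_weight {f g ϖ : α → ℝ≥0∞} (hf : AEMeasurable f μ)
    (hg : AEMeasurable g μ) (hϖ : AEMeasurable ϖ μ) (hϖtop : ∀ x, ϖ x ≠ ∞)
    (h : ∫⁻ x, f x ^ 2 / ϖ x ∂μ ≠ ∞) :
    (∫⁻ x, f x * g x ∂μ) ^ 2 ≤ (∫⁻ x, f x ^ 2 / ϖ x ∂μ) * ∫⁻ x, g x ^ 2 * ϖ x ∂μ := by
  have hsqrt : ∀ y : ℝ≥0∞, (y ^ (1 / 2 : ℝ)) ^ 2 = y := fun y => by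
    rw [← ENNReal.rpow_natCast, ← ENNReal.rpow_mul]; norm_num
  -- The factors `ϖ^{-1/2}` and `ϖ^{1/2}` are inserted. Where `ϖ = 0` their product is not 1, but
  -- there `f` vanishes almost everywhere by finiteness of the weighted square.
  have h1 : ∫⁻ x, f x * g x ∂μ
      = ∫⁻ x, (f x * (ϖ x)⁻¹ ^ (1 / 2 : ℝ)) * (g x * ϖ x ^ (1 / 2 : ℝ)) ∂μ := by
    refine lintegral_congr_ae ?_
    filter_upwards [ae_eq_zero_of_div hf hϖ h] with x hx
    rcases eq_or_ne (ϖ x) 0 with h0 | h0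
    · rw [hx h0]; simp
    · have h2 : (ϖ x)⁻¹ ^ (1 / 2 : ℝ) * ϖ x ^ (1 / 2 : ℝ) = 1 := by
        rw [← ENNReal.mul_rpow_of_nonneg _ _ (by norm_num), ENNReal.inv_mul_cancel h0 (hϖtop x),
          ENNReal.one_rpow]
      rw [mul_mul_mul_comm, h2, mul_one]
  rw [h1]
  refine (lintegral_mul_sq_le (hf.mul (hϖ.inv.pow_const _)) (hg.mul (hϖ.pow_const _))).trans ?_
  refine le_of_eq ?_
  congr 1 <;> refine lintegral_congr fun x => ?_ <;>
    simp only [Pi.mul_apply, Pi.inv_apply, mul_pow, hsqrt]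
  rfl

end CauchySchwarz

/-! ### Rescaling integrals against a kernel. -/

section ChangeOfVariables

variable {d : ℕ}

theorem lintegral_comp_smul {c : ℝ} (hc : c ≠ 0) (Φ : Euc d → ℝ≥0∞) :
    ∫⁻ u, Φ (c • u) = ENNReal.ofReal (|c| ^ d)⁻¹ * ∫⁻ y, Φ y := by
  have h := Measure.map_addHaar_smul (volume : Measure (Euc d)) hc
  have h2 := lintegral_map_equiv (μ := (volume : Measure (Euc d))) Φ
    (Homeomorph.smulOfNeZero c hc).toMeasurableEquiv
  have h3 : (⇑(Homeomorph.smulOfNeZero c hc).toMeasurableEquiv : Euc d → Euc d)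
      = fun x => c • x := rfl
  rw [h3, h, lintegral_smul_measure] at h2
  simp only [finrank_euclideanSpace, Fintype.card_fin, abs_inv, abs_pow, smul_eq_mul] at h2
  exact h2.symm

theorem lintegral_comp_scale_sub {h : ℝ} (hh : 0 < h) (x : Euc d) (Φ : Euc d → ℝ≥0∞) :
    ∫⁻ y, Φ (h⁻¹ • (y - x)) = ENNReal.ofReal (h ^ d) * ∫⁻ u, Φ u := by
  rw [lintegral_sub_right_eq_self (fun y => Φ (h⁻¹ • y)) x,
    lintegral_comp_smul (inv_ne_zero hh.ne')]
  simp [abs_of_pos hh]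

theorem lintegral_comp_scale_sub' {h : ℝ} (hh : 0 < h) (x : Euc d) (Φ : Euc d → ℝ≥0∞) :
    ∫⁻ y, Φ (h⁻¹ • (x - y)) = ENNReal.ofReal (h ^ d) * ∫⁻ u, Φ u := by
  rw [lintegral_sub_left_eq_self (fun y => Φ (h⁻¹ • y)) x,
    lintegral_comp_smul (inv_ne_zero hh.ne')]
  simp [abs_of_pos hh]

/-- Rescaled integral against a kernel centred at `x`. -/
theorem lintegral_kernel_eq {h : ℝ} (hh : 0 < h) (x : Euc d) (K F : Euc d → ℝ≥0∞) :
    ∫⁻ u, K u * F (x + h • u)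
      = ∫⁻ y, ENNReal.ofReal (h ^ d)⁻¹ * K (h⁻¹ • (y - x)) * F y := by
  have h1 := lintegral_comp_scale_sub hh x (fun u => K u * F (x + h • u))
  have h2 : ∀ y, x + h • h⁻¹ • (y - x) = y := fun y => by
    rw [smul_smul, mul_inv_cancel₀ hh.ne', one_smul]; abel
  simp only [h2] at h1
  simp only [mul_assoc]
  rw [lintegral_const_mul' _ _ ENNReal.ofReal_ne_top, h1, ← mul_assoc,
    ← ENNReal.ofReal_mul (by positivity), inv_mul_cancel₀ (by positivity)]
  simp

/-- The sign `-h` is that of the density estimate at a point `x`, which integrates over the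
observations `y` with argument `(x - y)/h`. The version with `+h` smooths around an observation.
Having both avoids any appeal to symmetry of the kernel. -/
theorem lintegral_kernel_eq' {h : ℝ} (hh : 0 < h) (x : Euc d) (K F : Euc d → ℝ≥0∞) :
    ∫⁻ u, K u * F (x + (-h) • u)
      = ∫⁻ y, ENNReal.ofReal (h ^ d)⁻¹ * K (h⁻¹ • (x - y)) * F y := by
  have h1 := lintegral_comp_scale_sub' hh x (fun u => K u * F (x + (-h) • u))
  have h2 : ∀ y, x + (-h) • h⁻¹ • (x - y) = y := fun y => by
    rw [neg_smul, smul_smul, mul_inv_cancel₀ hh.ne', one_smul]; abel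
  simp only [h2] at h1
  simp only [mul_assoc]
  rw [lintegral_const_mul' _ _ ENNReal.ofReal_ne_top, h1, ← mul_assoc,
    ← ENNReal.ofReal_mul (by positivity), inv_mul_cancel₀ (by positivity)]
  simp

variable {F : Type*} [NormedAddCommGroup F] [NormedSpace ℝ F]

theorem integral_kernel_eq {h : ℝ} (hh : 0 < h) (x : Euc d) (K : Euc d → ℝ) (g : Euc d → F) :
    ∫ u, K u • g (x + h • u) = ∫ y, ((h ^ d)⁻¹ * K (h⁻¹ • (y - x))) • g y := by
  have h2 : ∀ u : Euc d, h⁻¹ • (x + h • u - x) = u := fun u => by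
    rw [add_sub_cancel_left, smul_smul, inv_mul_cancel₀ hh.ne', one_smul]
  have h1 := Measure.integral_comp_smul (volume : Measure (Euc d))
    (fun y => ((h ^ d)⁻¹ * K (h⁻¹ • (x + y - x))) • g (x + y)) h
  rw [integral_add_left_eq_self (fun y => ((h ^ d)⁻¹ * K (h⁻¹ • (y - x))) • g y) x] at h1
  simp only [h2, finrank_euclideanSpace, Fintype.card_fin, mul_smul] at h1
  rw [integral_smul, abs_of_pos (by positivity)] at h1
  simp only [mul_smul]
  exact smul_right_injective _ (by positivity : ((h ^ d)⁻¹ : ℝ) ≠ 0) h1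

theorem integral_kernel_eq' {h : ℝ} (hh : 0 < h) (x : Euc d) (K : Euc d → ℝ) (g : Euc d → F) :
    ∫ u, K u • g (x + (-h) • u) = ∫ y, ((h ^ d)⁻¹ * K (h⁻¹ • (x - y))) • g y := by
  have h2 : ∀ u : Euc d, h⁻¹ • (x - (x + (-h) • u)) = u := fun u => by
    rw [sub_add_cancel_left, neg_smul, neg_neg, smul_smul, inv_mul_cancel₀ hh.ne', one_smul]
  have h1 := Measure.integral_comp_smul (volume : Measure (Euc d))
    (fun y => ((h ^ d)⁻¹ * K (h⁻¹ • (x - (x + y)))) • g (x + y)) (-h)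
  rw [integral_add_left_eq_self (fun y => ((h ^ d)⁻¹ * K (h⁻¹ • (x - y))) • g y) x] at h1
  simp only [h2, finrank_euclideanSpace, Fintype.card_fin, mul_smul] at h1
  rw [integral_smul, abs_inv, abs_pow, abs_neg, abs_of_pos hh] at h1
  simp only [mul_smul]
  exact smul_right_injective _ (by positivity : ((h ^ d)⁻¹ : ℝ) ≠ 0) h1

end ChangeOfVariables


/-! ### Consequences of membership in the Hölder classes. -/

section Holder

variable {d : ℕ} {F : Type*} [NormedAddCommGroup F] [NormedSpace ℝ F]

theorem HolderBound.continuous {υ α R : ℝ} {dens : Euc d → ℝ} {C : ℝ≥0} {g : Euc d → F}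
    (h : HolderBound υ α dens R C g) (hυ : 1 < υ) : Continuous g := by
  have h1 := (h.1 0 (by simpa using hυ)).continuous
  have h2 : g = fun x => iteratedFDeriv ℝ 0 g x 0 := by
    funext x; simp
  rw [h2]
  exact (ContinuousMultilinearMap.apply ℝ (fun _ : Fin 0 => Euc d) F 0).continuous.comp h1

theorem HolderBound.exists_taylorAt {υ α R : ℝ} {dens : Euc d → ℝ} {C : ℝ≥0} {g : Euc d → F}
    (h : HolderBound υ α dens R C g) : ∃ η : Euc d → ℝ, AEMeasurable η volume ∧ (∀ x, 0 ≤ η x) ∧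
      (∀ x, TaylorAt ⌈υ⌉₊ υ R (η x) g x) ∧ (α = 0 → ∀ x, η x ≤ C) ∧
      ∀ j : ℕ, 0 < j → α = j →
        ∫⁻ x, ‖g x‖ₑ ^ j / ENNReal.ofReal (dens x) ≤ C ∧
        ∫⁻ x, ENNReal.ofReal (η x) ^ j / ENNReal.ofReal (dens x) ≤ C := by
  obtain ⟨_, η, hηm, hη0, hT, h0, h1⟩ := h
  refine ⟨η, hηm, hη0, fun x y hy => hT x y hy, h0, fun j hj hα => ?_⟩
  have h2 := h1 (by rw [hα]; exact_mod_cast hj)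
  subst hα
  simp only [Real.rpow_natCast] at h2
  simpa only [ENNReal.ofReal_pow (norm_nonneg _), ENNReal.ofReal_pow (hη0 _), ofReal_norm] using h2

/-- `G` bounds `f` on the `R`-ball around each point, and `G ^ j / dens` is integrable. -/
structure Envelope (f dens : Euc d → ℝ) (j : ℕ) (R : ℝ) (G : Euc d → ℝ≥0∞) : Prop where
  aemeasurable : AEMeasurable G volume
  le : ∀ x y, ‖y - x‖ < R → ENNReal.ofReal (f y) ≤ G x
  lintegral_ne_top : ∫⁻ x, G x ^ j / ENNReal.ofReal (dens x) ≠ ∞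

theorem add_pow_le_ennreal (x y : ℝ≥0∞) (j : ℕ) : (x + y) ^ j ≤ 2 ^ j * (x ^ j + y ^ j) := by
  rcases le_total x y with h | h
  · calc (x + y) ^ j ≤ (2 * y) ^ j := by rw [two_mul]; gcongr
      _ = 2 ^ j * y ^ j := mul_pow _ _ _
      _ ≤ _ := by gcongr; exact le_add_self
  · calc (x + y) ^ j ≤ (2 * x) ^ j := by rw [two_mul]; gcongr
      _ = 2 ^ j * x ^ j := mul_pow _ _ _
      _ ≤ _ := by gcongr; exact le_self_add

/-- At order 1 the Taylor polynomial without constant term is empty, so `f(y) ≤ |f(x)| + η(x) R` on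
the `R`-ball, and the class bounds the `j`-th powers of both terms against `1/dens`. The envelope
lets a density be evaluated at a shifted point inside weighted integrals. -/
theorem HolderClass.exists_envelope {f dens : Euc d → ℝ} {j : ℕ} (hj : 0 < j)
    (hf : Measurable f) (hdens : Measurable dens) (h : HolderClass 1 j dens f) :
    ∃ R : ℝ, 0 < R ∧ ∃ G, Envelope f dens j R G := by
  obtain ⟨R, hR, C, hB⟩ := h
  obtain ⟨η, hηm, hη0, hT, -, hint⟩ := hB.exists_taylorAt
  obtain ⟨h1, h2⟩ := hint j hj rfl
  refine ⟨R, hR, fun x => ‖f x‖ₑ + ENNReal.ofReal (η x) * ENNReal.ofReal R, by fun_prop, ?_, ?_⟩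
  · intro x y hxy
    have h3 := hT x y hxy
    simp only [Nat.ceil_one, Finset.Ico_self, Finset.sum_empty, sub_zero, Real.rpow_one] at h3
    rw [← ofReal_norm, ← ENNReal.ofReal_mul (hη0 x),
      ← ENNReal.ofReal_add (norm_nonneg _) (mul_nonneg (hη0 x) hR.le)]
    refine ENNReal.ofReal_le_ofReal ?_
    have h4 : η x * ‖y - x‖ ≤ η x * R := mul_le_mul_of_nonneg_left hxy.le (hη0 x)
    have h5 := norm_sub_norm_le (f y) (f x)
    have h6 := Real.le_norm_self (f y)
    linarith
  · have hϖ : Measurable fun x => (ENNReal.ofReal (dens x))⁻¹ := by fun_prop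
    refine ne_top_of_le_ne_top (b := 2 ^ j * (C + ENNReal.ofReal R ^ j * C)) ?_ ?_
    · exact ENNReal.mul_ne_top (by simp) (ENNReal.add_ne_top.2 ⟨ENNReal.coe_ne_top,
        ENNReal.mul_ne_top (by simp) ENNReal.coe_ne_top⟩)
    calc _ ≤ ∫⁻ x, 2 ^ j * (‖f x‖ₑ ^ j / ENNReal.ofReal (dens x)
          + ENNReal.ofReal R ^ j * (ENNReal.ofReal (η x) ^ j / ENNReal.ofReal (dens x))) := by
          refine lintegral_mono fun x => ?_
          simp only [div_eq_mul_inv]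
          calc _ ≤ 2 ^ j * (‖f x‖ₑ ^ j + (ENNReal.ofReal (η x) * ENNReal.ofReal R) ^ j)
                * (ENNReal.ofReal (dens x))⁻¹ := by gcongr; exact add_pow_le_ennreal _ _ _
            _ = _ := by rw [mul_pow]; ring
      _ = 2 ^ j * ((∫⁻ x, ‖f x‖ₑ ^ j / ENNReal.ofReal (dens x))
          + ENNReal.ofReal R ^ j * ∫⁻ x, ENNReal.ofReal (η x) ^ j / ENNReal.ofReal (dens x)) := by
          simp only [div_eq_mul_inv]
          rw [lintegral_const_mul'' _ (by fun_prop), lintegral_add_left' (by fun_prop),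
            lintegral_const_mul'' _ (by fun_prop)]
      _ ≤ _ := by gcongr

theorem HolderClass.continuous_of_one {α : ℝ} {f dens : Euc d → ℝ} (h : HolderClass 1 α dens f) :
    Continuous f := by
  obtain ⟨R, hR, C, hB⟩ := h
  obtain ⟨η, -, hη0, hT, -, -⟩ := hB.exists_taylorAt
  refine continuous_iff_continuousAt.2 fun x => ?_
  refine tendsto_iff_norm_sub_tendsto_zero.2 ?_
  have h1 : Tendsto (fun y => η x * ‖y - x‖) (𝓝 x) (𝓝 0) := by
    have : Continuous fun y => η x * ‖y - x‖ := by fun_prop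
    simpa using this.tendsto x
  refine squeeze_zero' (Eventually.of_forall fun _ => norm_nonneg _) ?_ h1
  filter_upwards [Metric.ball_mem_nhds x hR] with y hy
  have h3 := hT x y (by rwa [mem_ball_iff_norm] at hy)
  simpa only [Nat.ceil_one, Finset.Ico_self, Finset.sum_empty, sub_zero, Real.rpow_one] using h3

end Holder

/-! ### Square integrability of `φ₀(Z)`. -/

section SecondMoment

variable {d : ℕ} {F : Type*} [NormedAddCommGroup F] [NormedSpace ℝ F]

/-- A smooth function is dominated by its local averages. -/
theorem exists_enorm_le_local_average {b : ℕ} (hb : 1 ≤ b) {υ R η : ℝ} (hυ : 0 ≤ υ)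
    (hη : 0 ≤ η) {φ : Euc d → F} (hφ : Continuous φ) (hT : ∀ x, TaylorAt b υ R η φ x)
    {r : ℝ} (hr : 0 < r) (hrR : r < R) :
    ∃ c : ℝ≥0, ∀ x, ‖φ x‖ₑ ≤ c * (∫⁻ y in Metric.ball x r, ‖φ y‖ₑ) + c := by
  obtain ⟨C, hC, hCt⟩ := exists_taylorTerm_le F b hb hυ hr
  set B := Metric.ball (0 : Euc d) r
  have hB0 : volume B ≠ 0 := (Metric.measure_ball_pos volume _ hr).ne'
  have hBtop : volume B ≠ ∞ := measure_ball_lt_top.ne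
  have hI : ∀ x (k : Fin b), ∫⁻ v in B, ‖φ (x + node b k • v)‖ₑ
      ≤ ENNReal.ofReal (|node b k| ^ d)⁻¹ * ∫⁻ y in Metric.ball x r, ‖φ y‖ₑ := fun x k => by
    have h1 : ∫⁻ y in Metric.ball x r, ‖φ y‖ₑ
        = ∫⁻ v, B.indicator (fun v => ‖φ (x + v)‖ₑ) v := by
      rw [← lintegral_indicator measurableSet_ball,
        ← lintegral_add_left_eq_self _ x]
      refine lintegral_congr fun v => ?_
      simp [Set.indicator, B]
    rw [h1, ← lintegral_comp_smul (node_pos b k).ne', ← lintegral_indicator measurableSet_ball]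
    refine lintegral_mono fun v => ?_
    by_cases hv : v ∈ B
    · have hv' : node b k • v ∈ B := by
        simp only [B, mem_ball_zero_iff, norm_smul, Real.norm_eq_abs, abs_of_pos (node_pos b k)] at *
        exact (mul_le_of_le_one_left (norm_nonneg _) (node_le_one b k)).trans_lt hv
      rw [Set.indicator_of_mem hv, Set.indicator_of_mem hv']
    · rw [Set.indicator_of_notMem hv]; exact bot_le
  set c₀ : ℝ≥0∞ := ENNReal.ofReal C
    * (∑ k : Fin b, ENNReal.ofReal (|node b k| ^ d)⁻¹ + ENNReal.ofReal η * volume B)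
  have hc₀ : c₀ ≠ ∞ := ENNReal.mul_ne_top (by simp)
    (ENNReal.add_ne_top.2 ⟨by simp, ENNReal.mul_ne_top (by simp) hBtop⟩)
  -- The bound of `φ(x)` by its values at `x + t_k v`, where the `t_k` are the nodes, is integrated
  -- over `v` in the ball. Scaling by `t_k ≤ 1` maps the ball into itself, so each node gives a
  -- multiple of the same local integral.
  have hmain : ∀ x, ‖φ x‖ₑ * volume B ≤ c₀ * (∫⁻ y in Metric.ball x r, ‖φ y‖ₑ) + c₀ := fun x => by
    have hm : ∀ k : Fin b, Measurable fun v : Euc d => ‖φ (x + node b k • v)‖ₑ := fun k =>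
      (hφ.comp (by fun_prop)).enorm.measurable
    calc ‖φ x‖ₑ * volume B = ∫⁻ _ in B, ‖φ x‖ₑ := by simp
      _ ≤ ∫⁻ v in B, ENNReal.ofReal C * (∑ k : Fin b, ‖φ (x + node b k • v)‖ₑ
            + ENNReal.ofReal η) := by
          refine setLIntegral_mono' measurableSet_ball fun v hv => ?_
          have h1 := hCt d R η φ x v hrR hη (hT x) (mem_ball_zero_iff.1 hv).le 0 (by omega)
          rw [taylorTerm_zero] at h1
          have h2 := ENNReal.ofReal_le_ofReal h1
          rw [ENNReal.ofReal_mul hC, ENNReal.ofReal_add (by positivity) hη,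
            ENNReal.ofReal_sum_of_nonneg fun _ _ => norm_nonneg _] at h2
          simpa only [ofReal_norm] using h2
      _ = ENNReal.ofReal C * ((∑ k : Fin b, ∫⁻ v in B, ‖φ (x + node b k • v)‖ₑ)
            + ENNReal.ofReal η * volume B) := by
          rw [lintegral_const_mul _ ((Finset.measurable_sum _ fun k _ => hm k).add_const _),
            lintegral_add_right _ measurable_const, lintegral_finsetSum _ fun k _ => hm k]
          simp
      _ ≤ ENNReal.ofReal C * (∑ k : Fin b, ENNReal.ofReal (|node b k| ^ d)⁻¹
            * (∫⁻ y in Metric.ball x r, ‖φ y‖ₑ) + ENNReal.ofReal η * volume B) := by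
          gcongr with k
          exact hI x _
      _ ≤ _ := by
          rw [← Finset.sum_mul]
          simp only [c₀]
          rw [mul_add, mul_add, add_mul, ← mul_assoc]
          exact add_le_add le_self_add le_add_self
  refine ⟨(c₀ / volume B).toNNReal, fun x => ?_⟩
  rw [ENNReal.coe_toNNReal (ENNReal.div_ne_top hc₀ hB0)]
  have h1 := ENNReal.div_le_div_right (hmain x) (volume B)
  rw [ENNReal.mul_div_cancel_right hB0 hBtop, ENNReal.add_div, ENNReal.mul_div_right_comm] at h1
  exact h1

/-- A smooth function that is square integrable for `dens` is square integrable for any density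
with an integrable envelope. -/
theorem lintegral_sq_mul_density_ne_top {f dens : Euc d → ℝ} (hf : Measurable f) (hdens : Measurable dens)
    {R₁ : ℝ} (hR₁ : 0 < R₁) {G : Euc d → ℝ≥0∞} (hG : Envelope f dens 1 R₁ G)
    (hf1 : ∫⁻ x, ENNReal.ofReal (f x) ≠ ∞) {b : ℕ} (hb : 1 ≤ b) {υ R η : ℝ} (hυ : 0 ≤ υ)
    (hR : 0 < R) (hη : 0 ≤ η) {φ : Euc d → F} (hφ : Continuous φ)
    (hT : ∀ x, TaylorAt b υ R η φ x)
    (hφ2 : ∫⁻ x, ‖φ x‖ₑ ^ 2 * ENNReal.ofReal (dens x) ≠ ∞) :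
    ∫⁻ x, ‖φ x‖ₑ ^ 2 * ENNReal.ofReal (f x) ≠ ∞ := by
  set r := min R₁ R / 2 with hr
  have hr0 : 0 < r := by positivity
  have hrR₁ : r < R₁ := by have := min_le_left R₁ R; rw [hr]; linarith [lt_min hR₁ hR]
  have hrR : r < R := by have := min_le_right R₁ R; rw [hr]; linarith [lt_min hR₁ hR]
  obtain ⟨c, hc⟩ := exists_enorm_le_local_average hb hυ hη hφ hT hr0 hrR
  set CG := ∫⁻ x, G x / ENNReal.ofReal (dens x) with hCG
  have hCGtop : CG ≠ ∞ := by simpa using hG.lintegral_ne_top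
  have hφm : Measurable fun y => ‖φ y‖ₑ := hφ.enorm.measurable
  -- Cauchy-Schwarz on the ball with weight `dens` produces `∫ 1/dens` over the ball. Multiplied by
  -- `f(x) ≤ G(y)` it is at most `∫ G/dens`. When `f(x) = 0` that local integral may be infinite, so
  -- this case is separate.
  have hloc : ∀ x, ENNReal.ofReal (f x) * (∫⁻ y in Metric.ball x r, ‖φ y‖ₑ) ^ 2
      ≤ CG * ∫⁻ y in Metric.ball x r, ‖φ y‖ₑ ^ 2 * ENNReal.ofReal (dens y) := fun x => by
    rcases eq_or_ne (ENNReal.ofReal (f x)) 0 with h0 | h0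
    · rw [h0, zero_mul]; exact bot_le
    set I := ∫⁻ y in Metric.ball x r, 1 ^ 2 / ENNReal.ofReal (dens y) with hI
    have hfI : ENNReal.ofReal (f x) * I ≤ CG := by
      rw [hI, ← lintegral_const_mul _ (by fun_prop)]
      refine le_trans ?_ (setLIntegral_le_lintegral (Metric.ball x r) _)
      refine setLIntegral_mono' measurableSet_ball fun y hy => ?_
      rw [one_pow, ← mul_div_assoc, mul_one]
      gcongr
      refine hG.le y x ?_
      rw [norm_sub_rev]
      exact (mem_ball_iff_norm.1 hy).trans hrR₁
    have hItop : I ≠ ∞ := by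
      intro h
      rw [h, ENNReal.mul_top h0] at hfI
      exact hCGtop (top_le_iff.1 hfI)
    have h1 := lintegral_mul_sq_le_weight (μ := volume.restrict (Metric.ball x r))
      (f := fun _ => 1) (g := fun y => ‖φ y‖ₑ) (ϖ := fun y => ENNReal.ofReal (dens y))
      aemeasurable_const hφm.aemeasurable (by fun_prop) (fun _ => ENNReal.ofReal_ne_top) hItop
    simp only [one_mul] at h1
    calc _ ≤ ENNReal.ofReal (f x) * (I * _) := by gcongr
      _ = (ENNReal.ofReal (f x) * I) * _ := by rw [mul_assoc]
      _ ≤ _ := by gcongr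
  -- Tonelli: a point `y` is counted by exactly those `x` in the ball around `y`, whose volume does
  -- not depend on `y`.
  have hball : ∫⁻ x, ∫⁻ y in Metric.ball x r, ‖φ y‖ₑ ^ 2 * ENNReal.ofReal (dens y)
      = volume (Metric.ball (0 : Euc d) r) * ∫⁻ y, ‖φ y‖ₑ ^ 2 * ENNReal.ofReal (dens y) := by
    have h1 : ∀ x, ∫⁻ y in Metric.ball x r, ‖φ y‖ₑ ^ 2 * ENNReal.ofReal (dens y)
        = ∫⁻ y, {p : Euc d × Euc d | dist p.2 p.1 < r}.indicator
          (fun p => ‖φ p.2‖ₑ ^ 2 * ENNReal.ofReal (dens p.2)) (x, y) := fun x => by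
      rw [← lintegral_indicator measurableSet_ball]
      refine lintegral_congr fun y => ?_
      simp [Set.indicator]
    simp only [h1]
    have hset : MeasurableSet {p : Euc d × Euc d | dist p.2 p.1 < r} :=
      measurableSet_lt (by fun_prop) measurable_const
    have hmeas : Measurable fun p : Euc d × Euc d => ‖φ p.2‖ₑ ^ 2 * ENNReal.ofReal (dens p.2) :=
      ((hφm.comp measurable_snd).pow_const 2).mul (hdens.comp measurable_snd).ennreal_ofReal
    rw [lintegral_lintegral_swap (f := fun x y => {p : Euc d × Euc d | dist p.2 p.1 < r}.indicator
      (fun p => ‖φ p.2‖ₑ ^ 2 * ENNReal.ofReal (dens p.2)) (x, y)) (hmeas.indicator hset).aemeasurable,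
      ← lintegral_const_mul _ (by fun_prop)]
    refine lintegral_congr fun y => ?_
    have h2 : ∀ x : Euc d, {p : Euc d × Euc d | dist p.2 p.1 < r}.indicator
          (fun p => ‖φ p.2‖ₑ ^ 2 * ENNReal.ofReal (dens p.2)) (x, y)
        = (Metric.ball y r).indicator
          (fun _ => ‖φ y‖ₑ ^ 2 * ENNReal.ofReal (dens y)) x := fun x => by
      simp [Set.indicator, dist_comm]
    simp only [h2]
    rw [lintegral_indicator measurableSet_ball, setLIntegral_const,
      Measure.addHaar_ball_center, mul_comm]
  refine ne_top_of_le_ne_top (b := 2 * (c ^ 2 * (CG * (volume (Metric.ball (0 : Euc d) r)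
    * ∫⁻ y, ‖φ y‖ₑ ^ 2 * ENNReal.ofReal (dens y)))) + 2 * c ^ 2 * ∫⁻ x, ENNReal.ofReal (f x)) ?_ ?_
  · have : volume (Metric.ball (0 : Euc d) r) ≠ ∞ := measure_ball_lt_top.ne
    finiteness
  rw [← hball]
  calc _ ≤ ∫⁻ x, (2 * (c ^ 2 * (CG * ∫⁻ y in Metric.ball x r,
          ‖φ y‖ₑ ^ 2 * ENNReal.ofReal (dens y))) + 2 * c ^ 2 * ENNReal.ofReal (f x)) := by
        refine lintegral_mono fun x => ?_
        calc ‖φ x‖ₑ ^ 2 * ENNReal.ofReal (f x)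
            ≤ (2 * (c * ∫⁻ y in Metric.ball x r, ‖φ y‖ₑ) ^ 2 + 2 * c ^ 2)
              * ENNReal.ofReal (f x) := by
              gcongr
              exact (pow_le_pow_left' (hc x) 2).trans (add_sq_le_ennreal _ _)
          _ = 2 * (c ^ 2 * (ENNReal.ofReal (f x) * (∫⁻ y in Metric.ball x r, ‖φ y‖ₑ) ^ 2))
              + 2 * c ^ 2 * ENNReal.ofReal (f x) := by ring
          _ ≤ _ := by gcongr ?_ + _; exact mul_le_mul_right (mul_le_mul_right (hloc x) _) _
    _ = _ := by
        rw [lintegral_add_right _ (by fun_prop), lintegral_const_mul' _ _ (by simp),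
          lintegral_const_mul' _ _ (by simp), lintegral_const_mul' _ _ hCGtop,
          lintegral_const_mul' _ _ (by finiteness)]

end SecondMoment


/-! ### Integrated bias and second moment of the rescaled kernel. -/

section Smoothing

variable {d : ℕ}

/-- The modulus of the rescaled kernel `h^{-d} K((z - x) / h)`. -/
noncomputable def scaledKernel (K : Euc d → ℝ) (h : ℝ) (x z : Euc d) : ℝ≥0∞ :=
  ENNReal.ofReal (h ^ d)⁻¹ * ‖K (h⁻¹ • (z - x))‖ₑ

/-- The rescaled kernel restricted to displacements of length at least `r`. -/
noncomputable def tailKernel (K : Euc d → ℝ) (h r : ℝ) (x z : Euc d) : ℝ≥0∞ :=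
  if r ≤ ‖z - x‖ then scaledKernel K h x z else 0

/-- Weighted mass of the squared rescaled kernel away from its centre. -/
noncomputable def tailMass (f dens K : Euc d → ℝ) (h r : ℝ) : ℝ≥0∞ :=
  ∫⁻ x, (∫⁻ z, tailKernel K h r x z ^ 2 / ENNReal.ofReal (dens z)) ∂densMeasure f

theorem measurable_scaledKernel {K : Euc d → ℝ} (hK : Measurable K) (h : ℝ) :
    Measurable fun p : Euc d × Euc d => scaledKernel K h p.1 p.2 := by
  unfold scaledKernel
  fun_prop

theorem measurable_tailKernel {K : Euc d → ℝ} (hK : Measurable K) (h r : ℝ) :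
    Measurable fun p : Euc d × Euc d => tailKernel K h r p.1 p.2 :=
  Measurable.ite (measurableSet_le measurable_const (by fun_prop)) (measurable_scaledKernel hK h)
    measurable_const

theorem measurable_scaledKernel_left {K : Euc d → ℝ} (hK : Measurable K) (h : ℝ) (z : Euc d) :
    Measurable fun y => scaledKernel K h y z := by
  unfold scaledKernel
  fun_prop

theorem measurable_tailKernel_left {K : Euc d → ℝ} (hK : Measurable K) (h r : ℝ) (z : Euc d) :
    Measurable fun y => tailKernel K h r y z := by
  unfold tailKernel
  exact Measurable.ite (measurableSet_le measurable_const (by fun_prop))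
    (measurable_scaledKernel_left hK h z) measurable_const

/-- Substituting `z = x + hu` turns the far part of the smoothing bias into an integral against the
tail kernel, the form in which the hypothesis on the tails of `K` can be used. -/
theorem lintegral_large_displacement_eq {h : ℝ} (hh : 0 < h) (K : Euc d → ℝ) (r : ℝ)
    (Φ : Euc d → ℝ≥0∞) (x : Euc d) :
    ∫⁻ u, ‖K u‖ₑ * (if r ≤ ‖h • u‖ then Φ (x + h • u) else 0)
      = ∫⁻ z, tailKernel K h r x z * Φ z := by
  have h1 := lintegral_kernel_eq hh x (fun u => if r ≤ ‖h • u‖ then ‖K u‖ₑ else 0) Φ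
  have h2 : ∀ y : Euc d, h • h⁻¹ • (y - x) = y - x := fun y => by
    rw [smul_smul, mul_inv_cancel₀ hh.ne', one_smul]
  simp only [h2] at h1
  trans ∫⁻ u, (if r ≤ ‖h • u‖ then ‖K u‖ₑ else 0) * Φ (x + h • u)
  · exact lintegral_congr fun u => by split_ifs <;> simp
  · refine h1.trans (lintegral_congr fun z => ?_)
    simp only [tailKernel, scaledKernel]
    split_ifs <;> simp

theorem lintegral_large_displacement_eq' {h : ℝ} (hh : 0 < h) (K : Euc d → ℝ) (r : ℝ)
    (Φ : Euc d → ℝ≥0∞) (z : Euc d) :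
    ∫⁻ u, ‖K u‖ₑ * (if r ≤ ‖(-h) • u‖ then Φ (z + (-h) • u) else 0)
      = ∫⁻ y, tailKernel K h r y z * Φ y := by
  have h1 := lintegral_kernel_eq' hh z (fun u => if r ≤ ‖(-h) • u‖ then ‖K u‖ₑ else 0) Φ
  have h2 : ∀ y : Euc d, ‖(-h) • h⁻¹ • (z - y)‖ = ‖z - y‖ := fun y => by
    rw [neg_smul, smul_smul, mul_inv_cancel₀ hh.ne', one_smul, norm_neg]
  simp only [h2] at h1
  trans ∫⁻ u, (if r ≤ ‖(-h) • u‖ then ‖K u‖ₑ else 0) * Φ (z + (-h) • u)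
  · exact lintegral_congr fun u => by split_ifs <;> simp
  · refine h1.trans (lintegral_congr fun z => ?_)
    simp only [tailKernel, scaledKernel]
    split_ifs <;> simp

theorem lintegral_densMeasure {f : Euc d → ℝ} (hf : Measurable f) (F : Euc d → ℝ≥0∞) :
    ∫⁻ x, F x ∂densMeasure f = ∫⁻ x, ENNReal.ofReal (f x) * F x := by
  unfold densMeasure
  rw [lintegral_withDensity_eq_lintegral_mul_non_measurable _ (by fun_prop)
    (Eventually.of_forall fun _ => ENNReal.ofReal_lt_top)]
  rfl

instance (f : Euc d → ℝ) : SFinite (densMeasure f) := by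
  unfold densMeasure; infer_instance

theorem tailMass_eq {f dens K : Euc d → ℝ} (hdens : Measurable dens) (hK : Measurable K) (h r : ℝ) :
    tailMass f dens K h r
      = ∫⁻ z, (∫⁻ y, tailKernel K h r y z ^ 2 ∂densMeasure f) / ENNReal.ofReal (dens z) := by
  have hAm := measurable_tailKernel hK h r
  unfold tailMass
  rw [lintegral_lintegral_swap (f := fun x z => tailKernel K h r x z ^ 2 / ENNReal.ofReal (dens z))
    (Measurable.aemeasurable (by simp only [Function.uncurry_def]; fun_prop))]
  refine lintegral_congr fun z => ?_
  simp only [div_eq_mul_inv]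
  rw [lintegral_mul_const _ ((measurable_tailKernel_left hK h r z).pow_const 2)]

theorem IsProbDensity.isProbabilityMeasure {f : Euc d → ℝ} (hf : IsProbDensity f) :
    IsProbabilityMeasure (densMeasure f) := by
  refine ⟨?_⟩
  unfold densMeasure
  rw [withDensity_apply _ MeasurableSet.univ, Measure.restrict_univ, hf.2.2]

theorem MomentKernel.lintegral_pow_ne_top {ρ : ℕ} {K : Euc d → ℝ} (hK : MomentKernel ρ K) :
    ∫⁻ u, ‖K u‖ₑ * ENNReal.ofReal (‖u‖ ^ ρ) ≠ ∞ := by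
  have h1 := hK.integrable_pow.2.ne
  convert h1 using 3 with u
  rw [enorm_mul, ← ofReal_norm, ← ofReal_norm (‖u‖ ^ ρ), norm_pow, norm_norm,
    ← ofReal_norm |K u|, norm_abs_eq_norm, mul_comm]

theorem norm_direction_le {r : ℝ} (hr : 0 < r) (b : ℕ) (k : Fin b) (y : Euc d) :
    ‖node b k • (r / ‖y‖) • y‖ ≤ r := by
  have h1 : ‖(r / ‖y‖) • y‖ ≤ r := by
    rw [norm_smul, norm_div, norm_norm, Real.norm_eq_abs, abs_of_pos hr]
    rcases eq_or_ne ‖y‖ 0 with h0 | h0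
    · rw [h0]; simpa using hr.le
    · rw [div_mul_cancel₀ _ h0]
  rw [norm_smul, Real.norm_eq_abs, abs_of_pos (node_pos b k)]
  exact (mul_le_of_le_one_left (norm_nonneg _) (node_le_one b k)).trans h1

/-- First moment of the smoothing bias of a function that is square integrable for `dens`. -/
theorem exists_lintegral_smoothing_bias_le {ρ : ℕ} (hρ : 1 ≤ ρ) {K : Euc d → ℝ}
    (hKm : Measurable K) (hK : MomentKernel ρ K) {f dens : Euc d → ℝ} (hf : IsProbDensity f)
    (hdens : Measurable dens) {R₂ : ℝ} (hR₂ : 0 < R₂) {G : Euc d → ℝ≥0∞}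
    (hG : Envelope f dens 2 R₂ G) {υ R η : ℝ} (hυ : (ρ : ℝ) < υ) (hR : 0 < R) (hη : 0 ≤ η)
    {φ : Euc d → ℝ} (hφ : Continuous φ) (hT : ∀ x, TaylorAt ⌈υ⌉₊ υ R η φ x)
    (hφ2 : ∫⁻ x, ‖φ x‖ₑ ^ 2 * ENNReal.ofReal (dens x) ≠ ∞) :
    ∃ c : ℝ≥0, ∃ r : ℝ, 0 < r ∧ ∀ h : ℝ, 0 < h →
      (∀ᵐ x ∂densMeasure f, Integrable (fun u => K u • φ (x + h • u)) volume) →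
      ∫⁻ x, ‖(∫ u, K u • φ (x + h • u)) - φ x‖ₑ ∂densMeasure f
        ≤ c * ENNReal.ofReal (h ^ ρ) + c * tailMass f dens K h r ^ (1 / 2 : ℝ) := by
  set r := min R₂ R / 2 with hr
  have hr0 : 0 < r := by positivity
  have hrR₂ : r < R₂ := by have := min_le_left R₂ R; rw [hr]; linarith [lt_min hR₂ hR]
  have hrR : r < R := by have := min_le_right R₂ R; rw [hr]; linarith [lt_min hR₂ hR]
  have hρb : ρ < ⌈υ⌉₊ := Nat.lt_ceil.2 hυ
  set b := ⌈υ⌉₊ with hb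
  obtain ⟨C, hC, hrem⟩ := exists_taylor_remainder_le ℝ hρ hρb hυ hr0
  have hφm : Measurable fun x => ‖φ x‖ₑ := hφ.enorm.measurable
  set cφ := ∫⁻ x, ‖φ x‖ₑ ^ 2 * ENNReal.ofReal (dens x) with hcφ
  set cG := ∫⁻ x, G x * ‖φ x‖ₑ with hcG
  have hcGtop : cG ≠ ∞ := by
    have h1 := lintegral_mul_sq_le_weight hG.aemeasurable hφm.aemeasurable
      (ϖ := fun x => ENNReal.ofReal (dens x)) (by fun_prop) (fun _ => ENNReal.ofReal_ne_top)
      hG.lintegral_ne_top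
    intro h2
    rw [← hcG, h2, ← hcφ] at h1
    refine ENNReal.mul_ne_top hG.lintegral_ne_top hφ2 (top_le_iff.1 ?_)
    simpa using h1
  -- A translation moves the shift from `φ` onto `f`, where the envelope absorbs it. The constant
  -- `cG` is finite by weighted Cauchy-Schwarz between `G` and `φ`.
  have hshift : ∀ v : Euc d, ‖v‖ ≤ r → ∫⁻ x, ‖φ (x + v)‖ₑ ∂densMeasure f ≤ cG := fun v hv => by
    rw [lintegral_densMeasure hf.1,
      ← lintegral_sub_right_eq_self (fun x => ENNReal.ofReal (f x) * ‖φ (x + v)‖ₑ) v]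
    refine lintegral_mono fun x => ?_
    rw [sub_add_cancel]
    gcongr
    refine hG.le x _ ?_
    simpa using hv.trans_lt hrR₂
  set κ := ∫⁻ u, ‖K u‖ₑ * ENNReal.ofReal (‖u‖ ^ ρ) with hκ
  have hκtop : κ ≠ ∞ := hK.lintegral_pow_ne_top
  set c₁ := ENNReal.ofReal C * (κ * (b * cG + ENNReal.ofReal η)) with hc₁
  have hc₁top : c₁ ≠ ∞ := by finiteness
  have hc₂top : cφ ^ (1 / 2 : ℝ) ≠ ∞ := ENNReal.rpow_ne_top_of_nonneg (by norm_num) hφ2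
  have hprob := hf.isProbabilityMeasure
  -- The summand 1 keeps the coefficient of the tail mass nonzero, so that the bound is trivial when
  -- that mass is infinite.
  refine ⟨(c₁ + cφ ^ (1 / 2 : ℝ) + 1).toNNReal, r, hr0, fun h hh hint => ?_⟩
  rw [ENNReal.coe_toNNReal (by finiteness)]
  set dir : Fin b → Euc d → Euc d := fun k u => node b k • (r / ‖h • u‖) • (h • u) with hdir
  have hdirm : ∀ k, Measurable (dir k) := fun k => by simp only [hdir]; fun_prop
  have hdirr : ∀ k u, ‖dir k u‖ ≤ r := fun k u => norm_direction_le hr0 b k _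
  -- the contribution of small displacements
  have hT2 : ∫⁻ x, (∫⁻ u, ‖K u‖ₑ * (ENNReal.ofReal (C * |h| ^ ρ * ‖u‖ ^ ρ) *
        (∑ k, ‖φ (x + dir k u)‖ₑ + ENNReal.ofReal η))) ∂densMeasure f
      ≤ c₁ * ENNReal.ofReal (h ^ ρ) := by
    have hm1 : ∀ k, Measurable fun p : Euc d × Euc d => ‖φ (p.1 + dir k p.2)‖ₑ := fun k =>
      hφm.comp (measurable_fst.add ((hdirm k).comp measurable_snd))
    rw [lintegral_lintegral_swap (f := fun x u => ‖K u‖ₑ *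
      (ENNReal.ofReal (C * |h| ^ ρ * ‖u‖ ^ ρ) * (∑ k, ‖φ (x + dir k u)‖ₑ + ENNReal.ofReal η)))
      (Measurable.aemeasurable (by
        have := Finset.measurable_fun_sum Finset.univ fun k _ => hm1 k
        simp only [Function.uncurry_def]
        fun_prop))]
    have hin : ∀ u, ∫⁻ x, ‖K u‖ₑ * (ENNReal.ofReal (C * |h| ^ ρ * ‖u‖ ^ ρ) *
        (∑ k, ‖φ (x + dir k u)‖ₑ + ENNReal.ofReal η)) ∂densMeasure f
        ≤ ENNReal.ofReal (C * h ^ ρ) * (b * cG + ENNReal.ofReal η)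
          * (‖K u‖ₑ * ENNReal.ofReal (‖u‖ ^ ρ)) := fun u => by
      have hm2 : ∀ k, Measurable fun x : Euc d => ‖φ (x + dir k u)‖ₑ := fun k =>
        hφm.comp (by fun_prop)
      rw [lintegral_const_mul' _ _ (by simp), lintegral_const_mul' _ _ (by simp),
        lintegral_add_right _ measurable_const, lintegral_finsetSum _ fun k _ => hm2 k,
        abs_of_pos hh, ENNReal.ofReal_mul (by positivity)]
      have h3 : ∑ k, ∫⁻ x, ‖φ (x + dir k u)‖ₑ ∂densMeasure f ≤ b * cG :=
        (Finset.sum_le_sum fun k _ => hshift _ (hdirr k u)).trans (by simp)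
      calc _ ≤ ‖K u‖ₑ * (ENNReal.ofReal (C * h ^ ρ) * ENNReal.ofReal (‖u‖ ^ ρ)
            * (b * cG + ENNReal.ofReal η)) := by gcongr; simp
        _ = _ := by ring
    refine (lintegral_mono hin).trans (le_of_eq ?_)
    rw [lintegral_const_mul' _ _ (by finiteness), ENNReal.ofReal_mul hC, hc₁]
    ring
  -- the contribution of large displacements
  have hAm := measurable_tailKernel hKm h r
  have hT1 : ∫⁻ x, (∫⁻ z, tailKernel K h r x z * ‖φ z‖ₑ) ∂densMeasure f
      ≤ (cφ ^ (1 / 2 : ℝ) + 1) * tailMass f dens K h r ^ (1 / 2 : ℝ) := by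
    rcases eq_or_ne (tailMass f dens K h r) ∞ with htop | hfin
    · rw [htop, ENNReal.top_rpow_of_pos (by norm_num), ENNReal.mul_top (by simp)]
      exact le_top
    have hw : Measurable fun p : Euc d × Euc d => ENNReal.ofReal (dens p.2) := by fun_prop
    have hg : Measurable fun p : Euc d × Euc d => ‖φ p.2‖ₑ := hφm.comp measurable_snd
    have e1 : ∫⁻ p, tailKernel K h r p.1 p.2 ^ 2 / ENNReal.ofReal (dens p.2)
        ∂(densMeasure f).prod volume = tailMass f dens K h r := by
      rw [lintegral_prod _ (by fun_prop)]
      rfl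
    -- Cauchy-Schwarz on the product space with weight `dens(z)`. The factor containing `φ` does not
    -- depend on `x`, and `f` has mass one, so it equals `cφ`.
    have h1 := lintegral_mul_sq_le_weight (μ := (densMeasure f).prod volume) hAm.aemeasurable
      hg.aemeasurable hw.aemeasurable (fun _ => ENNReal.ofReal_ne_top) (by rw [e1]; exact hfin)
    rw [e1, lintegral_prod _ (by fun_prop), lintegral_prod _ (by fun_prop)] at h1
    simp only [lintegral_const, measure_univ, mul_one] at h1
    have h2 : ∀ y : ℝ≥0∞, (y ^ 2) ^ (1 / 2 : ℝ) = y := fun y => by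
      rw [← ENNReal.rpow_natCast, ← ENNReal.rpow_mul]; norm_num
    have h3 := ENNReal.rpow_le_rpow h1 (by norm_num : (0 : ℝ) ≤ 1 / 2)
    rw [h2, ENNReal.mul_rpow_of_nonneg _ _ (by norm_num), mul_comm] at h3
    refine h3.trans ?_
    gcongr
    exact le_self_add
  have hmain : ∫⁻ x, ‖(∫ u, K u • φ (x + h • u)) - φ x‖ₑ ∂densMeasure f
      ≤ ∫⁻ x, ((∫⁻ z, tailKernel K h r x z * ‖φ z‖ₑ)
        + ∫⁻ u, ‖K u‖ₑ * (ENNReal.ofReal (C * |h| ^ ρ * ‖u‖ ^ ρ) *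
          (∑ k, ‖φ (x + dir k u)‖ₑ + ENNReal.ofReal η))) ∂densMeasure f := by
    refine lintegral_mono_ae ?_
    filter_upwards [hint] with x hx
    refine (hK.enorm_smooth_sub_le hC hη (fun y => hrem d R η φ x hrR hη (hT x) y) h hx).trans ?_
    rw [← lintegral_large_displacement_eq hh, ← lintegral_add_left]
    · exact lintegral_mono fun u => by rw [mul_add]
    · refine hKm.enorm.mul (Measurable.ite ?_ (hφm.comp (by fun_prop)) measurable_const)
      exact measurableSet_le measurable_const (by fun_prop)
  refine hmain.trans ?_
  rw [lintegral_add_left (by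
    exact Measurable.lintegral_prod_right'
      (f := fun p : Euc d × Euc d => tailKernel K h r p.1 p.2 * ‖φ p.2‖ₑ)
      (hAm.mul (hφm.comp measurable_snd)))]
  calc _ ≤ (cφ ^ (1 / 2 : ℝ) + 1) * tailMass f dens K h r ^ (1 / 2 : ℝ)
        + c₁ * ENNReal.ofReal (h ^ ρ) := add_le_add hT1 hT2
    _ ≤ _ := by
      rw [add_comm, add_assoc c₁]
      exact add_le_add (mul_le_mul_left le_self_add _) (mul_le_mul_left le_add_self _)

/-- Weighted mean square of the smoothing bias, uniformly over a class of functions dominated by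
the density `f`. -/
theorem exists_lintegral_smoothing_bias_sq_le {𝕜 : Type*} [RCLike 𝕜] {ρ : ℕ} (hρ : 1 ≤ ρ)
    {K : Euc d → ℝ} (hKm : Measurable K) (hK : MomentKernel ρ K) {f dens : Euc d → ℝ}
    (hf : IsProbDensity f) (hdens : Measurable dens) {R₂ : ℝ} (hR₂ : 0 < R₂)
    {G : Euc d → ℝ≥0∞} (hG : Envelope f dens 2 R₂ G) {υ R : ℝ} (hυ : (ρ : ℝ) < υ)
    (hR : 0 < R) (Cw : ℝ) (hCw : 0 ≤ Cw) (C₂ : ℝ≥0) :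
    ∃ c : ℝ≥0, ∃ r : ℝ, 0 < r ∧ ∀ (g : Euc d → 𝕜) (η : Euc d → ℝ), Continuous g →
      AEMeasurable η volume → (∀ x, 0 ≤ η x) → (∀ x, TaylorAt ⌈υ⌉₊ υ R (η x) g x) →
      ∫⁻ x, ENNReal.ofReal (η x) ^ 2 / ENNReal.ofReal (dens x) ≤ C₂ → (∀ x, ‖g x‖ ≤ Cw * f x) →
      ∀ h : ℝ, 0 < h →
      ∫⁻ z, ‖(∫ u, K u • g (z + (-h) • u)) - g z‖ₑ ^ 2 / ENNReal.ofReal (dens z)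
        ≤ c * (ENNReal.ofReal (h ^ (2 * ρ)) + tailMass f dens K h r) := by
  set r := min R₂ R / 2 with hr
  have hr0 : 0 < r := by positivity
  have hrR₂ : r < R₂ := by have := min_le_left R₂ R; rw [hr]; linarith [lt_min hR₂ hR]
  have hrR : r < R := by have := min_le_right R₂ R; rw [hr]; linarith [lt_min hR₂ hR]
  have hρb : ρ < ⌈υ⌉₊ := Nat.lt_ceil.2 hυ
  set b := ⌈υ⌉₊ with hb
  obtain ⟨C, hC, hrem⟩ := exists_taylor_remainder_le 𝕜 hρ hρb hυ hr0
  set κ := ∫⁻ u, ‖K u‖ₑ * ENNReal.ofReal (‖u‖ ^ ρ) with hκ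
  have hκtop : κ ≠ ∞ := hK.lintegral_pow_ne_top
  set cG := ∫⁻ x, G x ^ 2 / ENNReal.ofReal (dens x) with hcG
  have hcGtop : cG ≠ ∞ := hG.lintegral_ne_top
  have hprob := hf.isProbabilityMeasure
  set cw := ENNReal.ofReal Cw with hcw
  set c₁ := 2 * cw ^ 2 with hc₁
  set c₂ := 2 * (ENNReal.ofReal C ^ 2 * κ ^ 2) * (2 * (b * cw) ^ 2 * cG + 2 * C₂) with hc₂
  have hcwtop : cw ≠ ∞ := by simp [hcw]
  have hc₁top : c₁ ≠ ∞ := by finiteness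
  have hc₂top : c₂ ≠ ∞ := by finiteness
  refine ⟨(c₁ + c₂).toNNReal, r, hr0, fun g η hg hηm hη0 hT hηC hgf h hh => ?_⟩
  rw [ENNReal.coe_toNNReal (by finiteness)]
  have hgf' : ∀ x, ‖g x‖ₑ ≤ cw * ENNReal.ofReal (f x) := fun x => by
    rw [hcw, ← ENNReal.ofReal_mul hCw, ← ofReal_norm]
    exact ENNReal.ofReal_le_ofReal (hgf x)
  have hgm : Measurable fun x => ‖g x‖ₑ := hg.enorm.measurable
  have hfm : Measurable f := hf.1
  have hAm := measurable_tailKernel hKm h r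
  set t : Euc d → ℝ≥0∞ := fun z => ∫⁻ y, tailKernel K h r y z ∂densMeasure f with ht
  have htm : Measurable t := hAm.lintegral_prod_left'
  -- By Tonelli the convolution of `|K|` with `f` has finite integral, hence is finite almost
  -- everywhere, and it dominates because `‖g‖ ≤ Cw f`.
  have hint : ∀ᵐ z, Integrable (fun u => K u • g (z + (-h) • u)) volume := by
    have h1 : ∫⁻ z, ∫⁻ u, ‖K u‖ₑ * ENNReal.ofReal (f (z + (-h) • u)) ≠ ∞ := by
      rw [lintegral_lintegral_swap (f := fun z u => ‖K u‖ₑ * ENNReal.ofReal (f (z + (-h) • u)))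
        (Measurable.aemeasurable (by simp only [Function.uncurry_def]; fun_prop))]
      have h2 : ∀ u, ∫⁻ z, ‖K u‖ₑ * ENNReal.ofReal (f (z + (-h) • u)) = ‖K u‖ₑ := fun u => by
        rw [lintegral_const_mul' _ _ (by simp),
          lintegral_add_right_eq_self (fun z => ENNReal.ofReal (f z)), hf.2.2, mul_one]
      simp only [h2]
      exact hK.integrable.2.ne
    have hm : Measurable fun z => ∫⁻ u, ‖K u‖ₑ * ENNReal.ofReal (f (z + (-h) • u)) :=
      Measurable.lintegral_prod_right'
        (f := fun p : Euc d × Euc d => ‖K p.2‖ₑ * ENNReal.ofReal (f (p.1 + (-h) • p.2)))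
        (by fun_prop)
    filter_upwards [ae_lt_top hm h1] with z hz
    refine ⟨(hKm.aestronglyMeasurable.smul
      (hg.comp (by fun_prop)).aestronglyMeasurable), ?_⟩
    refine lt_of_le_of_lt (b := cw * ∫⁻ u, ‖K u‖ₑ * ENNReal.ofReal (f (z + (-h) • u))) ?_
      (ENNReal.mul_lt_top hcwtop.lt_top hz)
    rw [← lintegral_const_mul' _ _ hcwtop]
    refine lintegral_mono fun u => ?_
    rw [enorm_smul, mul_left_comm]
    gcongr
    exact hgf' _
  -- pointwise bound of the bias
  have hpt : ∀ᵐ z, ‖(∫ u, K u • g (z + (-h) • u)) - g z‖ₑ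
      ≤ cw * t z + ENNReal.ofReal (C * h ^ ρ) * κ * (b * cw * G z + ENNReal.ofReal (η z)) := by
    filter_upwards [hint] with z hz
    refine (hK.enorm_smooth_sub_le hC (hη0 z)
      (fun y => hrem d R (η z) g z hrR (hη0 z) (hT z) y) (-h) hz).trans ?_
    calc _ ≤ ∫⁻ u, (‖K u‖ₑ * (if r ≤ ‖(-h) • u‖ then cw * ENNReal.ofReal (f (z + (-h) • u)) else 0)
          + ENNReal.ofReal (C * h ^ ρ) * (b * cw * G z + ENNReal.ofReal (η z))
            * (‖K u‖ₑ * ENNReal.ofReal (‖u‖ ^ ρ))) := by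
          refine lintegral_mono fun u => ?_
          rw [abs_neg, abs_of_pos hh, ENNReal.ofReal_mul (p := C * h ^ ρ) (by positivity), mul_add]
          refine add_le_add ?_ ?_
          · gcongr
            split_ifs
            · exact hgf' _
            · exact le_rfl
          · calc _ ≤ ‖K u‖ₑ * (ENNReal.ofReal (C * h ^ ρ) * ENNReal.ofReal (‖u‖ ^ ρ)
                  * (b * cw * G z + ENNReal.ofReal (η z))) := by
                  gcongr
                  refine (Finset.sum_le_sum (g := fun _ => cw * G z) fun k _ =>
                    (hgf' _).trans ?_).trans (by simp [mul_assoc])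
                  gcongr
                  refine hG.le z _ ?_
                  rw [add_sub_cancel_left]
                  exact (norm_direction_le hr0 b k _).trans_lt hrR₂
              _ = _ := by ring
      _ = cw * t z
          + ENNReal.ofReal (C * h ^ ρ) * (b * cw * G z + ENNReal.ofReal (η z)) * κ := by
          rw [lintegral_add_left, lintegral_large_displacement_eq' hh K r
            (fun y => cw * ENNReal.ofReal (f y)), lintegral_const_mul _ (by fun_prop)]
          · congr 1
            rw [ht]
            simp only
            rw [lintegral_densMeasure hf.1, ← lintegral_const_mul' _ _ hcwtop]
            exact lintegral_congr fun y => by ring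
          · refine hKm.enorm.mul (Measurable.ite ?_ (by fun_prop) measurable_const)
            exact measurableSet_le measurable_const (by fun_prop)
      _ = _ := by ring
  -- Jensen for the probability density `f`. It converts the squared far part into the tail mass
  -- after division by `dens` and integration in `z`.
  have htsq : ∀ z, t z ^ 2 ≤ ∫⁻ y, tailKernel K h r y z ^ 2 ∂densMeasure f := fun z => by
    have h1 := lintegral_mul_sq_le (μ := densMeasure f) (f := fun y => tailKernel K h r y z)
      (g := fun _ => 1) (measurable_tailKernel_left hKm h r z).aemeasurable
      aemeasurable_const
    simpa using h1
  have htint : ∫⁻ z, t z ^ 2 / ENNReal.ofReal (dens z) ≤ tailMass f dens K h r := by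
    rw [tailMass_eq hdens hKm]
    refine lintegral_mono fun z => ?_
    gcongr
    exact htsq z
  set s := ENNReal.ofReal (h ^ (2 * ρ)) with hs
  have hs' : ENNReal.ofReal (C * h ^ ρ) ^ 2 = ENNReal.ofReal C ^ 2 * s := by
    rw [ENNReal.ofReal_mul hC, mul_pow, hs, mul_comm 2 ρ, pow_mul h,
      ENNReal.ofReal_pow (pow_nonneg hh.le ρ) 2]
  have hGm := hG.aemeasurable
  have hηm' : AEMeasurable (fun z => ENNReal.ofReal (η z)) volume := hηm.ennreal_ofReal
  calc _ ≤ ∫⁻ z, (c₁ * (t z ^ 2 / ENNReal.ofReal (dens z))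
          + 2 * (ENNReal.ofReal C ^ 2 * κ ^ 2 * s) *
            (2 * (b * cw) ^ 2 * (G z ^ 2 / ENNReal.ofReal (dens z))
              + 2 * (ENNReal.ofReal (η z) ^ 2 / ENNReal.ofReal (dens z)))) := by
        refine lintegral_mono_ae ?_
        filter_upwards [hpt] with z hz
        simp only [div_eq_mul_inv]
        calc _ ≤ (2 * (cw * t z) ^ 2 + 2 * (ENNReal.ofReal (C * h ^ ρ) * κ
              * (b * cw * G z + ENNReal.ofReal (η z))) ^ 2) * (ENNReal.ofReal (dens z))⁻¹ := by
              gcongr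
              exact (pow_le_pow_left' hz 2).trans (add_sq_le_ennreal _ _)
          _ ≤ (2 * (cw * t z) ^ 2 + 2 * (ENNReal.ofReal C ^ 2 * s * κ ^ 2
              * (2 * (b * cw * G z) ^ 2 + 2 * ENNReal.ofReal (η z) ^ 2)))
              * (ENNReal.ofReal (dens z))⁻¹ := by
              gcongr
              rw [mul_pow, mul_pow, hs']
              gcongr
              exact add_sq_le_ennreal _ _
          _ = _ := by rw [hc₁]; ring
    _ = c₁ * (∫⁻ z, t z ^ 2 / ENNReal.ofReal (dens z))
          + 2 * (ENNReal.ofReal C ^ 2 * κ ^ 2 * s) * (2 * (b * cw) ^ 2 * cG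
            + 2 * ∫⁻ z, ENNReal.ofReal (η z) ^ 2 / ENNReal.ofReal (dens z)) := by
        have hm1 : AEMeasurable (fun z => G z ^ 2 / ENNReal.ofReal (dens z)) volume := by fun_prop
        have hm2 : AEMeasurable (fun z => ENNReal.ofReal (η z) ^ 2 / ENNReal.ofReal (dens z))
          volume := by fun_prop
        have hm3 : AEMeasurable (fun z => t z ^ 2 / ENNReal.ofReal (dens z)) volume := by fun_prop
        rw [lintegral_add_left' (by fun_prop), lintegral_const_mul' _ _ hc₁top,
          lintegral_const_mul'' _ (by fun_prop), lintegral_add_left' (by fun_prop),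
          lintegral_const_mul'' _ hm1, lintegral_const_mul'' _ hm2]
    _ ≤ c₁ * tailMass f dens K h r + 2 * (ENNReal.ofReal C ^ 2 * κ ^ 2 * s)
          * (2 * (b * cw) ^ 2 * cG + 2 * C₂) := by gcongr
    _ = c₂ * s + c₁ * tailMass f dens K h r := by rw [hc₂]; ring
    _ ≤ _ := by
        rw [mul_add]
        exact add_le_add (mul_le_mul_left le_add_self _) (mul_le_mul_left le_self_add _)

/-- Weighted second moment of the rescaled kernel. -/
theorem exists_lintegral_scaledKernel_sq_le {K : Euc d → ℝ} (hKm : Measurable K)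
    (hK2 : Integrable (fun u => K u ^ 2) volume) {f dens : Euc d → ℝ} (hf : IsProbDensity f)
    (hdens : Measurable dens) {R₁ : ℝ} (hR₁ : 0 < R₁) {G : Euc d → ℝ≥0∞}
    (hG : Envelope f dens 1 R₁ G) :
    ∃ c : ℝ≥0, ∃ r : ℝ, 0 < r ∧ ∀ h : ℝ, 0 < h →
      ∫⁻ z, (∫⁻ y, scaledKernel K h y z ^ 2 ∂densMeasure f) / ENNReal.ofReal (dens z)
        ≤ c * (ENNReal.ofReal (h ^ d)⁻¹ + tailMass f dens K h r) := by
  set cK := ∫⁻ u, ‖K u‖ₑ ^ 2 with hcK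
  have hcKtop : cK ≠ ∞ := by
    have h1 := hK2.2.ne
    rw [hcK]
    convert h1 using 3 with u
    rw [enorm_pow]
  set cG := ∫⁻ x, G x / ENNReal.ofReal (dens x) with hcG
  have hcGtop : cG ≠ ∞ := by simpa using hG.lintegral_ne_top
  refine ⟨(cK * cG + 1).toNNReal, R₁, hR₁, fun h hh => ?_⟩
  rw [ENNReal.coe_toNNReal (by finiteness)]
  have hAm := measurable_tailKernel hKm h R₁
  -- Of the two factors `h^{-d}` in the square, the change of variables consumes one.
  have hsq : ∀ z, ∫⁻ y, scaledKernel K h y z ^ 2 = ENNReal.ofReal (h ^ d)⁻¹ * cK := fun z => by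
    have h1 := lintegral_comp_scale_sub' hh z (fun u => ENNReal.ofReal (h ^ d)⁻¹ ^ 2 * ‖K u‖ₑ ^ 2)
    simp only [scaledKernel, mul_pow]
    rw [h1, lintegral_const_mul' _ _ (by finiteness), ← mul_assoc, sq, ← mul_assoc,
      ← ENNReal.ofReal_mul (by positivity), mul_inv_cancel₀ (by positivity), ENNReal.ofReal_one,
      one_mul]
  -- For `y` near `z` the density obeys `f(y) ≤ G(z)` and leaves a Lebesgue integral of the squared
  -- kernel; the far part is the tail kernel.
  have hpt : ∀ z, ∫⁻ y, scaledKernel K h y z ^ 2 ∂densMeasure f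
      ≤ ENNReal.ofReal (h ^ d)⁻¹ * cK * G z
        + ∫⁻ y, tailKernel K h R₁ y z ^ 2 ∂densMeasure f := fun z => by
    have hSy := measurable_scaledKernel_left hKm h z
    rw [lintegral_densMeasure hf.1, lintegral_densMeasure hf.1, ← hsq z,
      ← lintegral_mul_const _ (hSy.pow_const 2), ← lintegral_add_left ((hSy.pow_const 2).mul_const _)]
    refine lintegral_mono fun y => ?_
    by_cases hyz : R₁ ≤ ‖z - y‖
    · simp only [tailKernel, if_pos hyz]
      exact le_add_self
    · refine le_add_right ?_
      rw [mul_comm]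
      gcongr
      exact hG.le z y (by rw [norm_sub_rev]; exact not_le.1 hyz)
  have htm : Measurable fun z => ∫⁻ y, tailKernel K h R₁ y z ^ 2 ∂densMeasure f :=
    (hAm.pow_const 2).lintegral_prod_left'
  calc _ ≤ ∫⁻ z, (ENNReal.ofReal (h ^ d)⁻¹ * cK * (G z / ENNReal.ofReal (dens z))
          + (∫⁻ y, tailKernel K h R₁ y z ^ 2 ∂densMeasure f) / ENNReal.ofReal (dens z)) := by
        refine lintegral_mono fun z => ?_
        rw [← mul_div_assoc, ← ENNReal.add_div]
        gcongr
        exact hpt z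
    _ = ENNReal.ofReal (h ^ d)⁻¹ * cK * cG + tailMass f dens K h R₁ := by
        rw [lintegral_add_right _ (by fun_prop), ← tailMass_eq hdens hKm,
          lintegral_const_mul' _ _ (by finiteness)]
    _ ≤ _ := by
        rw [mul_add]
        refine add_le_add ?_ ?_
        · calc _ = (cK * cG) * ENNReal.ofReal (h ^ d)⁻¹ := by ring
            _ ≤ _ := mul_le_mul_left le_self_add _
        · calc _ = 1 * tailMass f dens K h R₁ := (one_mul _).symm
            _ ≤ _ := mul_le_mul_left le_add_self _

end Smoothing


/-! ### The kernel `k(z,t)` and its domination by `f_Z`. -/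

section ConditionalKernel

variable {𝕜 : Type*} [RCLike 𝕜] {Ω : Type*} [MeasurableSpace Ω] {P : Measure Ω}
  [IsProbabilityMeasure P] {p q : ℕ} {Z : Ω → Euc p} {W : Ω → Euc q} {w : ℝ → 𝕜}
  {T : Set (Euc q)} {f dens : Euc p → ℝ} {C : ℝ}

/-- The bound over the possibly uncountable set `T` is a closed, hence measurable, condition on `v`.
It can therefore be transported through laws and disintegrations without losing uniformity in `t`.
-/
theorem isClosed_bounded_weight (hw : Continuous w) (T : Set (Euc q)) (C : ℝ) :
    IsClosed {v : Euc q | ∀ t ∈ T, ‖w (inner ℝ v t)‖ ≤ C} := by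
  have : {v : Euc q | ∀ t ∈ T, ‖w (inner ℝ v t)‖ ≤ C}
      = ⋂ t ∈ T, {v : Euc q | ‖w (inner ℝ v t)‖ ≤ C} := by
    ext v; simp
  rw [this]
  exact isClosed_biInter fun t _ => isClosed_le (by fun_prop) continuous_const

theorem ae_norm_condDistrib_integral_le (hZ : Measurable Z) (hW : Measurable W)
    (hw : Continuous w) (hC : ∀ᵐ s ∂P, ∀ t ∈ T, ‖w (inner ℝ (W s) t)‖ ≤ C) :
    ∀ᵐ z ∂P.map Z, ∀ t ∈ T, ‖∫ v, w (inner ℝ v t) ∂condDistrib W Z P z‖ ≤ C := by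
  have hmeas : MeasurableSet {x : Euc p × Euc q | ∀ t ∈ T, ‖w (inner ℝ x.2 t)‖ ≤ C} :=
    measurable_snd (isClosed_bounded_weight hw T C).measurableSet
  have h1 : ∀ᵐ x ∂(P.map Z) ⊗ₘ condDistrib W Z P, ∀ t ∈ T, ‖w (inner ℝ x.2 t)‖ ≤ C := by
    rw [compProd_map_condDistrib hW.aemeasurable]
    exact (ae_map_iff (hZ.prodMk hW).aemeasurable hmeas).2 hC
  filter_upwards [Measure.ae_ae_of_ae_compProd h1] with z hz t ht
  refine (norm_integral_le_of_norm_le_const (C := C) ?_).trans (by simp)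
  filter_upwards [hz] with v hv using hv t ht

/-- The conditional bound holds almost everywhere for the law of `Z`, that is, Lebesgue almost
everywhere on `{f > 0}`; elsewhere the factor `f(z)` makes the kernel zero. -/
theorem ae_norm_condKernel_le (hZ : Measurable Z) (hW : Measurable W)
    (hw : Continuous w) (hC : ∀ᵐ s ∂P, ∀ t ∈ T, ‖w (inner ℝ (W s) t)‖ ≤ C)
    (hf : IsProbDensity f) (hlaw : P.map Z = densMeasure f) :
    ∀ᵐ z, ∀ t ∈ T, ‖condKernel P Z W w f z t‖ ≤ C * f z := by
  have h1 := ae_norm_condDistrib_integral_le hZ hW hw hC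
  rw [hlaw, densMeasure, ae_withDensity_iff hf.1.ennreal_ofReal] at h1
  filter_upwards [h1] with z hz t ht
  unfold condKernel
  rw [norm_mul, RCLike.norm_ofReal, abs_of_nonneg (hf.2.1 z)]
  rcases eq_or_ne (f z) 0 with h0 | h0
  · simp [h0]
  · gcongr
    · exact hf.2.1 z
    · exact hz (by simpa using lt_of_le_of_ne (hf.2.1 z) h0.symm) t ht

theorem stronglyMeasurable_condKernel (hw : Continuous w) (hf : Measurable f) :
    StronglyMeasurable fun x : Euc p × Euc q => condKernel P Z W w f x.1 x.2 := by
  unfold condKernel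
  refine StronglyMeasurable.mul ?_ (by
    exact (RCLike.continuous_ofReal.measurable.comp (hf.comp measurable_fst)).stronglyMeasurable)
  have h1 : StronglyMeasurable fun y : (Euc p × Euc q) × Euc q => w (inner ℝ y.2 y.1.2) :=
    (hw.comp (by fun_prop)).stronglyMeasurable
  exact h1.integral_kernel_prod_right' (κ := (condDistrib W Z P).comap Prod.fst measurable_fst)

/-- Disintegration of a cross moment through the conditional kernel. -/
theorem integral_mul_weight_eq (hZ : Measurable Z) (hW : Measurable W)
    (hw : Continuous w) (hC : ∀ᵐ s ∂P, ∀ t ∈ T, ‖w (inner ℝ (W s) t)‖ ≤ C)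
    (hf : IsProbDensity f) (hlaw : P.map Z = densMeasure f) {θ : Euc p → 𝕜}
    (hθ : StronglyMeasurable θ) (hint : Integrable (fun s => θ (Z s)) P) {t : Euc q} (ht : t ∈ T) :
    ∫ s, θ (Z s) * w (inner ℝ (W s) t) ∂P = ∫ z, θ z * condKernel P Z W w f z t := by
  have hwt : Continuous fun v : Euc q => w (inner ℝ v t) := hw.comp (by fun_prop)
  have hFm : StronglyMeasurable fun x : Euc p × Euc q => θ x.1 * w (inner ℝ x.2 t) :=
    (hθ.comp_measurable measurable_fst).mul (hwt.comp continuous_snd).stronglyMeasurable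
  have hFint : Integrable (fun s => θ (Z s) * w (inner ℝ (W s) t)) P :=
    hint.mul_bdd ((hwt.measurable.comp hW).aestronglyMeasurable)
      (by filter_upwards [hC] with s hs using hs t ht)
  have h1 : ∫ s, θ (Z s) * w (inner ℝ (W s) t) ∂P
      = ∫ x, θ x.1 * w (inner ℝ x.2 t) ∂(P.map Z) ⊗ₘ condDistrib W Z P := by
    rw [compProd_map_condDistrib hW.aemeasurable,
      integral_map (hZ.prodMk hW).aemeasurable hFm.aestronglyMeasurable]
  have hF2 : Integrable (fun x : Euc p × Euc q => θ x.1 * w (inner ℝ x.2 t))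
      ((P.map Z) ⊗ₘ condDistrib W Z P) := by
    rw [compProd_map_condDistrib hW.aemeasurable,
      integrable_map_measure hFm.aestronglyMeasurable (hZ.prodMk hW).aemeasurable]
    exact hFint
  rw [h1, Measure.integral_compProd hF2, hlaw, densMeasure,
    integral_withDensity_eq_integral_toReal_smul hf.1.ennreal_ofReal
      (Eventually.of_forall fun _ => ENNReal.ofReal_lt_top)]
  refine integral_congr_ae (Eventually.of_forall fun z => ?_)
  simp only [condKernel]
  rw [ENNReal.toReal_ofReal (hf.2.1 z), integral_const_mul, RCLike.real_smul_eq_coe_mul]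
  ring

end ConditionalKernel

/-! ### The population operator as an integral operator. -/

section PopulationOperator

variable {𝕜 : Type*} [RCLike 𝕜] {Ω : Type*} [MeasurableSpace Ω] {P : Measure Ω}
  [IsProbabilityMeasure P] {p q : ℕ} {Z : Ω → Euc p} {W : Ω → Euc q} {w : ℝ → 𝕜}
  {T : Set (Euc q)} {μ : Measure (Euc q)} [IsFiniteMeasure μ] {f dens : Euc p → ℝ} {C : ℝ}

theorem IsProbDensity.lintegral_enorm_sq_mul {dens : Euc p → ℝ} (hdens : Measurable dens)
    (φ : Euc p → 𝕜) :
    ∫⁻ z, ‖φ z‖ₑ ^ 2 * ENNReal.ofReal (dens z) = ∫⁻ z, ‖φ z‖ₑ ^ 2 ∂densMeasure dens := by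
  rw [lintegral_densMeasure hdens]
  exact lintegral_congr fun z => mul_comm _ _

/-- `E|φ(Z)| = ∫ f |φ|` is bounded by weighted Cauchy-Schwarz through `∫ f²/dens` and the norm of
`φ`. -/
theorem integrable_comp_of_memLp (hZ : Measurable Z) (hf : IsProbDensity f)
    (hdens : Measurable dens) (hf2 : ∫⁻ z, ENNReal.ofReal (f z) ^ 2 / ENNReal.ofReal (dens z) ≠ ∞)
    (hlaw : P.map Z = densMeasure f) {φ : Euc p → 𝕜} (hφ : StronglyMeasurable φ)
    (hφ2 : ∫⁻ z, ‖φ z‖ₑ ^ 2 ∂densMeasure dens ≠ ∞) : Integrable (fun s => φ (Z s)) P := by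
  refine ⟨(hφ.comp_measurable hZ).aestronglyMeasurable, ?_⟩
  have hφm : Measurable fun z => ‖φ z‖ₑ := hφ.enorm
  have h1 : ∫⁻ s, ‖φ (Z s)‖ₑ ∂P = ∫⁻ z, ENNReal.ofReal (f z) * ‖φ z‖ₑ := by
    rw [← lintegral_densMeasure hf.1, ← hlaw, lintegral_map hφm hZ]
  have h2 := lintegral_mul_sq_le_weight (μ := (volume : Measure (Euc p)))
    hf.1.ennreal_ofReal.aemeasurable hφm.aemeasurable hdens.ennreal_ofReal.aemeasurable
    (fun _ => ENNReal.ofReal_ne_top) hf2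
  rw [IsProbDensity.lintegral_enorm_sq_mul hdens] at h2
  rw [hasFiniteIntegral_iff_enorm, h1]
  by_contra h3
  rw [not_lt, top_le_iff] at h3
  rw [h3] at h2
  refine ENNReal.mul_ne_top hf2 hφ2 (top_le_iff.1 ?_)
  simpa using h2

theorem lintegral_enorm_sq_Lp_ne_top {X : Type*} [MeasurableSpace X] {ν : Measure X}
    (φ : Lp 𝕜 2 ν) : ∫⁻ z, ‖φ z‖ₑ ^ 2 ∂ν ≠ ∞ :=
  lintegral_enorm_sq_ne_top (Lp.memLp φ)

/-- Dividing by the density turns Lebesgue integrals into integrals for the density. -/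
theorem integral_mul_div_densMeasure (hdens : IsProbDensity dens) {κ φ : Euc p → 𝕜}
    (h0 : ∀ᵐ z, dens z = 0 → κ z = 0) :
    ∫ z, φ z * (κ z / (dens z : 𝕜)) ∂densMeasure dens = ∫ z, φ z * κ z := by
  rw [densMeasure, integral_withDensity_eq_integral_toReal_smul hdens.1.ennreal_ofReal
      (Eventually.of_forall fun _ => ENNReal.ofReal_lt_top)]
  refine integral_congr_ae ?_
  filter_upwards [h0] with z hz
  rw [ENNReal.toReal_ofReal (hdens.2.1 z), RCLike.real_smul_eq_coe_mul]
  rcases eq_or_ne (dens z) 0 with h | h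
  · simp [hz h, h]
  · have : (dens z : 𝕜) ≠ 0 := by exact_mod_cast h
    field_simp

/-- Only an inequality: where `dens = 0` the left integrand is zero, while the extended quotient on
the right may be infinite. -/
theorem lintegral_enorm_div_sq_densMeasure (hdens : IsProbDensity dens) (κ : Euc p → 𝕜) :
    ∫⁻ z, ‖κ z / (dens z : 𝕜)‖ₑ ^ 2 ∂densMeasure dens
      ≤ ∫⁻ z, ‖κ z‖ₑ ^ 2 / ENNReal.ofReal (dens z) := by
  rw [lintegral_densMeasure hdens.1]
  refine lintegral_mono fun z => ?_
  rcases eq_or_ne (dens z) 0 with h | h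
  · simp [h]
  · have hpos : 0 < dens z := lt_of_le_of_ne (hdens.2.1 z) h.symm
    have h1 : ‖κ z / (dens z : 𝕜)‖ₑ = ‖κ z‖ₑ / ENNReal.ofReal (dens z) := by
      rw [← ofReal_norm, norm_div, RCLike.norm_ofReal, abs_of_pos hpos,
        ENNReal.ofReal_div_of_pos hpos, ofReal_norm]
    have h2 : ENNReal.ofReal (dens z) ≠ 0 := by simpa using hpos
    rw [h1, div_eq_mul_inv, div_eq_mul_inv, mul_pow, mul_left_comm, sq (ENNReal.ofReal (dens z))⁻¹,
      ← mul_assoc (ENNReal.ofReal (dens z)), ENNReal.mul_inv_cancel h2 ENNReal.ofReal_ne_top,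
      one_mul]

/-- The kernel `k/dens` is square integrable for `μ × dens`, since `|k| ≤ C f`, `∫ f²/dens` is
finite and so is `μ`. Division by `dens` loses nothing because `f` vanishes almost everywhere where
`dens` does. This also shows that `opAZ` is not the default value of `opOfFormula`. -/
theorem opAZ_apply (hZ : Measurable Z) (hW : Measurable W) (hw : Continuous w)
    (hC0 : 0 ≤ C) (hC : ∀ᵐ s ∂P, ∀ t ∈ T, ‖w (inner ℝ (W s) t)‖ ≤ C) (hμ : ∀ᵐ t ∂μ, t ∈ T)
    (hf : IsProbDensity f) (hlaw : P.map Z = densMeasure f) (hdens : IsProbDensity dens)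
    (hf2 : ∫⁻ z, ENNReal.ofReal (f z) ^ 2 / ENNReal.ofReal (dens z) ≠ ∞)
    (φ : Lp 𝕜 2 (densMeasure dens)) :
    opAZ P Z W w dens μ φ =ᵐ[μ] fun t => ∫ z, φ z * condKernel P Z W w f z t := by
  have hfin : ∀ φ : Lp 𝕜 2 (densMeasure dens), ∀ t ∈ T,
      ∫ s, φ (Z s) * w (inner ℝ (W s) t) ∂P = ∫ z, φ z * condKernel P Z W w f z t :=
    fun φ t ht => integral_mul_weight_eq hZ hW hw hC hf hlaw (Lp.stronglyMeasurable φ)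
      (integrable_comp_of_memLp hZ hf hdens.1 hf2 hlaw (Lp.stronglyMeasurable φ)
        (lintegral_enorm_sq_Lp_ne_top φ)) ht
  have hb := ae_norm_condKernel_le hZ hW hw hC hf hlaw
  have hf0 := ae_eq_zero_of_div hf.1.ennreal_ofReal.aemeasurable
    hdens.1.ennreal_ofReal.aemeasurable hf2
  have hκ0 : ∀ t, ∀ᵐ z, dens z = 0 → condKernel P Z W w f z t = 0 := fun t => by
    filter_upwards [hf0] with z hz hd
    have : f z = 0 := le_antisymm (by simpa using hz (by simp [hd])) (hf.2.1 z)
    simp [condKernel, this]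
  have hκm : StronglyMeasurable fun x : Euc q × Euc p =>
      condKernel P Z W w f x.2 x.1 / (dens x.2 : 𝕜) := by
    have h1 := (stronglyMeasurable_condKernel (P := P) (Z := Z) (W := W) (p := p) hw
      hf.1).comp_measurable (measurable_swap (α := Euc q) (β := Euc p))
    exact (h1.measurable.div (RCLike.continuous_ofReal.measurable.comp
      (hdens.1.comp measurable_snd))).stronglyMeasurable
  have hκ : MemLp (fun x : Euc q × Euc p => condKernel P Z W w f x.2 x.1 / (dens x.2 : 𝕜)) 2
      (μ.prod (densMeasure dens)) := by
    refine memLp_two_of_lintegral hκm.aestronglyMeasurable ?_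
    rw [lintegral_prod _ (hκm.measurable.enorm.pow_const 2).aemeasurable]
    refine ne_top_of_le_ne_top (b := ∫⁻ _, (ENNReal.ofReal C ^ 2 *
      ∫⁻ z, ENNReal.ofReal (f z) ^ 2 / ENNReal.ofReal (dens z)) ∂μ) ?_ ?_
    · rw [lintegral_const]
      finiteness
    · refine lintegral_mono_ae ?_
      filter_upwards [hμ] with t ht
      refine (lintegral_enorm_div_sq_densMeasure hdens _).trans ?_
      rw [← lintegral_const_mul' _ _ (by finiteness)]
      refine lintegral_mono_ae ?_
      filter_upwards [hb] with z hz
      rw [← mul_div_assoc, ← mul_pow, ← ENNReal.ofReal_mul hC0, ← ofReal_norm]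
      gcongr
      exact hz t ht
  obtain ⟨A, hA⟩ := exists_integralOperator
    (fun z t => condKernel P Z W w f z t / (dens z : 𝕜)) hκ
  have hspec : ∃ A : Lp 𝕜 2 (densMeasure dens) →L[𝕜] Lp 𝕜 2 μ, ∀ φ : Lp 𝕜 2 (densMeasure dens),
      A φ =ᵐ[μ] fun t => ∫ s, φ (Z s) * w (inner ℝ (W s) t) ∂P := by
    refine ⟨A, fun φ => (hA φ).trans ?_⟩
    filter_upwards [hμ] with t ht
    rw [hfin φ t ht, integral_mul_div_densMeasure hdens (hκ0 t)]
  refine (opOfFormula_spec hspec φ).trans ?_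
  filter_upwards [hμ] with t ht using hfin φ t ht

end PopulationOperator


/-! ### The estimated operator as a finite-rank operator. -/

section SampleOperator

variable {𝕜 : Type*} [RCLike 𝕜] {p q : ℕ} {w : ℝ → 𝕜} {T : Set (Euc q)} {μ : Measure (Euc q)}
  {dens : Euc p → ℝ} {C h : ℝ} {n : ℕ} {K : Euc p → ℝ} {z : ℕ → Euc p} {v : ℕ → Euc q}

theorem coeFn_toL2 {X : Type*} [MeasurableSpace X] {ν : Measure X} {f : X → 𝕜}
    (hf : MemLp f 2 ν) : toL2 ν f =ᵐ[ν] f := by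
  rw [toL2, dif_pos hf]
  exact hf.coeFn_toLp

theorem memLp_weight [IsFiniteMeasure μ] (hw : Continuous w) (hμ : ∀ᵐ t ∂μ, t ∈ T) {x : Euc q}
    (hx : ∀ t ∈ T, ‖w (inner ℝ x t)‖ ≤ C) : MemLp (fun t => w (inner ℝ x t)) 2 μ :=
  MemLp.of_bound (hw.comp (by fun_prop)).aestronglyMeasurable C
    (by filter_upwards [hμ] with t ht using hx t ht)

theorem integrable_mul_of_weight (hdens : Measurable dens) {φ κ : Euc p → 𝕜}
    (hφ : AEStronglyMeasurable φ) (hκ : AEStronglyMeasurable κ)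
    (hκ2 : ∫⁻ y, ‖κ y‖ₑ ^ 2 / ENNReal.ofReal (dens y) ≠ ∞)
    (hφ2 : ∫⁻ y, ‖φ y‖ₑ ^ 2 ∂densMeasure dens ≠ ∞) : Integrable fun y => φ y * κ y := by
  refine ⟨hφ.mul hκ, ?_⟩
  have h2 := lintegral_mul_sq_le_weight (μ := (volume : Measure (Euc p)))
    hκ.enorm hφ.enorm hdens.ennreal_ofReal.aemeasurable
    (fun _ => ENNReal.ofReal_ne_top) hκ2
  rw [IsProbDensity.lintegral_enorm_sq_mul hdens] at h2
  rw [hasFiniteIntegral_iff_enorm]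
  by_contra h3
  rw [not_lt, top_le_iff] at h3
  have h4 : ∫⁻ y, ‖κ y‖ₑ * ‖φ y‖ₑ = ∞ := by
    rw [← h3]
    exact lintegral_congr fun y => by rw [enorm_mul, mul_comm]
  rw [h4] at h2
  refine ENNReal.mul_ne_top hκ2 hφ2 (top_le_iff.1 ?_)
  simpa using h2

/-- An element of `L²_dens` is determined only up to `dens`-null sets, whereas the integrals are for
Lebesgue measure. They agree because `κ` vanishes where `dens` does. -/
theorem integral_mul_congr_densMeasure {κ φ ψ : Euc p → 𝕜} (hdens : IsProbDensity dens)
    (h0 : ∀ᵐ y, dens y = 0 → κ y = 0) (h : φ =ᵐ[densMeasure dens] ψ) :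
    ∫ y, φ y * κ y = ∫ y, ψ y * κ y := by
  rw [← integral_mul_div_densMeasure hdens h0, ← integral_mul_div_densMeasure hdens h0]
  refine integral_congr_ae ?_
  filter_upwards [h] with y hy
  rw [hy]

theorem lintegral_enorm_add_sq_div_ne_top {κ κ' : Euc p → 𝕜} (hκm : AEStronglyMeasurable κ)
    (hdens : Measurable dens)
    (hκ : ∫⁻ y, ‖κ y‖ₑ ^ 2 / ENNReal.ofReal (dens y) ≠ ∞)
    (hκ' : ∫⁻ y, ‖κ' y‖ₑ ^ 2 / ENNReal.ofReal (dens y) ≠ ∞) :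
    ∫⁻ y, ‖κ y + κ' y‖ₑ ^ 2 / ENNReal.ofReal (dens y) ≠ ∞ := by
  refine ne_top_of_le_ne_top (b := 2 * (∫⁻ y, ‖κ y‖ₑ ^ 2 / ENNReal.ofReal (dens y))
    + 2 * ∫⁻ y, ‖κ' y‖ₑ ^ 2 / ENNReal.ofReal (dens y)) (by finiteness) ?_
  have hd := hdens.ennreal_ofReal
  rw [← lintegral_const_mul' _ _ (by finiteness), ← lintegral_const_mul' _ _ (by finiteness),
    ← lintegral_add_left' (by have := hκm.enorm; fun_prop)]
  refine lintegral_mono fun y => ?_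
  rw [← mul_div_assoc, ← mul_div_assoc, ← ENNReal.add_div]
  gcongr
  exact enorm_add_sq_le _ _

theorem lintegral_enorm_sum_sq_div_ne_top {ι : Type*} (S : Finset ι) {κ : ι → Euc p → 𝕜}
    (hκm : ∀ i ∈ S, AEStronglyMeasurable (κ i)) (hdens : Measurable dens) (c : ι → 𝕜)
    (hκ : ∀ i ∈ S, ∫⁻ y, ‖κ i y‖ₑ ^ 2 / ENNReal.ofReal (dens y) ≠ ∞) :
    ∫⁻ y, ‖∑ i ∈ S, c i * κ i y‖ₑ ^ 2 / ENNReal.ofReal (dens y) ≠ ∞ := by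
  classical
  induction S using Finset.induction_on with
  | empty => simp
  | insert i S hi ih =>
    simp_rw [Finset.sum_insert hi]
    refine lintegral_enorm_add_sq_div_ne_top
      ((hκm i (Finset.mem_insert_self _ _)).const_mul _) hdens ?_
      (ih (fun j hj => hκm j (Finset.mem_insert_of_mem hj))
        fun j hj => hκ j (Finset.mem_insert_of_mem hj))
    simp_rw [enorm_mul, mul_pow, mul_div_assoc]
    rw [lintegral_const_mul' _ _ (by finiteness)]
    have := hκ i (Finset.mem_insert_self _ _)
    finiteness

/-- The rescaled kernel `y ↦ h⁻ᵖ K((y - x)/h)` centred at `x`. -/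
noncomputable def bump (𝕜 : Type*) [RCLike 𝕜] (K : Euc p → ℝ) (h : ℝ) (x y : Euc p) : 𝕜 :=
  (((h ^ p)⁻¹ * K (h⁻¹ • (y - x)) : ℝ) : 𝕜)

theorem kHat_eq (y : Euc p) (t : Euc q) :
    kHat w K h n z v y t = ∑ i ∈ Finset.range n, ((n : 𝕜)⁻¹ * w (inner ℝ (v i) t)) *
      bump 𝕜 K h (z i) y := by
  unfold kHat bump
  rw [Finset.mul_sum]
  refine Finset.sum_congr rfl fun i _ => ?_
  push_cast
  rw [mul_inv]
  ring

theorem measurable_bump (hK : Measurable K) :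
    Measurable fun x : Euc p × Euc p => bump 𝕜 K h x.1 x.2 := by
  unfold bump
  exact RCLike.continuous_ofReal.measurable.comp (by fun_prop)

theorem measurable_bump_right (hK : Measurable K) (x : Euc p) : Measurable (bump 𝕜 K h x) := by
  unfold bump
  exact RCLike.continuous_ofReal.measurable.comp (by fun_prop)

theorem enorm_bump_sq (x y : Euc p) : ‖bump 𝕜 K h x y‖ₑ ^ 2
    = ENNReal.ofReal (((h ^ p)⁻¹ * K (h⁻¹ • (y - x))) ^ 2) := by
  unfold bump
  rw [← ofReal_norm, RCLike.norm_ofReal, ← ENNReal.ofReal_pow (abs_nonneg _), sq_abs]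

theorem lintegral_bump_sq_ne_top {x : Euc p}
    (hKd : ∫⁻ y, ENNReal.ofReal (K (h⁻¹ • (y - x)) ^ 2) / ENNReal.ofReal (dens y) ≠ ∞) :
    ∫⁻ y, ‖bump 𝕜 K h x y‖ₑ ^ 2 / ENNReal.ofReal (dens y) ≠ ∞ := by
  simp_rw [enorm_bump_sq, mul_pow, ENNReal.ofReal_mul (sq_nonneg (h ^ p)⁻¹), mul_div_assoc]
  rw [lintegral_const_mul' _ _ (by finiteness)]
  finiteness

theorem ae_bump_eq_zero (hK : Measurable K) (hdens : IsProbDensity dens) {x : Euc p}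
    (hKd : ∫⁻ y, ENNReal.ofReal (K (h⁻¹ • (y - x)) ^ 2) / ENNReal.ofReal (dens y) ≠ ∞) :
    ∀ᵐ y, dens y = 0 → bump 𝕜 K h x y = 0 := by
  have := ae_eq_zero_of_div (measurable_bump_right (𝕜 := 𝕜) (h := h) hK x).enorm.aemeasurable
    hdens.1.ennreal_ofReal.aemeasurable (lintegral_bump_sq_ne_top (𝕜 := 𝕜) hKd)
  filter_upwards [this] with y hy h0
  simpa using hy (by simp [h0])

theorem measurable_kHat (hw : Continuous w) (hK : Measurable K) :
    Measurable fun x : Euc q × Euc p => kHat w K h n z v x.2 x.1 := by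
  simp_rw [kHat_eq]
  refine Finset.measurable_fun_sum _ fun i _ => ?_
  exact ((hw.comp (by fun_prop)).measurable.const_mul _).mul
    ((measurable_bump_right hK (z i)).comp measurable_snd)

theorem lintegral_kHat_sq_ne_top (hK : Measurable K) (hdens : Measurable dens)
    (hKd : ∀ i < n, ∫⁻ y, ENNReal.ofReal (K (h⁻¹ • (y - z i)) ^ 2) / ENNReal.ofReal (dens y) ≠ ∞)
    (t : Euc q) :
    ∫⁻ y, ‖kHat w K h n z v y t‖ₑ ^ 2 / ENNReal.ofReal (dens y) ≠ ∞ := by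
  simp_rw [kHat_eq]
  exact lintegral_enorm_sum_sq_div_ne_top _
    (fun i _ => (measurable_bump_right hK (z i)).aestronglyMeasurable) hdens _
    fun i hi => lintegral_bump_sq_ne_top (hKd i (Finset.mem_range.1 hi))

/-- The estimated operator has finite rank. -/
theorem integral_mul_kHat_eq (hK : Measurable K) (hdens : IsProbDensity dens)
    (hKd : ∀ i < n, ∫⁻ y, ENNReal.ofReal (K (h⁻¹ • (y - z i)) ^ 2) / ENNReal.ofReal (dens y) ≠ ∞)
    (φ : Lp 𝕜 2 (densMeasure dens)) (t : Euc q) :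
    ∫ y, φ y * kHat w K h n z v y t = ∑ i ∈ Finset.range n,
      ((n : 𝕜)⁻¹ * ∫ y, φ y * bump 𝕜 K h (z i) y) * w (inner ℝ (v i) t) := by
  simp_rw [kHat_eq, Finset.mul_sum]
  have hint : ∀ i ∈ Finset.range n, Integrable fun y => φ y * bump 𝕜 K h (z i) y := fun i hi =>
    integrable_mul_of_weight hdens.1 (Lp.stronglyMeasurable φ).aestronglyMeasurable
      (measurable_bump_right hK (z i)).aestronglyMeasurable
      (lintegral_bump_sq_ne_top (hKd i (Finset.mem_range.1 hi))) (lintegral_enorm_sq_Lp_ne_top φ)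
  have hrw : ∀ i y, φ y * ((n : 𝕜)⁻¹ * w (inner ℝ (v i) t) * bump 𝕜 K h (z i) y)
      = ((n : 𝕜)⁻¹ * w (inner ℝ (v i) t)) * (φ y * bump 𝕜 K h (z i) y) := fun i y => by ring
  simp_rw [hrw]
  rw [integral_finsetSum _ fun i hi => (hint i hi).const_mul _]
  refine Finset.sum_congr rfl fun i _ => ?_
  rw [integral_const_mul]
  ring

/-- Existence is witnessed explicitly by a sum of rank-one operators. The functional `φ ↦ ∫ φ(y) h⁻ᵖ
K((y - z_i)/h) dy` is the inner product with the conjugate of that rescaled kernel divided by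
`dens`, which lies in `L²_dens` by `hKd`. -/
theorem opAZHat_apply_ae [IsFiniteMeasure μ] (hw : Continuous w) (hμ : ∀ᵐ t ∂μ, t ∈ T)
    (hv : ∀ i < n, ∀ t ∈ T, ‖w (inner ℝ (v i) t)‖ ≤ C) (hK : Measurable K)
    (hdens : IsProbDensity dens)
    (hKd : ∀ i < n, ∫⁻ y, ENNReal.ofReal (K (h⁻¹ • (y - z i)) ^ 2) / ENNReal.ofReal (dens y) ≠ ∞)
    (φ : Lp 𝕜 2 (densMeasure dens)) :
    opAZHat w K dens μ h n z v φ =ᵐ[μ] fun t => ∫ y, φ y * kHat w K h n z v y t := by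
  refine opOfFormula_spec ?_ φ
  let κ : ℕ → Euc p → 𝕜 := fun i y => starRingEnd 𝕜 (bump 𝕜 K h (z i) y / (dens y : 𝕜))
  have hκm : ∀ i, Measurable (κ i) := fun i => by
    have h1 := measurable_bump_right (𝕜 := 𝕜) (h := h) hK (z i)
    have h2 : Measurable fun y => (dens y : 𝕜) :=
      RCLike.continuous_ofReal.measurable.comp hdens.1
    exact RCLike.continuous_conj.measurable.comp (h1.div h2)
  have hκ : ∀ i < n, MemLp (κ i) 2 (densMeasure dens) := fun i hi => by
    refine memLp_two_of_lintegral (hκm i).aestronglyMeasurable ?_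
    simp only [κ, RCLike.enorm_conj]
    exact ne_top_of_le_ne_top (lintegral_bump_sq_ne_top (hKd i hi))
      (lintegral_enorm_div_sq_densMeasure hdens _)
  refine ⟨∑ i ∈ Finset.range n, ((n : 𝕜)⁻¹ • (innerSL 𝕜 (toL2 (densMeasure dens) (κ i)))).smulRight
    (toL2 μ fun t => w (inner ℝ (v i) t)), fun φ => ?_⟩
  have hinner : ∀ i < n, inner 𝕜 (toL2 (densMeasure dens) (κ i)) φ
      = ∫ y, φ y * bump 𝕜 K h (z i) y := fun i hi => by
    rw [← integral_mul_div_densMeasure hdens (ae_bump_eq_zero hK hdens (hKd i hi)), L2.inner_def]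
    refine integral_congr_ae ?_
    filter_upwards [coeFn_toL2 (hκ i hi)] with y hy
    rw [hy, RCLike.inner_apply]
    simp [κ]
  have hsum : (∑ i ∈ Finset.range n,
      ((n : 𝕜)⁻¹ • (innerSL 𝕜 (toL2 (densMeasure dens) (κ i)))).smulRight
        (toL2 μ fun t => w (inner ℝ (v i) t))) φ
      = ∑ i ∈ Finset.range n, ((n : 𝕜)⁻¹ * ∫ y, φ y * bump 𝕜 K h (z i) y) •
        toL2 μ fun t => w (inner ℝ (v i) t) := by
    rw [sum_apply]
    refine Finset.sum_congr rfl fun i hi => ?_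
    simp [hinner i (Finset.mem_range.1 hi)]
  rw [hsum]
  have h1 : ∀ᵐ t ∂μ, ∀ i ∈ Finset.range n,
      (((n : 𝕜)⁻¹ * ∫ y, φ y * bump 𝕜 K h (z i) y) • toL2 μ fun t => w (inner ℝ (v i) t) :
        Lp 𝕜 2 μ) t = ((n : 𝕜)⁻¹ * ∫ y, φ y * bump 𝕜 K h (z i) y) * w (inner ℝ (v i) t) := by
    rw [Filter.eventually_all_finset]
    intro i hi
    filter_upwards [Lp.coeFn_smul ((n : 𝕜)⁻¹ * ∫ y, φ y * bump 𝕜 K h (z i) y)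
      (toL2 μ fun t => w (inner ℝ (v i) t)),
      coeFn_toL2 (memLp_weight hw hμ (hv i (Finset.mem_range.1 hi)))] with t h2 h3
    rw [h2, Pi.smul_apply, h3, smul_eq_mul]
  filter_upwards [h1, Lp.coeFn_finsetSum (Finset.range n) fun i =>
    (((n : 𝕜)⁻¹ * ∫ y, φ y * bump 𝕜 K h (z i) y) • toL2 μ fun t => w (inner ℝ (v i) t) :
        Lp 𝕜 2 μ)] with t h2 h3
  rw [h3, integral_mul_kHat_eq hK hdens hKd, Finset.sum_apply]
  exact Finset.sum_congr rfl h2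

end SampleOperator


/-! ### The estimated operator as an identity in `L²(μ)`. -/

section SampleOperatorVector

variable {𝕜 : Type*} [RCLike 𝕜] {p q : ℕ} {w : ℝ → 𝕜} {T : Set (Euc q)} {μ : Measure (Euc q)}
  {dens : Euc p → ℝ} {C h : ℝ} {n : ℕ} {K : Euc p → ℝ} {z : ℕ → Euc p} {v : ℕ → Euc q}

theorem sum_smul_weight_coeFn [IsFiniteMeasure μ] (hw : Continuous w) (hμ : ∀ᵐ t ∂μ, t ∈ T)
    (hv : ∀ i < n, ∀ t ∈ T, ‖w (inner ℝ (v i) t)‖ ≤ C) (c : ℕ → 𝕜) :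
    (∑ i ∈ Finset.range n, c i • toL2 μ fun t => w (inner ℝ (v i) t) : Lp 𝕜 2 μ)
      =ᵐ[μ] fun t => ∑ i ∈ Finset.range n, c i * w (inner ℝ (v i) t) := by
  have h1 : ∀ᵐ t ∂μ, ∀ i ∈ Finset.range n,
      (c i • toL2 μ fun t => w (inner ℝ (v i) t) : Lp 𝕜 2 μ) t = c i * w (inner ℝ (v i) t) := by
    rw [Filter.eventually_all_finset]
    intro i hi
    filter_upwards [Lp.coeFn_smul (c i) (toL2 μ fun t => w (inner ℝ (v i) t)),
      coeFn_toL2 (memLp_weight hw hμ (hv i (Finset.mem_range.1 hi)))] with t h2 h3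
    rw [h2, Pi.smul_apply, h3, smul_eq_mul]
  filter_upwards [h1, Lp.coeFn_finsetSum (Finset.range n) fun i =>
    (c i • toL2 μ fun t => w (inner ℝ (v i) t) : Lp 𝕜 2 μ)] with t h2 h3
  rw [h3, Finset.sum_apply]
  exact Finset.sum_congr rfl h2

theorem toL2_sum_weight [IsFiniteMeasure μ] (hw : Continuous w) (hμ : ∀ᵐ t ∂μ, t ∈ T)
    (hv : ∀ i < n, ∀ t ∈ T, ‖w (inner ℝ (v i) t)‖ ≤ C) (c : ℕ → 𝕜) :
    toL2 μ (fun t => ∑ i ∈ Finset.range n, c i * w (inner ℝ (v i) t))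
      = ∑ i ∈ Finset.range n, c i • toL2 μ fun t => w (inner ℝ (v i) t) := by
  have hm : MemLp (fun t => ∑ i ∈ Finset.range n, c i * w (inner ℝ (v i) t)) 2 μ :=
    memLp_finsetSum _ fun i hi =>
      (memLp_weight hw hμ (hv i (Finset.mem_range.1 hi))).const_mul (c i)
  exact Lp.ext ((coeFn_toL2 hm).trans (sum_smul_weight_coeFn hw hμ hv c).symm)

theorem opAZHat_eq_sum [IsFiniteMeasure μ] (hw : Continuous w) (hμ : ∀ᵐ t ∂μ, t ∈ T)
    (hv : ∀ i < n, ∀ t ∈ T, ‖w (inner ℝ (v i) t)‖ ≤ C) (hK : Measurable K)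
    (hdens : IsProbDensity dens)
    (hKd : ∀ i < n, ∫⁻ y, ENNReal.ofReal (K (h⁻¹ • (y - z i)) ^ 2) / ENNReal.ofReal (dens y) ≠ ∞)
    (φ : Lp 𝕜 2 (densMeasure dens)) :
    opAZHat w K dens μ h n z v φ = ∑ i ∈ Finset.range n,
      ((n : 𝕜)⁻¹ * ∫ y, φ y * bump 𝕜 K h (z i) y) • toL2 μ fun t => w (inner ℝ (v i) t) := by
  refine Lp.ext ((opAZHat_apply_ae hw hμ hv hK hdens hKd φ).trans ?_)
  refine EventuallyEq.trans (Eventually.of_forall fun t => ?_) (sum_smul_weight_coeFn hw hμ hv _).symm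
  exact integral_mul_kHat_eq hK hdens hKd φ t

theorem ae_comp_scale_sub {Q : Euc p → Prop} (hh : 0 < h) (hQ : ∀ᵐ u, Q u) (x : Euc p) :
    ∀ᵐ y, Q (h⁻¹ • (y - x)) := by
  obtain ⟨N, hN, hNm, hN0⟩ := exists_measurable_superset_of_null (ae_iff.1 hQ)
  have h1 := lintegral_comp_scale_sub hh x (N.indicator 1)
  have h2 : Measurable fun y : Euc p => N.indicator (1 : Euc p → ℝ≥0∞) (h⁻¹ • (y - x)) :=
    (measurable_one.indicator hNm).comp (by fun_prop)
  rw [lintegral_indicator_one hNm, hN0, mul_zero, lintegral_eq_zero_iff h2] at h1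
  filter_upwards [h1] with y hy
  by_contra hc
  simp [Set.indicator_of_mem (hN hc)] at hy

theorem opAZHat_congr_kernel {K' : Euc p → ℝ} (hh : 0 < h) (hKK' : K =ᵐ[volume] K') :
    opAZHat w K dens μ h n z v = opAZHat w K' dens μ h n z v := by
  have h0 : ∀ x : Euc p, ∀ᵐ y : Euc p, K (h⁻¹ • (y - x)) = K' (h⁻¹ • (y - x)) := fun x =>
    ae_comp_scale_sub hh hKK' x
  unfold opAZHat
  congr 1
  funext φ t
  refine integral_congr_ae ?_
  filter_upwards [ae_all_iff.2 fun i => h0 (z i)] with y hy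
  simp only [kHat, hy]

end SampleOperatorVector

/-! ### Operator norm bounded by the Hilbert-Schmidt distance. -/

section OperatorDistance

variable {𝕜 : Type*} [RCLike 𝕜] {Ω : Type*} [MeasurableSpace Ω] {P : Measure Ω}
  [IsProbabilityMeasure P] {p q : ℕ} {Z : Ω → Euc p} {W : Ω → Euc q} {w : ℝ → 𝕜}
  {T : Set (Euc q)} {μ : Measure (Euc q)} [IsFiniteMeasure μ] {f dens : Euc p → ℝ} {C h : ℝ}
  {n : ℕ} {K : Euc p → ℝ} {z : ℕ → Euc p} {v : ℕ → Euc q}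

/-- The squared Hilbert-Schmidt distance of two kernels. -/
noncomputable def kernelDist (dens : Euc p → ℝ) (μ : Measure (Euc q)) (κ κ' : Euc p → Euc q → 𝕜) :
    ℝ≥0∞ :=
  ∫⁻ t, (∫⁻ y, ‖κ y t - κ' y t‖ₑ ^ 2 / ENNReal.ofReal (dens y)) ∂μ

/-- For fixed `t`, weighted Cauchy-Schwarz bounds `|(A - B)φ(t)|²` by `‖φ‖²` times the weighted
square of the kernel difference; integration over `μ` gives the claim. -/
theorem enorm_sub_sq_le_kernelDist {A B : Lp 𝕜 2 (densMeasure dens) →L[𝕜] Lp 𝕜 2 μ}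
    {κ κ' : Euc p → Euc q → 𝕜} (hdens : IsProbDensity dens)
    (hκm : ∀ t, AEStronglyMeasurable fun y => κ y t)
    (hκm' : ∀ t, AEStronglyMeasurable fun y => κ' y t)
    (hκ : ∀ᵐ t ∂μ, ∫⁻ y, ‖κ y t‖ₑ ^ 2 / ENNReal.ofReal (dens y) ≠ ∞)
    (hκ' : ∀ᵐ t ∂μ, ∫⁻ y, ‖κ' y t‖ₑ ^ 2 / ENNReal.ofReal (dens y) ≠ ∞)
    (hA : ∀ φ, A φ =ᵐ[μ] fun t => ∫ y, φ y * κ y t)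
    (hB : ∀ φ, B φ =ᵐ[μ] fun t => ∫ y, φ y * κ' y t) :
    ‖A - B‖ₑ ^ 2 ≤ kernelDist dens μ κ κ' := by
  rcases eq_or_ne (kernelDist dens μ κ κ') ∞ with hQ | hQ
  · rw [hQ]; exact le_top
  set Q := kernelDist dens μ κ κ' with hQdef
  have key : ∀ φ : Lp 𝕜 2 (densMeasure dens), ‖(A - B) φ‖ₑ ^ 2 ≤ Q * ‖φ‖ₑ ^ 2 := fun φ => by
    have hφ : ‖φ‖ₑ ^ 2 = ∫⁻ y, ‖φ y‖ₑ ^ 2 ∂densMeasure dens := by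
      rw [Lp.enorm_def, ← ENNReal.rpow_natCast, Nat.cast_ofNat, eLpNorm_two_sq]
      simp
    have hAB : ‖(A - B) φ‖ₑ ^ 2 = ∫⁻ t, ‖((A - B) φ : Lp 𝕜 2 μ) t‖ₑ ^ 2 ∂μ := by
      rw [Lp.enorm_def, ← ENNReal.rpow_natCast, Nat.cast_ofNat, eLpNorm_two_sq]
      simp
    rw [hAB, hQdef, kernelDist, ← lintegral_mul_const' _ _ (by finiteness)]
    refine lintegral_mono_ae ?_
    filter_upwards [hA φ, hB φ, Lp.coeFn_sub (A φ) (B φ), hκ, hκ'] with t h1 h2 h3 h4 h5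
    have hs : ∀ κ : Euc p → 𝕜, AEStronglyMeasurable κ →
        ∫⁻ y, ‖κ y‖ₑ ^ 2 / ENNReal.ofReal (dens y) ≠ ∞ → Integrable fun y => φ y * κ y :=
      fun κ hκm hκ => integrable_mul_of_weight hdens.1
        (Lp.stronglyMeasurable φ).aestronglyMeasurable hκm hκ (lintegral_enorm_sq_Lp_ne_top φ)
    have h7 : ∫⁻ y, ‖κ y t - κ' y t‖ₑ ^ 2 / ENNReal.ofReal (dens y) ≠ ∞ := by
      simp_rw [sub_eq_add_neg]
      exact lintegral_enorm_add_sq_div_ne_top (hκm t) hdens.1 h4 (by simpa using h5)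
    have h6 : ((A - B) φ : Lp 𝕜 2 μ) t = ∫ y, φ y * (κ y t - κ' y t) := by
      rw [sub_apply, h3, Pi.sub_apply, h1, h2,
        ← integral_sub (hs _ (hκm t) h4) (hs _ (hκm' t) h5)]
      simp_rw [mul_sub]
    have h8 := lintegral_mul_sq_le_weight (μ := (volume : Measure (Euc p)))
      ((hκm t).sub (hκm' t)).enorm (Lp.stronglyMeasurable φ).aestronglyMeasurable.enorm
      hdens.1.ennreal_ofReal.aemeasurable (fun _ => ENNReal.ofReal_ne_top) h7
    rw [IsProbDensity.lintegral_enorm_sq_mul hdens.1, ← hφ] at h8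
    refine le_trans ?_ h8
    rw [h6]
    gcongr
    refine (enorm_integral_le_lintegral_enorm _).trans (le_of_eq ?_)
    exact lintegral_congr fun y => by simp [enorm_mul, mul_comm]
  have hbound : ‖A - B‖ ≤ √Q.toReal := by
    refine ContinuousLinearMap.opNorm_le_bound _ (Real.sqrt_nonneg _) fun φ => ?_
    have h1 := key φ
    rw [← ENNReal.toReal_le_toReal (by finiteness) (by finiteness)] at h1
    simp only [ENNReal.toReal_pow, ENNReal.toReal_mul, toReal_enorm] at h1
    refine abs_le_of_sq_le_sq' ?_ (by positivity) |>.2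
    rwa [mul_pow, Real.sq_sqrt ENNReal.toReal_nonneg]
  rw [← ofReal_norm, ← ENNReal.ofReal_pow (norm_nonneg _)]
  refine ENNReal.ofReal_le_of_le_toReal ?_
  calc ‖A - B‖ ^ 2 ≤ (√Q.toReal) ^ 2 := by gcongr
    _ = Q.toReal := Real.sq_sqrt ENNReal.toReal_nonneg

theorem enorm_opAZHat_sub_sq_le (hZ : Measurable Z) (hW : Measurable W) (hw : Continuous w)
    (hC0 : 0 ≤ C) (hC : ∀ᵐ s ∂P, ∀ t ∈ T, ‖w (inner ℝ (W s) t)‖ ≤ C) (hμ : ∀ᵐ t ∂μ, t ∈ T)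
    (hf : IsProbDensity f) (hlaw : P.map Z = densMeasure f) (hdens : IsProbDensity dens)
    (hf2 : ∫⁻ z, ENNReal.ofReal (f z) ^ 2 / ENNReal.ofReal (dens z) ≠ ∞)
    (hv : ∀ i < n, ∀ t ∈ T, ‖w (inner ℝ (v i) t)‖ ≤ C) (hK : Measurable K)
    (hKd : ∀ i < n, ∫⁻ y, ENNReal.ofReal (K (h⁻¹ • (y - z i)) ^ 2) / ENNReal.ofReal (dens y) ≠ ∞) :
    ‖opAZHat w K dens μ h n z v - opAZ P Z W w dens μ‖ₑ ^ 2
      ≤ kernelDist dens μ (kHat w K h n z v) (condKernel P Z W w f) := by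
  refine enorm_sub_sq_le_kernelDist hdens
    (fun t => ((measurable_kHat hw hK).comp
      (f := fun y : Euc p => ((t, y) : Euc q × Euc p)) (by fun_prop)).aestronglyMeasurable)
    (fun t => ((stronglyMeasurable_condKernel (P := P) (Z := Z) (W := W) hw hf.1).comp_measurable
      (g := fun y : Euc p => ((y, t) : Euc p × Euc q)) (by fun_prop)).aestronglyMeasurable)
    (Eventually.of_forall fun t => lintegral_kHat_sq_ne_top hK hdens.1 hKd t) ?_
    (opAZHat_apply_ae hw hμ hv hK hdens hKd) (opAZ_apply hZ hW hw hC0 hC hμ hf hlaw hdens hf2)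
  filter_upwards [hμ] with t ht
  refine ne_top_of_le_ne_top (b := ENNReal.ofReal C ^ 2 *
    ∫⁻ z, ENNReal.ofReal (f z) ^ 2 / ENNReal.ofReal (dens z)) (by finiteness) ?_
  rw [← lintegral_const_mul' _ _ (by finiteness)]
  refine lintegral_mono_ae ?_
  filter_upwards [ae_norm_condKernel_le hZ hW hw hC hf hlaw] with z hz
  rw [← mul_div_assoc, ← mul_pow, ← ENNReal.ofReal_mul hC0, ← ofReal_norm]
  gcongr
  exact hz t ht

end OperatorDistance


/-! ### Integrated mean squared error of the kernel estimate. -/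

section MeanSquareError

variable {𝕜 : Type*} [RCLike 𝕜] {Ω : Type*} [MeasurableSpace Ω] {P : Measure Ω}
  [IsProbabilityMeasure P] {p q : ℕ} {Z : ℕ → Ω → Euc p} {W : ℕ → Ω → Euc q} {w : ℝ → 𝕜}
  {T : Set (Euc q)} {μ : Measure (Euc q)} [IsFiniteMeasure μ] {f dens : Euc p → ℝ} {C h : ℝ}
  {n : ℕ} {K : Euc p → ℝ}

theorem enorm_bump (hh : 0 < h) (x y : Euc p) : ‖bump 𝕜 K h x y‖ₑ = scaledKernel K h x y := by
  unfold bump scaledKernel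
  rw [← ofReal_norm, RCLike.norm_ofReal, abs_mul, abs_of_pos (by positivity),
    ENNReal.ofReal_mul (by positivity), ← Real.norm_eq_abs, ofReal_norm]

theorem measurable_bump_left (hK : Measurable K) (z : Euc p) :
    Measurable fun y => bump 𝕜 K h y z := by
  unfold bump
  exact RCLike.continuous_ofReal.measurable.comp (by fun_prop)

theorem ae_lintegral_scaledKernel_ne_top (hK : Measurable K) (hKi : Integrable K) (hh : 0 < h)
    (hf : IsProbDensity f) : ∀ᵐ z, ∫⁻ y, scaledKernel K h y z ∂densMeasure f ≠ ∞ := by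
  have hm := measurable_scaledKernel hK h
  have hprob := hf.isProbabilityMeasure
  have h1 : ∫⁻ z, (∫⁻ y, scaledKernel K h y z ∂densMeasure f) ≠ ∞ := by
    rw [lintegral_lintegral_swap (f := fun z y => scaledKernel K h y z) (by fun_prop)]
    have h2 : ∀ y, ∫⁻ z, scaledKernel K h y z = ∫⁻ u, ‖K u‖ₑ := fun y => by
      have := lintegral_kernel_eq hh y (fun u => ‖K u‖ₑ) (fun _ => 1)
      simp only [mul_one] at this
      rw [this]
      rfl
    simp_rw [h2]
    simpa using hKi.2.ne
  have h3 : Measurable fun z => ∫⁻ y, scaledKernel K h y z ∂densMeasure f :=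
    Measurable.lintegral_prod_right' (f := fun x : Euc p × Euc p => scaledKernel K h x.2 x.1)
      (by fun_prop)
  filter_upwards [ae_lt_top h3 h1] with z hz using hz.ne

theorem integrable_bump_comp (hZ : ∀ i, Measurable (Z i)) (hK : Measurable K) (hh : 0 < h)
    (hlaw : P.map (Z 0) = densMeasure f) {z : Euc p}
    (hz : ∫⁻ y, scaledKernel K h y z ∂densMeasure f ≠ ∞) :
    Integrable (fun s => bump 𝕜 K h (Z 0 s) z) P := by
  refine ⟨((measurable_bump_left hK z).comp (hZ 0)).aestronglyMeasurable, ?_⟩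
  rw [hasFiniteIntegral_iff_enorm]
  simp_rw [enorm_bump hh]
  rw [← lintegral_map (μ := P) (f := fun y => scaledKernel K h y z)
    (measurable_scaledKernel_left hK h z) (hZ 0), hlaw]
  exact hz.lt_top

/-- At fixed `(z, t)` the estimate is a sample mean of i.i.d. terms. The weight is bounded by `C`,
and the mean is the kernel `k` smoothed at `z` by disintegration over `Z`. -/
theorem lintegral_kHat_sub_sq_le (hZ : ∀ i, Measurable (Z i)) (hW : ∀ i, Measurable (W i))
    (hpair : ∀ i j, i ≠ j → IndepFun (fun s => (Z i s, W i s)) (fun s => (Z j s, W j s)) P)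
    (hident : ∀ i, IdentDistrib (fun s => (Z i s, W i s)) (fun s => (Z 0 s, W 0 s)) P P)
    (hw : Continuous w) (hC : ∀ᵐ s ∂P, ∀ t ∈ T, ‖w (inner ℝ (W 0 s) t)‖ ≤ C)
    (hf : IsProbDensity f) (hlaw : P.map (Z 0) = densMeasure f) (hK : Measurable K) (hh : 0 < h)
    (hn : n ≠ 0) {t : Euc q} (ht : t ∈ T) {z : Euc p}
    (hz : ∫⁻ y, scaledKernel K h y z ∂densMeasure f ≠ ∞) (c : 𝕜) :
    ∫⁻ s, ‖kHat w K h n (fun i => Z i s) (fun i => W i s) z t - c‖ₑ ^ 2 ∂P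
      ≤ 8 * (n : ℝ≥0∞)⁻¹ *
          (ENNReal.ofReal C ^ 2 * ∫⁻ y, scaledKernel K h y z ^ 2 ∂densMeasure f)
        + 2 * ‖(∫ y, bump 𝕜 K h y z * condKernel P (Z 0) (W 0) w f y t) - c‖ₑ ^ 2 := by
  let Ξ : Euc p × Euc q → 𝕜 := fun x => bump 𝕜 K h x.1 z * w (inner ℝ x.2 t)
  have hΞ : Measurable Ξ := ((measurable_bump_left hK z).comp measurable_fst).mul
    (hw.comp (by fun_prop)).measurable
  let ξ : ℕ → Ω → 𝕜 := fun i s => Ξ (Z i s, W i s)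
  have h1 := lintegral_enorm_mean_sub_sq_le (P := P) (ξ := ξ)
    (fun i => hΞ.comp ((hZ i).prodMk (hW i)))
    (fun i j hij => (hpair i j hij).comp hΞ hΞ) (fun i => (hident i).comp hΞ) hn c
  have h2 : ∀ s, kHat w K h n (fun i => Z i s) (fun i => W i s) z t
      = (n : 𝕜)⁻¹ * ∑ i ∈ Finset.range n, ξ i s := fun s => by
    rw [kHat_eq, Finset.mul_sum]
    exact Finset.sum_congr rfl fun i _ => by simp only [ξ, Ξ]; ring
  have h3 : ∫ s, ξ 0 s ∂P = ∫ y, bump 𝕜 K h y z * condKernel P (Z 0) (W 0) w f y t :=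
    integral_mul_weight_eq (hZ 0) (hW 0) hw hC hf hlaw
      (measurable_bump_left hK z).stronglyMeasurable
      (integrable_bump_comp hZ hK hh hlaw hz) ht
  have h4 : ∫⁻ s, ‖ξ 0 s‖ₑ ^ 2 ∂P
      ≤ ENNReal.ofReal C ^ 2 * ∫⁻ y, scaledKernel K h y z ^ 2 ∂densMeasure f := by
    rw [← hlaw, lintegral_map ((measurable_scaledKernel_left hK h z).pow_const 2) (hZ 0),
      ← lintegral_const_mul' _ _ (by finiteness)]
    refine lintegral_mono_ae ?_
    filter_upwards [hC] with s hs
    simp only [ξ, Ξ]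
    rw [enorm_mul, mul_pow, enorm_bump hh, mul_comm]
    gcongr
    rw [← ofReal_norm]
    exact ENNReal.ofReal_le_ofReal (hs t ht)
  simp_rw [h2]
  rw [← h3]
  refine h1.trans ?_
  gcongr

theorem measurable_kHat_joint (hZ : ∀ i, Measurable (Z i)) (hW : ∀ i, Measurable (W i))
    (hw : Continuous w) (hK : Measurable K) :
    Measurable fun x : Ω × Euc q × Euc p =>
      kHat w K h n (fun i => Z i x.1) (fun i => W i x.1) x.2.2 x.2.1 := by
  simp_rw [kHat_eq]
  refine Finset.measurable_fun_sum _ fun i _ => ?_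
  refine Measurable.mul ?_ ?_
  · have : Measurable fun x : Ω × Euc q × Euc p => (inner ℝ (W i x.1) x.2.1 : ℝ) := by
      have := hW i
      fun_prop
    exact (hw.measurable.comp this).const_mul _
  · have : Measurable fun x : Ω × Euc q × Euc p => (Z i x.1, x.2.2) := by
      have := hZ i
      fun_prop
    have h2 := (measurable_bump (𝕜 := 𝕜) (h := h) hK).comp this
    exact h2

theorem Continuous.le_of_ae_le {X : Type*} [TopologicalSpace X] [MeasurableSpace X]
    {ν : Measure X} [ν.IsOpenPosMeasure] {F G : X → ℝ} (hF : Continuous F) (hG : Continuous G)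
    (h : ∀ᵐ x ∂ν, F x ≤ G x) (x : X) : F x ≤ G x := by
  have h1 : Dense {x | F x ≤ G x} := Measure.dense_of_ae h
  have h2 := (isClosed_le hF hG).closure_eq
  rw [h1.closure_eq] at h2
  have h3 : x ∈ {x | F x ≤ G x} := by rw [← h2]; exact Set.mem_univ x
  exact h3

/-- Tonelli reduces to fixed `(z, t)`. The variance uses the envelope with exponent 1, giving `1/(n
h^p)`, and the squared bias uses the envelope with exponent 2 and the smoothness of `k(·, t)`,
giving `h^{2ρ}`; each brings a tail mass. -/
theorem exists_lintegral_kernelDist_le (hZ : ∀ i, Measurable (Z i)) (hW : ∀ i, Measurable (W i))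
    (hpair : ∀ i j, i ≠ j → IndepFun (fun s => (Z i s, W i s)) (fun s => (Z j s, W j s)) P)
    (hident : ∀ i, IdentDistrib (fun s => (Z i s, W i s)) (fun s => (Z 0 s, W 0 s)) P P)
    (hw : Continuous w) (hC0 : 0 ≤ C) (hC : ∀ᵐ s ∂P, ∀ t ∈ T, ‖w (inner ℝ (W 0 s) t)‖ ≤ C)
    (hμ : ∀ᵐ t ∂μ, t ∈ T) (hf : IsProbDensity f) (hlaw : P.map (Z 0) = densMeasure f)
    (hdens : IsProbDensity dens) (hf_2 : HolderClass 1 2 dens f) (hf_1 : HolderClass 1 1 dens f)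
    {ρ : ℕ} (hρ : 1 ≤ ρ) {υ : ℝ} (hυ : (ρ : ℝ) < υ) {k : Euc p → Euc q → 𝕜}
    (hk : ∀ t ∈ T, (fun z => k z t) =ᵐ[volume] fun z => condKernel P (Z 0) (W 0) w f z t)
    (hk_B : UniformHolderClass υ 2 dens T (fun t z => k z t))
    (hKm : Measurable K) (hK : MomentKernel ρ K) (hK2 : Integrable (fun u => K u ^ 2) volume) :
    ∃ c : ℝ≥0, ∃ r₁ : ℝ, 0 < r₁ ∧ ∃ r₂ : ℝ, 0 < r₂ ∧ ∀ n : ℕ, n ≠ 0 → ∀ h : ℝ, 0 < h →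
      ∫⁻ s, kernelDist dens μ (kHat w K h n (fun i => Z i s) (fun i => W i s))
          (condKernel P (Z 0) (W 0) w f) ∂P
        ≤ c * ((n : ℝ≥0∞)⁻¹ * (ENNReal.ofReal (h ^ p)⁻¹ + tailMass f dens K h r₁)
          + (ENNReal.ofReal (h ^ (2 * ρ)) + tailMass f dens K h r₂)) := by
  have hf_1' : HolderClass 1 ((1 : ℕ) : ℝ) dens f := by simpa using hf_1
  have hf_2' : HolderClass 1 ((2 : ℕ) : ℝ) dens f := by simpa using hf_2
  obtain ⟨R₁, hR₁, G₁, hG₁⟩ := HolderClass.exists_envelope one_pos hf.1 hdens.1 hf_1'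
  obtain ⟨R₂, hR₂, G₂, hG₂⟩ := HolderClass.exists_envelope two_pos hf.1 hdens.1 hf_2'
  obtain ⟨R, hR, C₂, hkB⟩ := hk_B
  obtain ⟨c₁, r₁, hr₁, H₁⟩ := exists_lintegral_scaledKernel_sq_le hKm hK2 hf hdens.1 hR₁ hG₁
  obtain ⟨c₂, r₂, hr₂, H₂⟩ := exists_lintegral_smoothing_bias_sq_le (𝕜 := 𝕜) hρ hKm hK hf hdens.1
    hR₂ hG₂ hυ hR C hC0 C₂
  have hυ1 : 1 < υ := lt_of_le_of_lt (by exact_mod_cast hρ) hυ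
  have hfc := hf_1.continuous_of_one
  have hμtop : μ Set.univ ≠ ∞ := measure_ne_top _ _
  refine ⟨((8 * ENNReal.ofReal C ^ 2 * c₁ + 2 * c₂) * μ Set.univ).toNNReal, r₁, hr₁, r₂, hr₂,
    fun n hn h hh => ?_⟩
  rw [ENNReal.coe_toNNReal (by finiteness)]
  set cK := condKernel P (Z 0) (W 0) w f with hcK
  have hcKm : Measurable fun x : Euc p × Euc q => cK x.1 x.2 :=
    (stronglyMeasurable_condKernel hw hf.1).measurable
  have hjoint : Measurable fun x : Ω × Euc q × Euc p =>
      ‖kHat w K h n (fun i => Z i x.1) (fun i => W i x.1) x.2.2 x.2.1 - cK x.2.2 x.2.1‖ₑ ^ 2 := by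
    have h1 : Measurable fun x : Ω × Euc q × Euc p => (x.2.2, x.2.1) := by fun_prop
    have h2 := hcKm.comp h1
    have h3 := measurable_kHat_joint (n := n) (h := h) hZ hW hw hKm
    exact (h3.sub h2).enorm.pow_const 2
  have hd : Measurable fun z => ENNReal.ofReal (dens z) := hdens.1.ennreal_ofReal
  have hFm : Measurable fun x : (Ω × Euc q) × Euc p =>
      ‖kHat w K h n (fun i => Z i x.1.1) (fun i => W i x.1.1) x.2 x.1.2 - cK x.2 x.1.2‖ₑ ^ 2
        / ENNReal.ofReal (dens x.2) := by
    have h1 : Measurable fun x : (Ω × Euc q) × Euc p => (x.1.1, x.1.2, x.2) := by fun_prop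
    have h2 := hjoint.comp h1
    exact h2.div (hd.comp measurable_snd)
  unfold kernelDist
  rw [lintegral_lintegral_swap (f := fun s t => ∫⁻ z, ‖kHat w K h n (fun i => Z i s)
    (fun i => W i s) z t - cK z t‖ₑ ^ 2 / ENNReal.ofReal (dens z))
    hFm.lintegral_prod_right'.aemeasurable]
  set B := (n : ℝ≥0∞)⁻¹ * (ENNReal.ofReal (h ^ p)⁻¹ + tailMass f dens K h r₁)
    + (ENNReal.ofReal (h ^ (2 * ρ)) + tailMass f dens K h r₂) with hB
  rw [mul_right_comm, ← lintegral_const]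
  refine lintegral_mono_ae ?_
  filter_upwards [hμ] with t ht
  have hFm2 : Measurable fun x : Ω × Euc p =>
      ‖kHat w K h n (fun i => Z i x.1) (fun i => W i x.1) x.2 t - cK x.2 t‖ₑ ^ 2
        / ENNReal.ofReal (dens x.2) := by
    have h1 : Measurable fun x : Ω × Euc p => ((x.1, t), x.2) := by fun_prop
    have h2 := hFm.comp h1
    exact h2
  rw [lintegral_lintegral_swap (f := fun s z => ‖kHat w K h n (fun i => Z i s)
    (fun i => W i s) z t - cK z t‖ₑ ^ 2 / ENNReal.ofReal (dens z)) hFm2.aemeasurable]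
  obtain ⟨η, hηm, hη0, hTay, -, hη2⟩ := (hkB t ht).exists_taylorAt
  have hη2' := (hη2 2 two_pos (by simp)).2
  have hkc : Continuous fun z => k z t := (hkB t ht).continuous hυ1
  -- Domination by `C f` is needed at every point, because the bias bound evaluates `k` at the
  -- interpolation nodes. Continuity of both sides upgrades the almost everywhere inequality.
  have hkle : ∀ z, ‖k z t‖ ≤ C * f z := by
    refine Continuous.le_of_ae_le (ν := volume) hkc.norm (by fun_prop) ?_
    filter_upwards [ae_norm_condKernel_le (hZ 0) (hW 0) hw hC hf hlaw, hk t ht] with z h1 h2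
    rw [h2]
    exact h1 t ht
  have H₂' := H₂ (fun z => k z t) η hkc hηm hη0 hTay hη2' hkle h hh
  have hmean : ∀ z, ∫ y, bump 𝕜 K h y z * cK y t = ∫ u, K u • k (z + (-h) • u) t := fun z => by
    rw [integral_kernel_eq' hh z K fun y => k y t]
    refine integral_congr_ae ?_
    filter_upwards [hk t ht] with y hy
    rw [hy, RCLike.real_smul_eq_coe_mul]
    rfl
  calc ∫⁻ z, (∫⁻ s, ‖kHat w K h n (fun i => Z i s) (fun i => W i s) z t - cK z t‖ₑ ^ 2
        / ENNReal.ofReal (dens z) ∂P)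
      ≤ ∫⁻ z, (8 * (n : ℝ≥0∞)⁻¹ * ENNReal.ofReal C ^ 2 *
          ((∫⁻ y, scaledKernel K h y z ^ 2 ∂densMeasure f) / ENNReal.ofReal (dens z))
          + 2 * (‖(∫ u, K u • k (z + (-h) • u) t) - k z t‖ₑ ^ 2 / ENNReal.ofReal (dens z))) := by
        refine lintegral_mono_ae ?_
        filter_upwards [ae_lintegral_scaledKernel_ne_top hKm hK.integrable hh hf, hk t ht]
          with z hz hkz
        simp_rw [div_eq_mul_inv]
        rw [lintegral_mul_const'' _ (by
          have h1 : Measurable fun s : Ω => (s, t, z) := by fun_prop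
          have h2 := hjoint.comp h1
          exact h2.aemeasurable)]
        have h2 := lintegral_kHat_sub_sq_le hZ hW hpair hident hw hC hf hlaw hKm hh hn ht hz
          (cK z t)
        refine (mul_le_mul_left h2 _).trans (le_of_eq ?_)
        rw [← hcK, hmean z, ← hkz]
        ring
    _ = 8 * (n : ℝ≥0∞)⁻¹ * ENNReal.ofReal C ^ 2 *
          (∫⁻ z, (∫⁻ y, scaledKernel K h y z ^ 2 ∂densMeasure f) / ENNReal.ofReal (dens z))
        + 2 * ∫⁻ z, ‖(∫ u, K u • k (z + (-h) • u) t) - k z t‖ₑ ^ 2 / ENNReal.ofReal (dens z) := by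
        have hm : Measurable fun z => ∫⁻ y, scaledKernel K h y z ^ 2 ∂densMeasure f :=
          Measurable.lintegral_prod_right'
            (f := fun x : Euc p × Euc p => scaledKernel K h x.2 x.1 ^ 2) (by
              have := measurable_scaledKernel hKm h
              fun_prop)
        have hn' : (n : ℝ≥0∞) ≠ 0 := by exact_mod_cast hn
        rw [lintegral_add_left (by fun_prop), lintegral_const_mul' _ _ (by finiteness),
          lintegral_const_mul' _ _ (by finiteness)]
    _ ≤ 8 * (n : ℝ≥0∞)⁻¹ * ENNReal.ofReal C ^ 2 *
          (c₁ * (ENNReal.ofReal (h ^ p)⁻¹ + tailMass f dens K h r₁))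
        + 2 * (c₂ * (ENNReal.ofReal (h ^ (2 * ρ)) + tailMass f dens K h r₂)) := by
        gcongr
        exact H₁ h hh
    _ = (8 * ENNReal.ofReal C ^ 2 * c₁) *
          ((n : ℝ≥0∞)⁻¹ * (ENNReal.ofReal (h ^ p)⁻¹ + tailMass f dens K h r₁))
        + 2 * c₂ * (ENNReal.ofReal (h ^ (2 * ρ)) + tailMass f dens K h r₂) := by ring
    _ ≤ (8 * ENNReal.ofReal C ^ 2 * c₁ + 2 * c₂) * B := by
        rw [hB, mul_add (8 * ENNReal.ofReal C ^ 2 * c₁ + 2 * c₂)]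
        gcongr
        · exact le_self_add
        · exact le_add_self

end MeanSquareError


/-! ### From moment bounds to convergence in probability. -/

section Probability

variable {Ω : Type*} [MeasurableSpace Ω] {P : Measure Ω}

/-- A stochastic bound of product form implies convergence to zero in probability. -/
theorem tendstoInMeasure_of_product_bound {E : Type*} [SeminormedAddCommGroup E] {X : ℕ → Ω → E}
    [IsProbabilityMeasure P]
    {D N B : ℕ → Ω → ℝ≥0∞} (hD : ∀ n, AEMeasurable (D n) P) (hN : ∀ n, AEMeasurable (N n) P)
    (hB : ∀ n, AEMeasurable (B n) P) {d e : ℕ → ℝ≥0∞} {c M : ℝ≥0} {τ : ℝ≥0∞} (hτ : τ ≠ 0)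
    (hτ' : τ ≠ ∞)
    (hD0 : Tendsto (fun n => ∫⁻ s, D n s ^ 2 ∂P) atTop (𝓝 0))
    (hNM : ∀ n, ∫⁻ s, N n s ^ 2 ∂P ≤ M)
    (hB0 : Tendsto (fun n => ∫⁻ s, B n s ∂P) atTop (𝓝 0))
    (hd : Tendsto d atTop (𝓝 0)) (he : Tendsto e atTop (𝓝 0))
    (hX : ∀ᶠ n in atTop, ∀ᵐ s ∂P, D n s ≤ τ → ‖X n s‖ₑ ≤ c * ((D n s + d n) * N n s + B n s + e n)) :
    TendstoInMeasure P X atTop fun _ => 0 := by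
  have h1 : Tendsto (fun n => ∫⁻ s, (D n s + d n) * N n s ∂P) atTop (𝓝 0) := by
    have h2 : Tendsto (fun n => ((2 * ∫⁻ s, D n s ^ 2 ∂P) + 2 * d n ^ 2) * M) atTop (𝓝 0) := by
      have h3 : Tendsto (fun n => 2 * (∫⁻ s, D n s ^ 2 ∂P)) atTop (𝓝 0) := by
        simpa using ENNReal.Tendsto.const_mul hD0 (Or.inr (by finiteness : (2 : ℝ≥0∞) ≠ ∞))
      have h4 : Tendsto (fun n => 2 * d n ^ 2) atTop (𝓝 0) := by
        simpa using ENNReal.Tendsto.const_mul (hd.ennrpow_const 2)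
          (Or.inr (by finiteness : (2 : ℝ≥0∞) ≠ ∞))
      simpa using ENNReal.Tendsto.mul_const (h3.add h4)
        (Or.inr (ENNReal.coe_ne_top : (M : ℝ≥0∞) ≠ ∞))
    have h3 : Tendsto (fun n => (∫⁻ s, (D n s + d n) * N n s ∂P) ^ 2) atTop (𝓝 0) := by
      refine tendsto_of_tendsto_of_tendsto_of_le_of_le tendsto_const_nhds h2
        (fun _ => bot_le) fun n => ?_
      refine (lintegral_mul_sq_le ((hD n).add_const _) (hN n)).trans ?_
      gcongr
      · calc ∫⁻ s, (D n s + d n) ^ 2 ∂P ≤ ∫⁻ s, (2 * D n s ^ 2 + 2 * d n ^ 2) ∂P :=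
              lintegral_mono fun s => add_sq_le_ennreal _ _
          _ = _ := by
              rw [lintegral_add_right _ measurable_const, lintegral_const_mul' _ _ (by finiteness),
                lintegral_const]
              simp
      · exact hNM n
    have h4 := h3.ennrpow_const (1 / 2)
    simp only [← ENNReal.rpow_natCast, ← ENNReal.rpow_mul] at h4
    simpa using h4
  have h5 : Tendsto (fun n => ∫⁻ s, c * ((D n s + d n) * N n s + B n s + e n) ∂P) atTop (𝓝 0) := by
    have h6 : ∀ n, ∫⁻ s, c * ((D n s + d n) * N n s + B n s + e n) ∂P
        = c * ((∫⁻ s, (D n s + d n) * N n s ∂P) + (∫⁻ s, B n s ∂P) + e n) := fun n => by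
      rw [lintegral_const_mul' _ _ (by finiteness), lintegral_add_right _ measurable_const,
        lintegral_add_right' _ (hB n), lintegral_const]
      simp
    simp_rw [h6]
    simpa using ENNReal.Tendsto.const_mul ((h1.add hB0).add he)
      (Or.inr (ENNReal.coe_ne_top : (c : ℝ≥0∞) ≠ ∞))
  refine tendstoInMeasure_of_ne_top fun ε hε hε' => ?_
  have h7 : Tendsto (fun n => (∫⁻ s, D n s ^ 2 ∂P) / τ ^ 2
      + (∫⁻ s, c * ((D n s + d n) * N n s + B n s + e n) ∂P) / ε) atTop (𝓝 0) := by
    have h8 := ENNReal.Tendsto.div_const hD0 (Or.inr (pow_ne_zero 2 hτ))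
    have h9 := ENNReal.Tendsto.div_const h5 (Or.inr hε.ne')
    simpa using h8.add h9
  refine tendsto_of_tendsto_of_tendsto_of_le_of_le' tendsto_const_nhds h7
    (Eventually.of_forall fun _ => bot_le) ?_
  filter_upwards [hX] with n hn
  -- The error bound is available only where `D ≤ τ`. The exceptional event is charged to the second
  -- moment of `D`, and Markov's inequality treats both events.
  have h10 : P {s | ε ≤ edist (X n s) 0} ≤ P ({s | τ ^ 2 ≤ D n s ^ 2}
      ∪ {s | ε ≤ c * ((D n s + d n) * N n s + B n s + e n)}) := by
    refine measure_mono_ae ?_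
    filter_upwards [hn] with s hs hs'
    rcases le_total (D n s) τ with h | h
    · exact Or.inr (le_trans (by rw [← edist_zero_right]; exact hs') (hs h))
    · exact Or.inl (by simpa using pow_le_pow_left' h 2)
  refine h10.trans ((measure_union_le _ _).trans ?_)
  gcongr
  · exact meas_ge_le_lintegral_div ((hD n).pow_const 2) (pow_ne_zero 2 hτ) (by finiteness)
  · refine meas_ge_le_lintegral_div ?_ hε.ne' hε'
    have := hD n; have := hN n; have := hB n
    fun_prop

end Probability

/-! ### The centred noise term. -/

section Noise

variable {𝕜 : Type*} [RCLike 𝕜] {Ω : Type*} [MeasurableSpace Ω] {P : Measure Ω}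
  [IsProbabilityMeasure P] {q : ℕ} {W : ℕ → Ω → Euc q} {w : ℝ → 𝕜}
  {T : Set (Euc q)} {μ : Measure (Euc q)} [IsFiniteMeasure μ] {C : ℝ} {U : ℕ → Ω → ℝ}

/-- The weight is bounded and a function of `W`, so it can be pulled out of the conditional
expectation of `U` given `W`, which is zero. -/
theorem integral_residual_mul_weight_eq_zero {U : Ω → ℝ} {W : Ω → Euc q} (hW : Measurable W)
    (hw : Continuous w) (hC : ∀ᵐ s ∂P, ∀ t ∈ T, ‖w (inner ℝ (W s) t)‖ ≤ C)
    (hUint : Integrable U P)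
    (hU : P[U | MeasurableSpace.comap W inferInstance] =ᵐ[P] 0) {t : Euc q} (ht : t ∈ T) :
    ∫ s, (U s : 𝕜) * w (inner ℝ (W s) t) ∂P = 0 := by
  have hwt : Continuous fun v : Euc q => w (inner ℝ v t) := hw.comp (by fun_prop)
  have hm : MeasurableSpace.comap W inferInstance ≤ (inferInstance : MeasurableSpace Ω) :=
    hW.comap_le
  have hg : StronglyMeasurable[MeasurableSpace.comap W inferInstance]
      fun s => w (inner ℝ (W s) t) :=
    hwt.stronglyMeasurable.comp_measurable (comap_measurable W)
  have hint : Integrable (U • fun s => w (inner ℝ (W s) t)) P := by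
    have h1 := (hUint.ofReal (𝕜 := 𝕜)).mul_bdd (hwt.measurable.comp hW).aestronglyMeasurable
      (by filter_upwards [hC] with s hs using hs t ht)
    refine h1.congr (Eventually.of_forall fun s => ?_)
    simp [RCLike.real_smul_eq_coe_mul]
  have h2 := condExp_smul_of_aestronglyMeasurable_right
    (m := MeasurableSpace.comap W inferInstance) (μ := P) hUint hint hg.aestronglyMeasurable
  calc ∫ s, (U s : 𝕜) * w (inner ℝ (W s) t) ∂P = ∫ s, (U • fun s => w (inner ℝ (W s) t)) s ∂P := by
        refine integral_congr_ae (Eventually.of_forall fun s => ?_)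
        simp [RCLike.real_smul_eq_coe_mul]
    _ = ∫ s, (P[U • (fun s => w (inner ℝ (W s) t)) | MeasurableSpace.comap W inferInstance]) s ∂P :=
        (integral_condExp hm).symm
    _ = 0 := by
        rw [integral_eq_zero_of_ae]
        filter_upwards [h2, hU] with s h3 h4
        rw [h3, Pi.smul_apply', h4]
        simp

/-- The measurable version of the squared norm of `n⁻¹ ∑_{i<n} U_i w(W_iᵀ·)`. -/
noncomputable def noiseNormSq (w : ℝ → 𝕜) (μ : Measure (Euc q)) (U : ℕ → Ω → ℝ)
    (W : ℕ → Ω → Euc q) (n : ℕ) (s : Ω) : ℝ≥0∞ :=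
  ∫⁻ t, ‖(n : 𝕜)⁻¹ * ∑ i ∈ Finset.range n, (U i s : 𝕜) * w (inner ℝ (W i s) t)‖ₑ ^ 2 ∂μ

theorem measurable_noise_joint (hU : ∀ i, Measurable (U i)) (hW : ∀ i, Measurable (W i))
    (hw : Continuous w) (n : ℕ) : Measurable fun x : Ω × Euc q =>
      ‖(n : 𝕜)⁻¹ * ∑ i ∈ Finset.range n, (U i x.1 : 𝕜) * w (inner ℝ (W i x.1) x.2)‖ₑ ^ 2 := by
  refine (Measurable.const_mul (Finset.measurable_fun_sum _ fun i _ => ?_) _).enorm.pow_const 2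
  refine Measurable.mul ?_ ?_
  · exact RCLike.continuous_ofReal.measurable.comp ((hU i).comp measurable_fst)
  · have : Measurable fun x : Ω × Euc q => (inner ℝ (W i x.1) x.2 : ℝ) := by
      have := hW i
      fun_prop
    exact hw.measurable.comp this

theorem measurable_noiseNormSq (hU : ∀ i, Measurable (U i)) (hW : ∀ i, Measurable (W i))
    (hw : Continuous w) (n : ℕ) : Measurable (noiseNormSq w μ U W n) :=
  (measurable_noise_joint hU hW hw n).lintegral_prod_right'

/-- For each `t` in `T` the noise is a mean of independent centred variables, so its second moment
is `O(1/n)`, uniformly in `t`; `μ` is finite. -/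
theorem lintegral_noiseNormSq_le (hUm : ∀ i, Measurable (U i)) (hW : ∀ i, Measurable (W i))
    (hpair : ∀ i j, i ≠ j → IndepFun (fun s => (U i s, W i s)) (fun s => (U j s, W j s)) P)
    (hident : ∀ i, IdentDistrib (fun s => (U i s, W i s)) (fun s => (U 0 s, W 0 s)) P P)
    (hw : Continuous w) (hC : ∀ᵐ s ∂P, ∀ t ∈ T, ‖w (inner ℝ (W 0 s) t)‖ ≤ C)
    (hμ : ∀ᵐ t ∂μ, t ∈ T) (hUint : Integrable (U 0) P)
    (hU : P[U 0 | MeasurableSpace.comap (W 0) inferInstance] =ᵐ[P] 0) {n : ℕ} (hn : n ≠ 0) :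
    ∫⁻ s, noiseNormSq w μ U W n s ∂P
      ≤ 8 * (n : ℝ≥0∞)⁻¹ * (ENNReal.ofReal C ^ 2 * ∫⁻ s, ‖U 0 s‖ₑ ^ 2 ∂P) * μ Set.univ := by
  unfold noiseNormSq
  rw [lintegral_lintegral_swap (f := fun s t => ‖(n : 𝕜)⁻¹ * ∑ i ∈ Finset.range n,
    (U i s : 𝕜) * w (inner ℝ (W i s) t)‖ₑ ^ 2) (measurable_noise_joint hUm hW hw n).aemeasurable,
    ← lintegral_const]
  refine lintegral_mono_ae ?_
  filter_upwards [hμ] with t ht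
  let Ξ : ℝ × Euc q → 𝕜 := fun x => (x.1 : 𝕜) * w (inner ℝ x.2 t)
  have hΞ : Measurable Ξ := (RCLike.continuous_ofReal.measurable.comp measurable_fst).mul
    (hw.comp (by fun_prop)).measurable
  let ξ : ℕ → Ω → 𝕜 := fun i s => Ξ (U i s, W i s)
  have h1 := lintegral_enorm_mean_sub_sq_le (P := P) (ξ := ξ)
    (fun i => hΞ.comp ((hUm i).prodMk (hW i)))
    (fun i j hij => (hpair i j hij).comp hΞ hΞ) (fun i => (hident i).comp hΞ) hn 0
  have h2 : ∫ s, ξ 0 s ∂P = 0 :=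
    integral_residual_mul_weight_eq_zero (hW 0) hw hC hUint hU ht
  rw [h2] at h1
  simp only [sub_zero, enorm_zero, ne_eq, OfNat.ofNat_ne_zero, not_false_eq_true, zero_pow,
    mul_zero, add_zero] at h1
  refine h1.trans ?_
  gcongr
  rw [← lintegral_const_mul' _ _ (by finiteness)]
  refine lintegral_mono_ae ?_
  filter_upwards [hC] with s hs
  simp only [ξ, Ξ]
  rw [enorm_mul, mul_pow, mul_comm, ← ofReal_norm, ← ofReal_norm, ← ofReal_norm,
    RCLike.norm_ofReal, Real.norm_eq_abs]
  gcongr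
  exact hs t ht

end Noise


/-! ### Error bound with constants independent of the perturbed operator. -/

section DeterministicError

variable {𝕜 : Type*} [RCLike 𝕜] {H₁ H₂ : Type*} [NormedAddCommGroup H₁] [InnerProductSpace 𝕜 H₁]
  [CompleteSpace H₁] [NormedAddCommGroup H₂] [InnerProductSpace 𝕜 H₂] [CompleteSpace H₂]

/-- The threshold `τ` does two things: it keeps `a‖B‖² ≤ 1`, which is possible since the inequality
for `A` is strict, and, being at most 1, it forces `δ ≤ 1/(m+1)`, so that the regularization bias is
`O((m+1)⁻²)` with no separate term in `δ`. -/
theorem exists_norm_landweberOp_error_le {a : ℝ} (ha : 0 < a) (A : H₁ →L[𝕜] H₂)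
    (hA : a * ‖A‖ ^ 2 < 1) (ψ χ : H₁) :
    ∃ c : ℝ, 0 ≤ c ∧ ∃ τ : ℝ, 0 < τ ∧ ∀ (B : H₁ →L[𝕜] H₂) (m : ℕ) (δ : ℝ) (ε b : H₂),
      ‖B - A‖ ≤ δ → (m + 1) * δ ≤ τ →
      ‖inner 𝕜 (ContinuousLinearMap.adjoint A (A ψ))
          (landweberOp a m B (B (ContinuousLinearMap.adjoint A (A χ)) + ε + b)
            - ContinuousLinearMap.adjoint A (A χ))
          - inner 𝕜 ψ (ContinuousLinearMap.adjoint A ε)‖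
        ≤ c * (((m + 1) * δ + √(1 / (m + 1))) * ‖ε‖ + ‖b‖ + 1 / ((m : ℝ) + 1) ^ 2) := by
  obtain ⟨τ, hτ0, hτ1, hτ⟩ : ∃ τ : ℝ, 0 < τ ∧ τ ≤ 1 ∧ a * (‖A‖ + τ) ^ 2 ≤ 1 := by
    have h1 : Tendsto (fun τ : ℝ => a * (‖A‖ + τ) ^ 2) (𝓝[>] 0) (𝓝 (a * (‖A‖ + 0) ^ 2)) :=
      ((by fun_prop : Continuous fun τ : ℝ => a * (‖A‖ + τ) ^ 2).tendsto 0).mono_left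
        nhdsWithin_le_nhds
    rw [add_zero] at h1
    have h2 := h1.eventually (gt_mem_nhds hA)
    have h3 : ∀ᶠ τ : ℝ in 𝓝[>] 0, τ ≤ 1 :=
      nhdsWithin_le_nhds (Iic_mem_nhds (by norm_num))
    obtain ⟨τ, h4, h5, h6⟩ := (h2.and (h3.and self_mem_nhdsWithin)).exists
    exact ⟨τ, h6, h5, h4.le⟩
  set L := ‖A‖ + 1 with hL
  have hL0 : 0 ≤ L := by positivity
  refine ⟨‖ψ‖ * (1 + 2 * a * L ^ 2 + √(4 / a)) + ‖ψ‖ * (2 * L + 2 * a * L ^ 2)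
    + ‖ψ‖ * ‖χ‖ * (4 / a + 2 * L) ^ 2, by positivity, τ, hτ0, fun B m δ ε b hδ hmδ => ?_⟩
  have hδ0 : 0 ≤ δ := (norm_nonneg _).trans hδ
  set M : ℝ := (m : ℝ) + 1 with hM
  have hM1 : 1 ≤ M := by rw [hM]; linarith [Nat.cast_nonneg (α := ℝ) m]
  have hM0 : 0 < M := by linarith
  have hδM : δ ≤ M * δ := le_mul_of_one_le_left hδ0 hM1
  have hBn : ‖B‖ ≤ ‖A‖ + δ := by
    have h1 := norm_sub_norm_le B A
    linarith
  have hB : a * ‖B‖ ^ 2 ≤ 1 := by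
    refine le_trans ?_ hτ
    gcongr
    linarith
  -- The integer quotient `k = ⌊m/4⌋` satisfies `(m+1)/4 ≤ k + 1`, so the decay `d` is at most
  -- `(4/a)/(m+1)`.
  have h1 := norm_landweberOp_error_le ha A hB (k := m / 4) (Nat.mul_div_le m 4) ψ χ ε b (L := L)
    (by rw [hL]; linarith) (by rw [hL]; linarith) hδ rfl
  set d : ℝ := 1 / (a * ((m / 4 : ℕ) + 1)) with hd
  have hk : M / 4 ≤ (m / 4 : ℕ) + 1 := by
    have : m + 1 ≤ 4 * (m / 4 + 1) := by omega
    have h2 : (m : ℝ) + 1 ≤ 4 * ((m / 4 : ℕ) + 1) := by exact_mod_cast this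
    rw [hM]; linarith
  have hdM : d ≤ 4 / a * (1 / M) := by
    have h2 : d ≤ 1 / (a * (M / 4)) := by
      rw [hd]
      exact one_div_le_one_div_of_le (by positivity) (by gcongr)
    refine h2.trans (le_of_eq ?_)
    field_simp
  have hsd : √d ≤ √(4 / a) * √(1 / M) := by
    rw [← Real.sqrt_mul (by positivity)]
    exact Real.sqrt_le_sqrt hdM
  have hd0 : 0 ≤ d := by rw [hd]; positivity
  have hδ1 : δ ≤ 1 / M := by
    rw [le_div_iff₀ hM0]
    linarith
  have e1 : δ + √d + 2 * a * L ^ 2 * M * δ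
      ≤ (1 + 2 * a * L ^ 2 + √(4 / a)) * (M * δ + √(1 / M)) := by
    have h2 : 0 ≤ 2 * a * L ^ 2 := by positivity
    have h3 : 0 ≤ √(4 / a) * (M * δ) := by positivity
    have h4 : 0 ≤ (1 + 2 * a * L ^ 2) * √(1 / M) := by positivity
    nlinarith
  have e2 : 2 * L + 2 * a * L ^ 2 * M * δ ≤ 2 * L + 2 * a * L ^ 2 := by
    have h2 : 0 ≤ 2 * a * L ^ 2 := by positivity
    nlinarith
  have e3 : (d + 2 * L * δ) ^ 2 ≤ (4 / a + 2 * L) ^ 2 * (1 / M ^ 2) := by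
    have h2 : d + 2 * L * δ ≤ (4 / a + 2 * L) * (1 / M) := by
      rw [add_mul]
      gcongr
    calc _ ≤ ((4 / a + 2 * L) * (1 / M)) ^ 2 := by gcongr
      _ = _ := by rw [mul_pow, div_pow, one_pow]
  refine h1.trans ?_
  set x := M * δ + √(1 / M) with hx
  have hx0 : 0 ≤ x := by positivity
  calc _ ≤ ‖ψ‖ * ((1 + 2 * a * L ^ 2 + √(4 / a)) * x) * ‖ε‖
        + ‖ψ‖ * (2 * L + 2 * a * L ^ 2) * ‖b‖
        + ‖ψ‖ * ‖χ‖ * ((4 / a + 2 * L) ^ 2 * (1 / M ^ 2)) := by gcongr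
    _ ≤ _ := by
      set c₁ := ‖ψ‖ * (1 + 2 * a * L ^ 2 + √(4 / a)) with hc₁
      set c₂ := ‖ψ‖ * (2 * L + 2 * a * L ^ 2) with hc₂
      set c₃ := ‖ψ‖ * ‖χ‖ * (4 / a + 2 * L) ^ 2 with hc₃
      have p1 : 0 ≤ c₁ := by positivity
      have p2 : 0 ≤ c₂ := by positivity
      have p3 : 0 ≤ c₃ := by positivity
      calc _ = c₁ * (x * ‖ε‖) + c₂ * ‖b‖ + c₃ * (1 / M ^ 2) := by rw [hc₁, hc₂, hc₃]; ring
        _ ≤ (c₁ + c₂ + c₃) * (x * ‖ε‖) + (c₁ + c₂ + c₃) * ‖b‖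
            + (c₁ + c₂ + c₃) * (1 / M ^ 2) := by
          gcongr <;> linarith
        _ = _ := by ring

end DeterministicError

/-! ### Splitting the data into signal, noise and smoothing bias. -/

section SampleDecomposition

variable {𝕜 : Type*} [RCLike 𝕜] {p q : ℕ} {w : ℝ → 𝕜} {T : Set (Euc q)} {μ : Measure (Euc q)}
  [IsFiniteMeasure μ] {dens : Euc p → ℝ} {C h : ℝ} {n : ℕ} {K : Euc p → ℝ} {y : ℕ → ℝ}
  {z : ℕ → Euc p} {v : ℕ → Euc q} {φ : Euc p → ℝ}

/-- The error of smoothing `φ` with the rescaled kernel. -/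
noncomputable def smoothBias (φ K : Euc p → ℝ) (h : ℝ) (x : Euc p) : ℝ :=
  φ x - ∫ u, K u • φ (x + h • u)

theorem integral_toL2_mul_bump (hh : 0 < h) (hK : Measurable K) (hdens : IsProbDensity dens)
    {x : Euc p}
    (hKd : ∫⁻ y, ENNReal.ofReal (K (h⁻¹ • (y - x)) ^ 2) / ENNReal.ofReal (dens y) ≠ ∞)
    (hφ : MemLp φ 2 (densMeasure dens)) :
    ∫ y, toL2 (densMeasure dens) (fun z => (φ z : 𝕜)) y * bump 𝕜 K h x y
      = ((∫ u, K u • φ (x + h • u) : ℝ) : 𝕜) := by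
  rw [integral_mul_congr_densMeasure hdens (ae_bump_eq_zero hK hdens hKd) (coeFn_toL2 hφ.ofReal),
    integral_kernel_eq hh, ← integral_ofReal]
  refine integral_congr_ae (Eventually.of_forall fun y => ?_)
  simp only [bump, smul_eq_mul]
  push_cast
  ring

/-- All terms are combinations of the functions `w(v_iᵀ·)`, so coefficients can be compared: `y_i`
equals the smoothed value of `φ` at `z_i`, plus the residual `y_i - φ(z_i)`, plus the smoothing
error there. -/
theorem toL2_sHat_eq (hw : Continuous w) (hμ : ∀ᵐ t ∂μ, t ∈ T)
    (hv : ∀ i < n, ∀ t ∈ T, ‖w (inner ℝ (v i) t)‖ ≤ C) (hh : 0 < h) (hK : Measurable K)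
    (hdens : IsProbDensity dens)
    (hKd : ∀ i < n, ∫⁻ y, ENNReal.ofReal (K (h⁻¹ • (y - z i)) ^ 2) / ENNReal.ofReal (dens y) ≠ ∞)
    (hφ : MemLp φ 2 (densMeasure dens)) :
    toL2 μ (sHat w n y v)
      = opAZHat w K dens μ h n z v (toL2 (densMeasure dens) fun z => (φ z : 𝕜))
        + (∑ i ∈ Finset.range n, ((n : 𝕜)⁻¹ * ((y i - φ (z i) : ℝ) : 𝕜)) •
            toL2 μ fun t => w (inner ℝ (v i) t))
        + ∑ i ∈ Finset.range n, ((n : 𝕜)⁻¹ * (smoothBias φ K h (z i) : 𝕜)) •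
            toL2 μ fun t => w (inner ℝ (v i) t) := by
  have h1 : sHat w n y v = fun t => ∑ i ∈ Finset.range n,
      ((n : 𝕜)⁻¹ * (y i : 𝕜)) * w (inner ℝ (v i) t) := by
    funext t
    rw [sHat, Finset.mul_sum]
    exact Finset.sum_congr rfl fun i _ => by ring
  rw [h1, toL2_sum_weight hw hμ hv, opAZHat_eq_sum hw hμ hv hK hdens hKd,
    ← Finset.sum_add_distrib, ← Finset.sum_add_distrib]
  refine Finset.sum_congr rfl fun i hi => ?_
  rw [integral_toL2_mul_bump hh hK hdens (hKd i (Finset.mem_range.1 hi)) hφ, ← add_smul, ← add_smul]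
  congr 1
  rw [← mul_add, ← mul_add, smoothBias]
  congr 1
  push_cast
  ring

theorem enorm_toL2_weight_le (hw : Continuous w) (hμ : ∀ᵐ t ∂μ, t ∈ T) {x : Euc q}
    (hx : ∀ t ∈ T, ‖w (inner ℝ x t)‖ ≤ C) :
    ‖toL2 μ fun t => w (inner ℝ x t)‖ₑ ≤ μ Set.univ ^ (1 / 2 : ℝ) * ENNReal.ofReal C := by
  rw [Lp.enorm_def, eLpNorm_congr_ae (coeFn_toL2 (memLp_weight hw hμ hx))]
  have := eLpNorm_le_of_ae_bound (p := 2) (μ := μ) (f := fun t => w (inner ℝ x t)) (C := C)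
    (by filter_upwards [hμ] with t ht using hx t ht)
  simpa using this

theorem enorm_sum_weight_le (hw : Continuous w) (hμ : ∀ᵐ t ∂μ, t ∈ T)
    (hv : ∀ i < n, ∀ t ∈ T, ‖w (inner ℝ (v i) t)‖ ≤ C) (β : ℕ → ℝ) :
    ‖∑ i ∈ Finset.range n, ((n : 𝕜)⁻¹ * (β i : 𝕜)) • toL2 μ fun t => w (inner ℝ (v i) t)‖ₑ
      ≤ μ Set.univ ^ (1 / 2 : ℝ) * ENNReal.ofReal C *
        ((n : ℝ≥0∞)⁻¹ * ∑ i ∈ Finset.range n, ‖β i‖ₑ) := by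
  rcases Nat.eq_zero_or_pos n with rfl | hn
  · simp
  refine (enorm_sum_le _ _).trans ?_
  rw [Finset.mul_sum, Finset.mul_sum]
  refine Finset.sum_le_sum fun i hi => ?_
  have h1 : ‖(n : 𝕜)⁻¹ * (β i : 𝕜)‖ₑ = (n : ℝ≥0∞)⁻¹ * ‖β i‖ₑ := by
    rw [← ofReal_norm, norm_mul, norm_inv, RCLike.norm_natCast, RCLike.norm_ofReal,
      ENNReal.ofReal_mul (by positivity), ENNReal.ofReal_inv_of_pos (by positivity),
      ENNReal.ofReal_natCast, ← Real.norm_eq_abs, ofReal_norm]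
  rw [enorm_smul, h1, mul_comm]
  gcongr
  exact enorm_toL2_weight_le hw hμ (hv i (Finset.mem_range.1 hi))

theorem enorm_sum_weight_sq (hw : Continuous w) (hμ : ∀ᵐ t ∂μ, t ∈ T)
    (hv : ∀ i < n, ∀ t ∈ T, ‖w (inner ℝ (v i) t)‖ ≤ C) (u : ℕ → ℝ) :
    ‖∑ i ∈ Finset.range n, ((n : 𝕜)⁻¹ * (u i : 𝕜)) • toL2 μ fun t => w (inner ℝ (v i) t)‖ₑ ^ 2
      = ∫⁻ t, ‖(n : 𝕜)⁻¹ * ∑ i ∈ Finset.range n, (u i : 𝕜) * w (inner ℝ (v i) t)‖ₑ ^ 2 ∂μ := by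
  rw [Lp.enorm_def, ← ENNReal.rpow_natCast, Nat.cast_ofNat, eLpNorm_two_sq]
  simp only [ENNReal.rpow_ofNat]
  refine lintegral_congr_ae ?_
  filter_upwards [sum_smul_weight_coeFn hw hμ hv fun i => (n : 𝕜)⁻¹ * (u i : 𝕜)] with t ht
  rw [ht, Finset.mul_sum]
  simp_rw [mul_assoc]

end SampleDecomposition


/-! ### Consequences of the rate conditions. -/

section Rates

variable {h : ℕ → ℝ} {m : ℕ → ℕ} {ρ p : ℕ}

/-- A zero value of `m n` would make the quotient in `h₂` zero, contrary to divergence. Then `h₃`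
gives `n < (m n)³` eventually. -/
theorem tendsto_regularization_atTop
    (h₂ : Tendsto (fun n : ℕ => (n : ℝ) * h n ^ p / (m n : ℝ) ^ 2) atTop atTop)
    (h₃ : Tendsto (fun n : ℕ => (n : ℝ) / (m n : ℝ) ^ 3) atTop (𝓝 0)) :
    (∀ᶠ n in atTop, m n ≠ 0) ∧ Tendsto m atTop atTop := by
  have hm0 : ∀ᶠ n in atTop, m n ≠ 0 := by
    filter_upwards [h₂.eventually_gt_atTop 0] with n hn h0
    simp [h0] at hn
  refine ⟨hm0, tendsto_atTop.2 fun b => ?_⟩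
  filter_upwards [hm0, h₃.eventually (gt_mem_nhds one_pos), eventually_ge_atTop (b ^ 3)]
    with n h0 h1 h4
  have hpos : (0 : ℝ) < (m n : ℝ) ^ 3 := by positivity
  rw [div_lt_one hpos] at h1
  have h5 : n < m n ^ 3 := by exact_mod_cast h1
  by_contra hc
  have := Nat.pow_lt_pow_left (not_le.1 hc) (by norm_num : 3 ≠ 0)
  omega

theorem tendsto_operator_rate (hh : ∀ n, 0 < h n)
    (h₁ : Tendsto (fun n : ℕ => (m n : ℝ) * h n ^ ρ) atTop (𝓝 0))
    (h₂ : Tendsto (fun n : ℕ => (n : ℝ) * h n ^ p / (m n : ℝ) ^ 2) atTop atTop)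
    (hm0 : ∀ᶠ n in atTop, m n ≠ 0) {t₁ t₂ : ℕ → ℝ≥0∞} {C₁ C₂ : ℝ≥0} (c : ℝ≥0)
    (ht₁ : ∀ᶠ n in atTop, t₁ n ≤ C₁ * ENNReal.ofReal (h n ^ (2 * ρ)))
    (ht₂ : ∀ᶠ n in atTop, t₂ n ≤ C₂ * ENNReal.ofReal (h n ^ (2 * ρ))) :
    Tendsto (fun n : ℕ => ENNReal.ofReal ((m n : ℝ) + 1) ^ 2 *
      (c * ((n : ℝ≥0∞)⁻¹ * (ENNReal.ofReal (h n ^ p)⁻¹ + t₁ n)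
        + (ENNReal.ofReal (h n ^ (2 * ρ)) + t₂ n)))) atTop (𝓝 0) := by
  have e1 : Tendsto (fun n : ℕ => ENNReal.ofReal (((n : ℝ) * h n ^ p / (m n : ℝ) ^ 2)⁻¹))
      atTop (𝓝 0) := by
    simpa using ENNReal.tendsto_ofReal h₂.inv_tendsto_atTop
  have e2 : Tendsto (fun n : ℕ => ENNReal.ofReal (((m n : ℝ) * h n ^ ρ) ^ 2)) atTop (𝓝 0) := by
    simpa using ENNReal.tendsto_ofReal (h₁.pow 2)
  have e3 : Tendsto (fun n : ℕ => (4 * c : ℝ≥0∞) *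
      (ENNReal.ofReal (((n : ℝ) * h n ^ p / (m n : ℝ) ^ 2)⁻¹)
        + (C₁ + 1 + C₂) * ENNReal.ofReal (((m n : ℝ) * h n ^ ρ) ^ 2))) atTop (𝓝 0) := by
    have e4 := ENNReal.Tendsto.const_mul e2 (a := (C₁ + 1 + C₂ : ℝ≥0∞)) (Or.inr (by finiteness))
    have e5 := ENNReal.Tendsto.const_mul (e1.add e4) (a := (4 * c : ℝ≥0∞)) (Or.inr (by finiteness))
    simpa using e5
  refine tendsto_of_tendsto_of_tendsto_of_le_of_le' tendsto_const_nhds e3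
    (Eventually.of_forall fun _ => bot_le) ?_
  filter_upwards [hm0, ht₁, ht₂, eventually_gt_atTop 0] with n hm h5 h6 hn
  have hm1 : (1 : ℝ) ≤ m n := by exact_mod_cast Nat.one_le_iff_ne_zero.2 hm
  have hM : ENNReal.ofReal ((m n : ℝ) + 1) ^ 2 ≤ 4 * ENNReal.ofReal ((m n : ℝ) ^ 2) := by
    rw [← ENNReal.ofReal_pow (by positivity), show (4 : ℝ≥0∞) = ENNReal.ofReal 4 by simp,
      ← ENNReal.ofReal_mul (by norm_num)]
    exact ENNReal.ofReal_le_ofReal (by nlinarith)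
  -- The tail mass in the variance term needs no help from `n⁻¹`: it is already of order `h^{2ρ}`.
  have hn1 : (n : ℝ≥0∞)⁻¹ ≤ 1 := ENNReal.inv_le_one.2 (by exact_mod_cast hn)
  have hn2 : (n : ℝ≥0∞)⁻¹ = ENNReal.ofReal (n : ℝ)⁻¹ := by
    rw [ENNReal.ofReal_inv_of_pos (by positivity), ENNReal.ofReal_natCast]
  have hhp : 0 < h n ^ p := pow_pos (hh n) p
  calc _ ≤ (4 * ENNReal.ofReal ((m n : ℝ) ^ 2)) *
        (c * ((n : ℝ≥0∞)⁻¹ * ENNReal.ofReal (h n ^ p)⁻¹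
          + 1 * (C₁ * ENNReal.ofReal (h n ^ (2 * ρ)))
          + (ENNReal.ofReal (h n ^ (2 * ρ)) + C₂ * ENNReal.ofReal (h n ^ (2 * ρ))))) := by
        rw [mul_add (n : ℝ≥0∞)⁻¹]
        gcongr
    _ = (4 * c) * (ENNReal.ofReal ((m n : ℝ) ^ 2) *
          ((n : ℝ≥0∞)⁻¹ * ENNReal.ofReal (h n ^ p)⁻¹)
        + (C₁ + 1 + C₂) * (ENNReal.ofReal ((m n : ℝ) ^ 2) * ENNReal.ofReal (h n ^ (2 * ρ)))) := by
        ring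
    _ = _ := by
        rw [hn2, ← ENNReal.ofReal_mul (by positivity), ← ENNReal.ofReal_mul (by positivity),
          ← ENNReal.ofReal_mul (by positivity)]
        congr 4
        · rw [inv_div, div_eq_mul_inv, mul_inv]
        · rw [mul_pow, ← pow_mul, mul_comm ρ 2]

theorem tendsto_bias_rate (hh : ∀ n, 0 < h n)
    (h₄ : Tendsto (fun n : ℕ => (n : ℝ) * h n ^ (2 * ρ)) atTop (𝓝 0)) {t : ℕ → ℝ≥0∞} {C : ℝ≥0}
    (c : ℝ≥0) (ht : ∀ᶠ n in atTop, t n ≤ C * ENNReal.ofReal (h n ^ (2 * ρ))) :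
    Tendsto (fun n : ℕ => ENNReal.ofReal √(n : ℝ) *
      (c * ENNReal.ofReal (h n ^ ρ) + c * t n ^ (1 / 2 : ℝ))) atTop (𝓝 0) := by
  have e1 : Tendsto (fun n : ℕ => ENNReal.ofReal √((n : ℝ) * h n ^ (2 * ρ))) atTop (𝓝 0) := by
    simpa using ENNReal.tendsto_ofReal h₄.sqrt
  have e2 := ENNReal.Tendsto.const_mul e1 (a := (c + c * (C : ℝ≥0∞) ^ (1 / 2 : ℝ)))
    (Or.inr (by finiteness))
  rw [mul_zero] at e2
  refine tendsto_of_tendsto_of_tendsto_of_le_of_le' tendsto_const_nhds e2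
    (Eventually.of_forall fun _ => bot_le) ?_
  filter_upwards [ht] with n hn
  have hhρ : 0 < h n ^ ρ := pow_pos (hh n) ρ
  have e3 : h n ^ (2 * ρ) = (h n ^ ρ) ^ 2 := by rw [← pow_mul, mul_comm]
  have e4 : t n ^ (1 / 2 : ℝ) ≤ (C : ℝ≥0∞) ^ (1 / 2 : ℝ) * ENNReal.ofReal (h n ^ ρ) := by
    calc t n ^ (1 / 2 : ℝ) ≤ (C * ENNReal.ofReal (h n ^ (2 * ρ))) ^ (1 / 2 : ℝ) := by gcongr
      _ = _ := by
        rw [ENNReal.mul_rpow_of_nonneg _ _ (by norm_num), e3,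
          ENNReal.ofReal_rpow_of_nonneg (by positivity) (by norm_num), ← Real.sqrt_eq_rpow,
          Real.sqrt_sq hhρ.le]
  have e5 : √((n : ℝ) * h n ^ (2 * ρ)) = √(n : ℝ) * h n ^ ρ := by
    rw [Real.sqrt_mul (by positivity), e3, Real.sqrt_sq hhρ.le]
  rw [e5, ENNReal.ofReal_mul (by positivity)]
  calc _ ≤ ENNReal.ofReal √(n : ℝ) * (c * ENNReal.ofReal (h n ^ ρ)
        + c * ((C : ℝ≥0∞) ^ (1 / 2 : ℝ) * ENNReal.ofReal (h n ^ ρ))) := by gcongr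
    _ = _ := by ring

/-- The square of the expression is at most `n/m⁴ ≤ n/m³` once `m ≥ 1`. -/
theorem tendsto_regularization_bias_rate
    (h₃ : Tendsto (fun n : ℕ => (n : ℝ) / (m n : ℝ) ^ 3) atTop (𝓝 0))
    (hm0 : ∀ᶠ n in atTop, m n ≠ 0) :
    Tendsto (fun n : ℕ => ENNReal.ofReal (√(n : ℝ) * (1 / ((m n : ℝ) + 1) ^ 2))) atTop (𝓝 0) := by
  have e1 : Tendsto (fun n : ℕ => ENNReal.ofReal √((n : ℝ) / (m n : ℝ) ^ 3)) atTop (𝓝 0) := by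
    simpa using ENNReal.tendsto_ofReal h₃.sqrt
  refine tendsto_of_tendsto_of_tendsto_of_le_of_le' tendsto_const_nhds e1
    (Eventually.of_forall fun _ => bot_le) ?_
  filter_upwards [hm0] with n hm
  have hm1 : (1 : ℝ) ≤ m n := by exact_mod_cast Nat.one_le_iff_ne_zero.2 hm
  refine ENNReal.ofReal_le_ofReal ?_
  refine Real.le_sqrt_of_sq_le ?_
  rw [mul_pow, Real.sq_sqrt (Nat.cast_nonneg n), one_div, inv_pow, ← pow_mul, div_eq_mul_inv]
  gcongr
  calc (m n : ℝ) ^ 3 ≤ (m n : ℝ) ^ 4 := pow_le_pow_right₀ hm1 (by norm_num)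
    _ ≤ ((m n : ℝ) + 1) ^ (2 * 2) := by gcongr; linarith

theorem tendsto_sqrt_regularization_rate (hm : Tendsto m atTop atTop) :
    Tendsto (fun n : ℕ => ENNReal.ofReal √(1 / ((m n : ℝ) + 1))) atTop (𝓝 0) := by
  have h1 : Tendsto (fun n : ℕ => 1 / ((m n : ℝ) + 1)) atTop (𝓝 0) :=
    tendsto_one_div_add_atTop_nhds_zero_nat.comp hm
  simpa using ENNReal.tendsto_ofReal h1.sqrt

end Rates

/-! ### The smoothing bias averaged over the sample. -/

section SmoothingBias

variable {Ω : Type*} [MeasurableSpace Ω] {P : Measure Ω} {p : ℕ} {Z : ℕ → Ω → Euc p}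
  {f dens φ K : Euc p → ℝ} {h : ℝ}

/-- The square integrability assumed at the random point `Z 0` is a measurable condition on the
point, so it holds almost everywhere for the law of `Z`; weighted Cauchy-Schwarz against `φ` then
applies. -/
theorem ae_integrable_kernel_mul (hZ : Measurable (Z 0)) (hlaw : P.map (Z 0) = densMeasure f)
    (hh : 0 < h) (hK : Measurable K) (hdens : Measurable dens) (hφ : Continuous φ)
    (hφ2 : ∫⁻ y, ‖φ y‖ₑ ^ 2 ∂densMeasure dens ≠ ∞)
    (hKd : ∀ᵐ s ∂P, ∫⁻ y, ENNReal.ofReal (K (h⁻¹ • (y - Z 0 s)) ^ 2) / ENNReal.ofReal (dens y) < ∞) :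
    ∀ᵐ x ∂densMeasure f, Integrable (fun u => K u • φ (x + h • u)) := by
  have hm : Measurable fun x => ∫⁻ y, ENNReal.ofReal (K (h⁻¹ • (y - x)) ^ 2)
      / ENNReal.ofReal (dens y) := by
    refine Measurable.lintegral_prod_right' (f := fun x : Euc p × Euc p =>
      ENNReal.ofReal (K (h⁻¹ • (x.2 - x.1)) ^ 2) / ENNReal.ofReal (dens x.2)) ?_
    fun_prop
  have h1 : ∀ᵐ x ∂densMeasure f, ∫⁻ y, ENNReal.ofReal (K (h⁻¹ • (y - x)) ^ 2)
      / ENNReal.ofReal (dens y) < ∞ := by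
    rw [← hlaw, ae_map_iff hZ.aemeasurable (measurableSet_lt hm measurable_const)]
    exact hKd
  filter_upwards [h1] with x hx
  have h2 : Integrable fun y => φ y * bump ℝ K h x y :=
    integrable_mul_of_weight hdens hφ.aestronglyMeasurable
      (measurable_bump_right hK x).aestronglyMeasurable (lintegral_bump_sq_ne_top hx.ne) hφ2
  have h3 := ((h2.comp_add_left x).comp_smul hh.ne').const_mul (h ^ p)
  refine h3.congr (Eventually.of_forall fun u => ?_)
  have h4 : h⁻¹ • (x + h • u - x) = u := by
    rw [add_sub_cancel_left, smul_smul, inv_mul_cancel₀ hh.ne', one_smul]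
  have h5 : h ^ p ≠ 0 := (pow_pos hh p).ne'
  simp only [bump, h4, RCLike.ofReal_real_eq_id, id_eq, smul_eq_mul]
  field_simp

theorem measurable_smoothBias (hK : Measurable K) (hφ : Continuous φ) :
    Measurable (smoothBias φ K h) := by
  unfold smoothBias
  refine hφ.measurable.sub (StronglyMeasurable.measurable ?_)
  have h1 : Measurable fun x : Euc p × Euc p => K x.2 • φ (x.1 + h • x.2) :=
    (hK.comp measurable_snd).smul (hφ.comp (by fun_prop)).measurable
  exact h1.stronglyMeasurable.integral_prod_right'

theorem lintegral_mean_smoothBias (hZ : ∀ i, Measurable (Z i))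
    (hident : ∀ i, IdentDistrib (Z i) (Z 0) P P)
    (hlaw : P.map (Z 0) = densMeasure f) (hK : Measurable K) (hφ : Continuous φ)
    {n : ℕ} (hn : n ≠ 0) :
    ∫⁻ s, (n : ℝ≥0∞)⁻¹ * ∑ i ∈ Finset.range n, ‖smoothBias φ K h (Z i s)‖ₑ ∂P
      = ∫⁻ x, ‖(∫ u, K u • φ (x + h • u)) - φ x‖ₑ ∂densMeasure f := by
  have hm := (measurable_smoothBias (h := h) hK hφ).enorm
  have hn' : (n : ℝ≥0∞) ≠ 0 := by exact_mod_cast hn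
  have h1 : ∀ i, ∫⁻ s, ‖smoothBias φ K h (Z i s)‖ₑ ∂P
      = ∫⁻ x, ‖smoothBias φ K h x‖ₑ ∂densMeasure f := fun i => by
    rw [← hlaw, ← (hident i).map_eq, lintegral_map hm (hZ i)]
  rw [lintegral_const_mul' _ _ (by finiteness),
    lintegral_finsetSum (f := fun i s => ‖smoothBias φ K h (Z i s)‖ₑ) _
      fun i _ => hm.comp (hZ i)]
  simp_rw [h1]
  rw [Finset.sum_const, Finset.card_range, nsmul_eq_mul, ← mul_assoc,
    ENNReal.inv_mul_cancel hn' (by finiteness), one_mul]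
  refine lintegral_congr fun x => ?_
  rw [smoothBias, ← enorm_neg, neg_sub]

theorem tailMass_eq_lintegral (hZ : Measurable (Z 0)) (hlaw : P.map (Z 0) = densMeasure f)
    (hK : Measurable K) (hdens : Measurable dens) (hh : 0 < h) (r : ℝ) :
    tailMass f dens K h r = ∫⁻ s, (∫⁻ z in {z | r ≤ ‖z - Z 0 s‖},
        ENNReal.ofReal (((h ^ p)⁻¹ * K (h⁻¹ • (z - Z 0 s))) ^ 2)
          / ENNReal.ofReal (dens z)) ∂P := by
  have hm := measurable_tailKernel hK h r
  have hm2 : Measurable fun x => ∫⁻ z, tailKernel K h r x z ^ 2 / ENNReal.ofReal (dens z) :=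
    Measurable.lintegral_prod_right' (f := fun x : Euc p × Euc p =>
      tailKernel K h r x.1 x.2 ^ 2 / ENNReal.ofReal (dens x.2)) (by fun_prop)
  rw [tailMass, ← hlaw, lintegral_map hm2 hZ]
  refine lintegral_congr fun s => ?_
  have hms : MeasurableSet {z | r ≤ ‖z - Z 0 s‖} :=
    measurableSet_le measurable_const (by fun_prop)
  rw [← lintegral_indicator hms]
  refine lintegral_congr fun z => ?_
  by_cases hz : r ≤ ‖z - Z 0 s‖
  · rw [Set.indicator_of_mem (by exact hz), tailKernel, if_pos hz, ← enorm_bump (𝕜 := ℝ) hh,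
      enorm_bump_sq]
  · rw [Set.indicator_of_notMem (by exact hz), tailKernel, if_neg hz]
    simp

end SmoothingBias


/-! ### The scaled estimator error at a fixed sample. -/

section EstimatorError

variable {𝕜 : Type*} [RCLike 𝕜] {p q : ℕ} {w : ℝ → 𝕜} {T : Set (Euc q)} {μ : Measure (Euc q)}
  [IsFiniteMeasure μ] {dens : Euc p → ℝ} {C : ℝ} {K : Euc p → ℝ} {φ : Euc p → ℝ}

theorem sqrt_mul_inv_natCast (n : ℕ) (x : 𝕜) :
    ((√(n : ℝ) : ℝ) : 𝕜) * ((n : 𝕜)⁻¹ * x) = (((√(n : ℝ))⁻¹ : ℝ) : 𝕜) * x := by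
  have h1 : √(n : ℝ) * (n : ℝ)⁻¹ = (√(n : ℝ))⁻¹ := by
    rw [← div_eq_mul_inv, Real.sqrt_div_self', one_div]
  rw [← h1]
  push_cast
  ring

theorem ENNReal.le_sqrt_of_sq_le {x y : ℝ≥0∞} (hxy : x ^ 2 ≤ y) : x ≤ y ^ (1 / 2 : ℝ) := by
  calc x = (x ^ 2) ^ (1 / 2 : ℝ) := by
        rw [← ENNReal.rpow_natCast, ← ENNReal.rpow_mul]; norm_num
    _ ≤ _ := by gcongr

/-- Conversion of a real error bound, scaled by `√n`, to extended nonnegative reals. -/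
theorem ofReal_error_bound {n : ℕ} {c M δ x y : ℝ} {X N B : ℝ≥0∞} (hc : 0 ≤ c) (hM : 0 < M)
    (hδ : 0 ≤ δ) (hx : 0 ≤ x) (hy : 0 ≤ y)
    (hX : X ≤ ENNReal.ofReal √(n : ℝ) *
      ENNReal.ofReal (c * ((M * δ + √(1 / M)) * x + y + 1 / M ^ 2)))
    (hN : ENNReal.ofReal √(n : ℝ) * ENNReal.ofReal x ≤ N) (hB : ENNReal.ofReal y ≤ B) :
    X ≤ ENNReal.ofReal c * ((ENNReal.ofReal M * ENNReal.ofReal δ + ENNReal.ofReal √(1 / M)) * N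
      + ENNReal.ofReal √(n : ℝ) * B + ENNReal.ofReal (√(n : ℝ) * (1 / M ^ 2))) := by
  refine hX.trans ?_
  calc _ = ENNReal.ofReal c * ((ENNReal.ofReal M * ENNReal.ofReal δ
            + ENNReal.ofReal √(1 / M)) * (ENNReal.ofReal √(n : ℝ) * ENNReal.ofReal x)
          + ENNReal.ofReal √(n : ℝ) * ENNReal.ofReal y
          + ENNReal.ofReal (√(n : ℝ) * (1 / M ^ 2))) := by
        rw [ENNReal.ofReal_mul hc, ENNReal.ofReal_add (by positivity) (by positivity),
          ENNReal.ofReal_add (by positivity) (by positivity), ENNReal.ofReal_mul (by positivity),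
          ENNReal.ofReal_add (by positivity) (by positivity), ENNReal.ofReal_mul hM.le,
          ENNReal.ofReal_mul (Real.sqrt_nonneg (n : ℝ))]
        ring
    _ ≤ _ := by gcongr

/-- Error bound of the estimator at a given sample. -/
theorem enorm_estimator_error_le {h : ℝ} {n m : ℕ} {y : ℕ → ℝ} {z : ℕ → Euc p} {v : ℕ → Euc q}
    (A : Lp 𝕜 2 (densMeasure dens) →L[𝕜] Lp 𝕜 2 μ) {Q : ℝ≥0∞}
    (hA : ‖opAZHat w K dens μ h n z v - A‖ₑ ^ 2 ≤ Q)
    (hw : Continuous w) (hμ : ∀ᵐ t ∂μ, t ∈ T) (hdens : IsProbDensity dens)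
    (hv : ∀ i < n, ∀ t ∈ T, ‖w (inner ℝ (v i) t)‖ ≤ C) (hh : 0 < h) (hK : Measurable K)
    (hKd : ∀ i < n, ∫⁻ y, ENNReal.ofReal (K (h⁻¹ • (y - z i)) ^ 2) / ENNReal.ofReal (dens y) ≠ ∞)
    (hφ : MemLp φ 2 (densMeasure dens)) {a c τ : ℝ} (hc : 0 ≤ c) (hτ0 : 0 < τ)
    {ψ χ : Lp 𝕜 2 (densMeasure dens)}
    (hχ : ContinuousLinearMap.adjoint A (A χ) = toL2 (densMeasure dens) fun z => (φ z : 𝕜))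
    (H : ∀ (B : Lp 𝕜 2 (densMeasure dens) →L[𝕜] Lp 𝕜 2 μ) (m : ℕ) (δ : ℝ) (ε b : Lp 𝕜 2 μ),
      ‖B - A‖ ≤ δ → (m + 1) * δ ≤ τ →
      ‖inner 𝕜 (ContinuousLinearMap.adjoint A (A ψ))
          (landweberOp a m B (B (ContinuousLinearMap.adjoint A (A χ)) + ε + b)
            - ContinuousLinearMap.adjoint A (A χ))
          - inner 𝕜 ψ (ContinuousLinearMap.adjoint A ε)‖
        ≤ c * (((m + 1) * δ + √(1 / (m + 1))) * ‖ε‖ + ‖b‖ + 1 / ((m : ℝ) + 1) ^ 2))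
    (hτ : ENNReal.ofReal ((m : ℝ) + 1) * Q ^ (1 / 2 : ℝ) ≤ ENNReal.ofReal τ) :
    ‖((√(n : ℝ) : ℝ) : 𝕜) * inner 𝕜 (ContinuousLinearMap.adjoint A (A ψ))
          (phiHat w K dens μ a m h n y z v - toL2 (densMeasure dens) fun z => (φ z : 𝕜))
        - (((√(n : ℝ))⁻¹ : ℝ) : 𝕜) * ∑ i ∈ Finset.range n, ((y i - φ (z i) : ℝ) : 𝕜) *
            inner 𝕜 ψ (ContinuousLinearMap.adjoint A (toL2 μ fun t => w (inner ℝ (v i) t)))‖ₑ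
      ≤ ENNReal.ofReal c * ((ENNReal.ofReal ((m : ℝ) + 1) * Q ^ (1 / 2 : ℝ)
            + ENNReal.ofReal √(1 / ((m : ℝ) + 1)))
          * ((n : ℝ≥0∞) * ∫⁻ t, ‖(n : 𝕜)⁻¹ * ∑ i ∈ Finset.range n,
              ((y i - φ (z i) : ℝ) : 𝕜) * w (inner ℝ (v i) t)‖ₑ ^ 2 ∂μ) ^ (1 / 2 : ℝ)
        + ENNReal.ofReal √(n : ℝ) * (μ Set.univ ^ (1 / 2 : ℝ) * ENNReal.ofReal C *
            ((n : ℝ≥0∞)⁻¹ * ∑ i ∈ Finset.range n, ‖smoothBias φ K h (z i)‖ₑ))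
        + ENNReal.ofReal (√(n : ℝ) * (1 / ((m : ℝ) + 1) ^ 2))) := by
  have hM : 0 < (m : ℝ) + 1 := by positivity
  have hM' : ENNReal.ofReal ((m : ℝ) + 1) ≠ 0 := by simpa using hM
  -- The threshold condition makes the Hilbert-Schmidt distance finite, so it can serve as the real
  -- number `δ` of the deterministic bound.
  have hQtop : Q ^ (1 / 2 : ℝ) ≠ ∞ := fun hcon => by
    rw [hcon, ENNReal.mul_top hM'] at hτ
    exact absurd (top_le_iff.1 hτ) ENNReal.ofReal_ne_top
  obtain ⟨δ, hδ0, hQδ⟩ : ∃ δ : ℝ, 0 ≤ δ ∧ Q ^ (1 / 2 : ℝ) = ENNReal.ofReal δ :=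
    ⟨_, ENNReal.toReal_nonneg, (ENNReal.ofReal_toReal hQtop).symm⟩
  rw [hQδ] at hτ ⊢
  have hBA : ‖opAZHat w K dens μ h n z v - A‖ ≤ δ := by
    have h1 := ENNReal.le_sqrt_of_sq_le hA
    rw [hQδ, ← ofReal_norm] at h1
    exact (ENNReal.ofReal_le_ofReal_iff hδ0).1 h1
  have hMδ : ((m : ℝ) + 1) * δ ≤ τ := by
    rw [← ENNReal.ofReal_mul hM.le] at hτ
    exact (ENNReal.ofReal_le_ofReal_iff hτ0.le).1 hτ
  have h2 := H _ m δ (∑ i ∈ Finset.range n, ((n : 𝕜)⁻¹ * ((y i - φ (z i) : ℝ) : 𝕜)) •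
            toL2 μ fun t => w (inner ℝ (v i) t))
    (∑ i ∈ Finset.range n, ((n : 𝕜)⁻¹ * (smoothBias φ K h (z i) : 𝕜)) •
            toL2 μ fun t => w (inner ℝ (v i) t)) hBA hMδ
  rw [hχ, ← toL2_sHat_eq hw hμ hv hh hK hdens hKd hφ, ← landweber_eq_landweberOp] at h2
  have h4 : (((√(n : ℝ))⁻¹ : ℝ) : 𝕜) * ∑ i ∈ Finset.range n, ((y i - φ (z i) : ℝ) : 𝕜) *
            inner 𝕜 ψ (ContinuousLinearMap.adjoint A (toL2 μ fun t => w (inner ℝ (v i) t)))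
      = ((√(n : ℝ) : ℝ) : 𝕜) * inner 𝕜 ψ (ContinuousLinearMap.adjoint A
          (∑ i ∈ Finset.range n, ((n : 𝕜)⁻¹ * ((y i - φ (z i) : ℝ) : 𝕜)) •
            toL2 μ fun t => w (inner ℝ (v i) t))) := by
    rw [map_sum, inner_sum, Finset.mul_sum, Finset.mul_sum]
    refine Finset.sum_congr rfl fun i _ => ?_
    rw [map_smul, inner_smul_right, mul_assoc, sqrt_mul_inv_natCast]
  rw [h4, ← mul_sub, enorm_mul]
  have h5 : ‖((√(n : ℝ) : ℝ) : 𝕜)‖ₑ = ENNReal.ofReal √(n : ℝ) := by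
    rw [← ofReal_norm, RCLike.norm_ofReal, abs_of_nonneg (Real.sqrt_nonneg _)]
  rw [h5, ← ofReal_norm]
  refine ofReal_error_bound hc hM hδ0 (norm_nonneg _) (norm_nonneg _)
    (by gcongr; exact h2) ?_ ?_
  · refine ENNReal.le_sqrt_of_sq_le (le_of_eq ?_)
    rw [mul_pow, ← ENNReal.ofReal_pow (Real.sqrt_nonneg _), Real.sq_sqrt (Nat.cast_nonneg n),
      ENNReal.ofReal_natCast, ofReal_norm, enorm_sum_weight_sq hw hμ hv fun i => y i - φ (z i)]
  · rw [ofReal_norm]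
    exact enorm_sum_weight_le hw hμ hv fun i => smoothBias φ K h (z i)

end EstimatorError


/-! ### Almost sure properties of the whole sample. -/

section Sample

variable {𝕜 : Type*} [RCLike 𝕜] {Ω : Type*} [MeasurableSpace Ω] {P : Measure Ω}
  [IsProbabilityMeasure P] {p q : ℕ} {Z : ℕ → Ω → Euc p} {W : ℕ → Ω → Euc q} {w : ℝ → 𝕜}
  {T : Set (Euc q)} {μ : Measure (Euc q)} [IsFiniteMeasure μ] {f dens : Euc p → ℝ} {C h : ℝ}
  {n : ℕ} {K φ : Euc p → ℝ}

theorem ae_all_norm_weight_le (hW : ∀ i, Measurable (W i))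
    (hident : ∀ i, IdentDistrib (W i) (W 0) P P) (hw : Continuous w)
    (hC : ∀ᵐ s ∂P, ∀ t ∈ T, ‖w (inner ℝ (W 0 s) t)‖ ≤ C) :
    ∀ᵐ s ∂P, ∀ i, ∀ t ∈ T, ‖w (inner ℝ (W i s) t)‖ ≤ C := by
  refine ae_all_iff.2 fun i => ?_
  have hm := (isClosed_bounded_weight hw T C).measurableSet
  have h1 : ∀ᵐ v ∂P.map (W i), ∀ t ∈ T, ‖w (inner ℝ v t)‖ ≤ C := by
    rw [(hident i).map_eq, ae_map_iff (hW 0).aemeasurable hm]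
    exact hC
  rwa [ae_map_iff (hW i).aemeasurable hm] at h1

theorem measurable_kernelDist (hZ : ∀ i, Measurable (Z i)) (hW : ∀ i, Measurable (W i))
    (hw : Continuous w) (hK : Measurable K) (hdens : Measurable dens)
    {κ : Euc p → Euc q → 𝕜} (hκ : Measurable fun x : Euc p × Euc q => κ x.1 x.2) :
    Measurable fun s => kernelDist dens μ (kHat w K h n (fun i => Z i s) (fun i => W i s)) κ := by
  unfold kernelDist
  refine Measurable.lintegral_prod_right' (f := fun x : Ω × Euc q =>
    ∫⁻ y, ‖kHat w K h n (fun i => Z i x.1) (fun i => W i x.1) y x.2 - κ y x.2‖ₑ ^ 2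
      / ENNReal.ofReal (dens y)) ?_
  have h1 : Measurable fun x : (Ω × Euc q) × Euc p => (x.1.1, x.1.2, x.2) := by fun_prop
  have h2 : Measurable fun x : (Ω × Euc q) × Euc p => (x.2, x.1.2) := by fun_prop
  have h3 := (measurable_kHat_joint (n := n) (h := h) hZ hW hw hK).comp h1
  have h4 := hκ.comp h2
  have h5 := ((h3.sub h4).enorm.pow_const 2).div (hdens.ennreal_ofReal.comp measurable_snd)
  exact Measurable.lintegral_prod_right' h5

theorem HolderClass.exists_taylorAt_of_zero {υ : ℝ} (hυ : 1 < υ) (h : HolderClass υ 0 dens φ) :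
    Continuous φ ∧ ∃ R : ℝ, 0 < R ∧ ∃ η : ℝ, 0 ≤ η ∧ ∀ x, TaylorAt ⌈υ⌉₊ υ R η φ x := by
  obtain ⟨R, hR, c, hB⟩ := h
  obtain ⟨η, -, -, hT, hη, -⟩ := hB.exists_taylorAt
  refine ⟨hB.continuous hυ, R, hR, c, c.2, fun x y hy => (hT x y hy).trans ?_⟩
  gcongr
  exact hη rfl x

end Sample

/-! ### Assembly for a measurable kernel. -/

section Limit

variable {𝕜 : Type*} [RCLike 𝕜] {Ω : Type*} [MeasurableSpace Ω]

/-- Combines the deterministic bound at each sample with the three moment bounds. The functional is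
already written as `A*Aψ` and `φ` as `A*Aχ`, so only the rates and the moments remain to be checked.
-/
theorem tendstoInMeasure_estimator_error
    (P : Measure Ω) [IsProbabilityMeasure P] {p q : ℕ}
    (Y : ℕ → Ω → ℝ) (Z : ℕ → Ω → Euc p) (W : ℕ → Ω → Euc q)
    (hY : ∀ i, Measurable (Y i)) (hZ : ∀ i, Measurable (Z i)) (hW : ∀ i, Measurable (W i))
    (hindep : iIndepFun (fun i s => (Y i s, Z i s, W i s)) P)
    (hident : ∀ i, IdentDistrib (fun s => (Y i s, Z i s, W i s))
      (fun s => (Y 0 s, Z 0 s, W 0 s)) P P)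
    (hY2 : MemLp (Y 0) 2 P) {w : ℝ → 𝕜} (hw : Continuous w) {T : Set (Euc q)} {C : ℝ}
    (hC0 : 0 ≤ C) (hC : ∀ᵐ s ∂P, ∀ t ∈ T, ‖w (inner ℝ (W 0 s) t)‖ ≤ C)
    (μ : Measure (Euc q)) [IsFiniteMeasure μ] (hμ : ∀ᵐ t ∂μ, t ∈ T)
    {dens : Euc p → ℝ} (hdens : IsProbDensity dens) {f : Euc p → ℝ} (hf : IsProbDensity f)
    (hlaw : P.map (Z 0) = densMeasure f)
    {φ : Euc p → ℝ} (hφ : MemLp φ 2 (densMeasure dens))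
    (hU_int : Integrable (fun s => Y 0 s - φ (Z 0 s)) P)
    (hU : P[fun s => Y 0 s - φ (Z 0 s) | MeasurableSpace.comap (W 0) inferInstance] =ᵐ[P] 0)
    {ρ : ℕ} (hρ : 1 ≤ ρ) (hf_2 : HolderClass 1 2 dens f) (hf_1 : HolderClass 1 1 dens f)
    {υ : ℝ} (hυ : (ρ : ℝ) < υ) (hφ_B : HolderClass υ 0 dens φ)
    {υ' : ℝ} (hυ' : (ρ : ℝ) < υ') {k : Euc p → Euc q → 𝕜}
    (hk : ∀ t ∈ T, (fun z => k z t) =ᵐ[volume] fun z => condKernel P (Z 0) (W 0) w f z t)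
    (hk_B : UniformHolderClass υ' 2 dens T (fun t z => k z t))
    {K : Euc p → ℝ} (hKm : Measurable K) (hK : MomentKernel ρ K)
    (hK2 : Integrable (fun u => K u ^ 2) volume)
    {h : ℕ → ℝ} (hh : ∀ n, 0 < h n) {m : ℕ → ℕ}
    (hK_dens : ∀ᶠ n in atTop, ∀ i < n, ∀ᵐ s ∂P,
      ∫⁻ z, ENNReal.ofReal (K ((h n)⁻¹ • (z - Z i s)) ^ 2) / ENNReal.ofReal (dens z) < ∞)
    (hK_tail : ∀ r : ℝ, 0 < r → ∃ c : ℝ≥0, ∀ᶠ n in atTop,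
      tailMass f dens K (h n) r ≤ c * ENNReal.ofReal (h n ^ (2 * ρ)))
    (hrate₁ : Tendsto (fun (n : ℕ) => (m n : ℝ) * h n ^ ρ) atTop (𝓝 0))
    (hrate₂ : Tendsto (fun (n : ℕ) => (n : ℝ) * h n ^ p / (m n : ℝ) ^ 2) atTop atTop)
    (hrate₃ : Tendsto (fun (n : ℕ) => (n : ℝ) / (m n : ℝ) ^ 3) atTop (𝓝 0))
    (hrate₄ : Tendsto (fun (n : ℕ) => (n : ℝ) * h n ^ (2 * ρ)) atTop (𝓝 0))
    {a : ℝ} (ha : 0 < a) (ha' : a * ‖opAZ P (Z 0) (W 0) w dens μ‖ ^ 2 < 1)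
    {χ ψ : Lp 𝕜 2 (densMeasure dens)}
    (hχ : ContinuousLinearMap.adjoint (opAZ P (Z 0) (W 0) w dens μ)
      (opAZ P (Z 0) (W 0) w dens μ χ) = toL2 (densMeasure dens) fun z => (φ z : 𝕜)) :
    TendstoInMeasure P
      (fun (n : ℕ) s =>
        ((√(n : ℝ) : ℝ) : 𝕜) * inner 𝕜
          (ContinuousLinearMap.adjoint (opAZ P (Z 0) (W 0) w dens μ)
            (opAZ P (Z 0) (W 0) w dens μ ψ))
          (phiHat w K dens μ a (m n) (h n) n (fun i => Y i s) (fun i => Z i s) (fun i => W i s)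
            - toL2 (densMeasure dens) fun z => (φ z : 𝕜))
        - (((√(n : ℝ))⁻¹ : ℝ) : 𝕜) * ∑ i ∈ Finset.range n,
            ((Y i s - φ (Z i s) : ℝ) : 𝕜) *
              inner 𝕜 ψ (ContinuousLinearMap.adjoint (opAZ P (Z 0) (W 0) w dens μ)
                (toL2 μ fun t => w (inner ℝ (W i s) t))))
      atTop (fun _ => 0) := by
  have hυ1 : 1 < υ := lt_of_le_of_lt (by exact_mod_cast hρ) hυ
  obtain ⟨hφc, Rφ, hRφ, ηφ, hηφ, hTφ⟩ := HolderClass.exists_taylorAt_of_zero hυ1 hφ_B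
  have hf_1' : HolderClass 1 ((1 : ℕ) : ℝ) dens f := by simpa using hf_1
  have hf_2' : HolderClass 1 ((2 : ℕ) : ℝ) dens f := by simpa using hf_2
  obtain ⟨R₁, hR₁, G₁, hG₁⟩ := HolderClass.exists_envelope one_pos hf.1 hdens.1 hf_1'
  obtain ⟨R₂, hR₂, G₂, hG₂⟩ := HolderClass.exists_envelope two_pos hf.1 hdens.1 hf_2'
  have hf2 : ∫⁻ z, ENNReal.ofReal (f z) ^ 2 / ENNReal.ofReal (dens z) ≠ ∞ := by
    refine ne_top_of_le_ne_top hG₂.lintegral_ne_top (lintegral_mono fun z => ?_)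
    gcongr
    exact hG₂.le z z (by simpa using hR₂)
  have hφ2 : ∫⁻ y, ‖φ y‖ₑ ^ 2 ∂densMeasure dens ≠ ∞ := lintegral_enorm_sq_ne_top hφ
  have hφ2' : ∫⁻ y, ‖φ y‖ₑ ^ 2 * ENNReal.ofReal (dens y) ≠ ∞ := by
    rwa [IsProbDensity.lintegral_enorm_sq_mul hdens.1]
  -- the laws of the subvectors
  have hZW : Measurable fun x : ℝ × Euc p × Euc q => (x.2.1, x.2.2) := by fun_prop
  have hUW : Measurable fun x : ℝ × Euc p × Euc q => (x.1 - φ x.2.1, x.2.2) := by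
    have := hφc.measurable
    fun_prop
  have hpairZ : ∀ i j, i ≠ j → IndepFun (fun s => (Z i s, W i s)) (fun s => (Z j s, W j s)) P :=
    fun i j hij => (hindep.indepFun hij).comp hZW hZW
  have hpairU : ∀ i j, i ≠ j → IndepFun (fun s => (Y i s - φ (Z i s), W i s))
      (fun s => (Y j s - φ (Z j s), W j s)) P :=
    fun i j hij => (hindep.indepFun hij).comp hUW hUW
  have hidentZ : ∀ i, IdentDistrib (fun s => (Z i s, W i s)) (fun s => (Z 0 s, W 0 s)) P P :=
    fun i => (hident i).comp hZW
  have hidentU : ∀ i, IdentDistrib (fun s => (Y i s - φ (Z i s), W i s))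
      (fun s => (Y 0 s - φ (Z 0 s), W 0 s)) P P := fun i => (hident i).comp hUW
  have hUm : ∀ i, Measurable fun s => Y i s - φ (Z i s) :=
    fun i => (hY i).sub (hφc.measurable.comp (hZ i))
  have hall := ae_all_norm_weight_le hW (fun i => (hidentZ i).comp measurable_snd) hw hC
  -- second moment of the residual
  have hU2 : ∫⁻ s, ‖Y 0 s - φ (Z 0 s)‖ₑ ^ 2 ∂P ≠ ∞ := by
    refine lintegral_enorm_sq_ne_top (hY2.sub ?_)
    refine memLp_two_of_lintegral (hφc.measurable.comp (hZ 0)).aestronglyMeasurable ?_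
    have h1 := lintegral_sq_mul_density_ne_top hf.1 hdens.1 hR₁ hG₁ (by rw [hf.2.2]; finiteness)
      (Nat.one_le_ceil_iff.2 (by linarith)) (by linarith) hRφ hηφ hφc hTφ hφ2'
    rw [IsProbDensity.lintegral_enorm_sq_mul hf.1, ← hlaw,
      lintegral_map (hφc.measurable.enorm.pow_const 2) (hZ 0)] at h1
    exact h1
  obtain ⟨c₁, r₁, hr₁, r₂, hr₂, hMSE⟩ := exists_lintegral_kernelDist_le (μ := μ) hZ hW hpairZ
    hidentZ hw hC0 hC hμ hf hlaw hdens hf_2 hf_1 hρ hυ' hk hk_B hKm hK hK2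
  obtain ⟨c₂, r₃, hr₃, hbias⟩ := exists_lintegral_smoothing_bias_le hρ hKm hK hf hdens.1 hR₂ hG₂
    hυ hRφ hηφ hφc hTφ hφ2'
  obtain ⟨t₁, ht₁⟩ := hK_tail r₁ hr₁
  obtain ⟨t₂, ht₂⟩ := hK_tail r₂ hr₂
  obtain ⟨t₃, ht₃⟩ := hK_tail r₃ hr₃
  obtain ⟨hm0, hm⟩ := tendsto_regularization_atTop hrate₂ hrate₃
  obtain ⟨c, hc, τ, hτ0, H⟩ := exists_norm_landweberOp_error_le ha _ ha' ψ χ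
  have hCw : μ Set.univ ^ (1 / 2 : ℝ) * ENNReal.ofReal C ≠ ∞ := by finiteness
  have hsq : ∀ x : ℝ≥0∞, (x ^ (1 / 2 : ℝ)) ^ 2 = x := fun x => by
    rw [← ENNReal.rpow_natCast, ← ENNReal.rpow_mul]; norm_num
  have hcκ : Measurable fun x : Euc p × Euc q => condKernel P (Z 0) (W 0) w f x.1 x.2 :=
    (stronglyMeasurable_condKernel hw hf.1).measurable
  have hKdist := fun n => measurable_kernelDist (μ := μ) (n := n) (h := h n) hZ hW hw hKm hdens.1 hcκ
  -- `D` is `m + 1` times the Hilbert-Schmidt distance, `N` is `√n‖ε‖`, and `B` bounds `√n‖b‖`. Each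
  -- is given by an integral or a sum, which makes its measurability in the sample accessible; the
  -- operators themselves are never treated as random elements.
  refine tendstoInMeasure_of_product_bound
    (D := fun n s => ENNReal.ofReal ((m n : ℝ) + 1) * kernelDist dens μ
      (kHat w K (h n) n (fun i => Z i s) (fun i => W i s))
        (condKernel P (Z 0) (W 0) w f) ^ (1 / 2 : ℝ))
    (N := fun n s => ((n : ℝ≥0∞) *
      noiseNormSq w μ (fun i s => Y i s - φ (Z i s)) W n s) ^ (1 / 2 : ℝ))
    (B := fun n s => ENNReal.ofReal √(n : ℝ) * (μ Set.univ ^ (1 / 2 : ℝ) * ENNReal.ofReal C *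
      ((n : ℝ≥0∞)⁻¹ * ∑ i ∈ Finset.range n, ‖smoothBias φ K (h n) (Z i s)‖ₑ)))
    (d := fun n => ENNReal.ofReal √(1 / ((m n : ℝ) + 1)))
    (e := fun n => ENNReal.ofReal (√(n : ℝ) * (1 / ((m n : ℝ) + 1) ^ 2)))
    (c := c.toNNReal) (τ := ENNReal.ofReal τ)
    (M := (8 * (ENNReal.ofReal C ^ 2 * ∫⁻ s, ‖Y 0 s - φ (Z 0 s)‖ₑ ^ 2 ∂P) * μ Set.univ).toNNReal)
    (fun n => ((hKdist n).pow_const _).const_mul _ |>.aemeasurable)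
    (fun n => (((measurable_noiseNormSq hUm hW hw n).const_mul _).pow_const _).aemeasurable)
    (fun n => ?_) (by simpa using hτ0) ENNReal.ofReal_ne_top ?_ (fun n => ?_) ?_
    (tendsto_sqrt_regularization_rate hm) (tendsto_regularization_bias_rate hrate₃ hm0) ?_
  · have hm1 : Measurable fun s => ∑ i ∈ Finset.range n, ‖smoothBias φ K (h n) (Z i s)‖ₑ :=
      Finset.measurable_fun_sum _ fun i _ =>
        ((measurable_smoothBias (h := h n) hKm hφc).comp (hZ i)).enorm
    exact (((hm1.const_mul _).const_mul _).const_mul _).aemeasurable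
  · refine tendsto_of_tendsto_of_tendsto_of_le_of_le' tendsto_const_nhds
      (tendsto_operator_rate hh hrate₁ hrate₂ hm0 c₁ ht₁ ht₂)
      (Eventually.of_forall fun _ => bot_le) ?_
    filter_upwards [eventually_gt_atTop 0] with n hn
    simp_rw [mul_pow, hsq]
    rw [lintegral_const_mul' _ _ (by finiteness)]
    gcongr
    exact hMSE n hn.ne' (h n) (hh n)
  · simp_rw [hsq]
    rw [ENNReal.coe_toNNReal (by finiteness), lintegral_const_mul' _ _ (by finiteness)]
    rcases Nat.eq_zero_or_pos n with rfl | hn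
    · simp
    have hn' : (n : ℝ≥0∞) ≠ 0 := by exact_mod_cast hn.ne'
    refine (mul_le_mul_right (lintegral_noiseNormSq_le hUm hW hpairU hidentU hw hC hμ hU_int hU
      hn.ne') _).trans (le_of_eq ?_)
    calc _ = ((n : ℝ≥0∞) * (n : ℝ≥0∞)⁻¹) *
          (8 * (ENNReal.ofReal C ^ 2 * ∫⁻ s, ‖Y 0 s - φ (Z 0 s)‖ₑ ^ 2 ∂P) * μ Set.univ) := by ring
      _ = _ := by rw [ENNReal.mul_inv_cancel hn' (by finiteness), one_mul]
  · have h1 := ENNReal.Tendsto.const_mul (tendsto_bias_rate hh hrate₄ c₂ ht₃)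
      (a := μ Set.univ ^ (1 / 2 : ℝ) * ENNReal.ofReal C) (Or.inr hCw)
    rw [mul_zero] at h1
    refine tendsto_of_tendsto_of_tendsto_of_le_of_le' tendsto_const_nhds h1
      (Eventually.of_forall fun _ => bot_le) ?_
    filter_upwards [hK_dens, eventually_gt_atTop 0] with n hKd hn
    rw [lintegral_const_mul' _ _ (by finiteness), lintegral_const_mul' _ _ hCw,
      lintegral_mean_smoothBias hZ (fun i => (hidentZ i).comp measurable_fst) hlaw hKm hφc hn.ne',
      mul_left_comm]
    gcongr
    exact hbias (h n) (hh n) (ae_integrable_kernel_mul (hZ 0) hlaw (hh n) hKm hdens.1 hφc hφ2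
      (hKd 0 hn))
  · filter_upwards [hK_dens] with n hKd
    have hKd' : ∀ᵐ s ∂P, ∀ i < n, ∫⁻ z, ENNReal.ofReal (K ((h n)⁻¹ • (z - Z i s)) ^ 2)
        / ENNReal.ofReal (dens z) ≠ ∞ := by
      refine ae_all_iff.2 fun i => ?_
      by_cases hi : i < n
      · filter_upwards [hKd i hi] with s hs _ using hs.ne
      · exact Eventually.of_forall fun s hi' => absurd hi' hi
    filter_upwards [hall, hKd'] with s hs hKs hDs
    have hdist := enorm_opAZHat_sub_sq_le (n := n) (h := h n) (z := fun i => Z i s)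
      (v := fun i => W i s) (hZ 0) (hW 0) hw hC0 hC hμ hf hlaw hdens hf2 (fun i _ => hs i) hKm hKs
    exact enorm_estimator_error_le _ hdist hw hμ hdens (fun i _ => hs i) (hh n) hKm hKs hφ hc hτ0
      hχ H hDs

end Limit

end NPIV

/-! ### The asymptotic expansion. -/

theorem mainTheorem3 {𝕜 : Type*} [RCLike 𝕜] {Ω : Type*} [MeasurableSpace Ω]
    (P : Measure Ω) [IsProbabilityMeasure P] {p q : ℕ}
    -- the sample
    (Y : ℕ → Ω → ℝ) (Z : ℕ → Ω → NPIV.Euc p) (W : ℕ → Ω → NPIV.Euc q)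
    (hY : ∀ i, Measurable (Y i)) (hZ : ∀ i, Measurable (Z i)) (hW : ∀ i, Measurable (W i))
    (hindep : iIndepFun (fun i s => (Y i s, Z i s, W i s)) P)
    (hident : ∀ i, IdentDistrib (fun s => (Y i s, Z i s, W i s))
      (fun s => (Y 0 s, Z 0 s, W 0 s)) P P)
    (hY2 : MemLp (Y 0) 2 P)
    (hWbdd : ∃ M : ℝ, ∀ᵐ s ∂P, ‖W 0 s‖ ≤ M)
    -- the weight function, the index set and the measure on it
    (w : ℝ → 𝕜) (hw_an : AnalyticOnNhd ℝ w Set.univ)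
    (hw_poly : ¬ ∃ Q : Polynomial 𝕜, ∀ x : ℝ, w x = Q.eval (x : 𝕜))
    (hw_deriv : ∀ l : ℕ, iteratedDeriv l w 0 ≠ 0)
    (T : Set (NPIV.Euc q)) (hT : T ∈ 𝓝 (0 : NPIV.Euc q))
    (hw_bdd : ∃ C : ℝ, ∀ᵐ s ∂P, ∀ t ∈ T, ‖w (inner ℝ (W 0 s) t)‖ ≤ C)
    (μ : Measure (NPIV.Euc q)) [IsFiniteMeasure μ] (hμ : ∀ᵐ t ∂μ, t ∈ T)
    -- the densities of the reference measure and of `Z`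
    (dens : NPIV.Euc p → ℝ) (hdens : NPIV.IsProbDensity dens)
    (hdens_pos : ∀ z ∈ (P.map (Z 0)).support, 0 < dens z)
    (fZ : NPIV.Euc p → ℝ) (hfZ : NPIV.IsProbDensity fZ)
    (hZ_law : P.map (Z 0) = NPIV.densMeasure fZ)
    -- the model
    (φ₀ : NPIV.Euc p → ℝ) (hφ₀ : MemLp φ₀ 2 (NPIV.densMeasure dens))
    (hU_int : Integrable (fun s => Y 0 s - φ₀ (Z 0 s)) P)
    (hU : P[fun s => Y 0 s - φ₀ (Z 0 s) | MeasurableSpace.comap (W 0) inferInstance] =ᵐ[P] 0)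
    -- identification
    (hinj : Function.Injective (NPIV.opAZ P (Z 0) (W 0) w dens μ))
    -- smoothness and integrability
    (ρ : ℕ) (hρ : 1 ≤ ρ)
    (hfZ_2 : NPIV.HolderClass 1 2 dens fZ) (hfZ_1 : NPIV.HolderClass 1 1 dens fZ)
    (υ : ℝ) (hυ : (ρ : ℝ) < υ) (hφ₀_B : NPIV.HolderClass υ 0 dens φ₀)
    (υ' : ℝ) (hυ' : (ρ : ℝ) < υ')
    (k : NPIV.Euc p → NPIV.Euc q → 𝕜)
    (hk : ∀ t ∈ T, (fun z => k z t) =ᵐ[volume]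
      fun z => NPIV.condKernel P (Z 0) (W 0) w fZ z t)
    (hk_B : NPIV.UniformHolderClass υ' 2 dens T (fun t z => k z t))
    -- the kernel, the bandwidth and the regularization parameter
    (K : NPIV.Euc p → ℝ) (hK : NPIV.IsKernelOfOrder ρ K)
    (hK_sq : Integrable (fun u => K u ^ 2) volume)
    (hK_sq' : Integrable (fun u => K u ^ 2 * ‖u‖) volume)
    (h : ℕ → ℝ) (hh : ∀ n, 0 < h n) (m : ℕ → ℕ)
    (hK_dens : ∀ᶠ n in atTop, ∀ i < n, ∀ᵐ s ∂P,
      ∫⁻ z, ENNReal.ofReal (K ((h n)⁻¹ • (z - Z i s)) ^ 2) / ENNReal.ofReal (dens z) < ∞)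
    (hK_tail : ∀ r : ℝ, 0 < r → ∃ C : ℝ≥0, ∀ᶠ n in atTop,
      ∫⁻ s, (∫⁻ z in {z | r ≤ ‖z - Z 0 s‖},
        ENNReal.ofReal (((h n ^ p)⁻¹ * K ((h n)⁻¹ • (z - Z 0 s))) ^ 2)
          / ENNReal.ofReal (dens z)) ∂P ≤ C * ENNReal.ofReal (h n ^ (2 * ρ)))
    (hrate₁ : Tendsto (fun (n : ℕ) => (m n : ℝ) * h n ^ ρ) atTop (𝓝 0))
    (hrate₂ : Tendsto (fun (n : ℕ) => (n : ℝ) * h n ^ p / (m n : ℝ) ^ 2) atTop atTop)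
    (hrate₃ : Tendsto (fun (n : ℕ) => (n : ℝ) / (m n : ℝ) ^ 3) atTop (𝓝 0))
    (hrate₄ : Tendsto (fun (n : ℕ) => (n : ℝ) * h n ^ (2 * ρ)) atTop (𝓝 0))
    (a : ℝ) (ha : 0 < a) (ha' : a * ‖NPIV.opAZ P (Z 0) (W 0) w dens μ‖ ^ 2 < 1)
    -- source conditions
    {J : Type*} (lam : J → ℝ) (e : J → Lp 𝕜 2 (NPIV.densMeasure dens)) (f : J → Lp 𝕜 2 μ)
    (hsvd : NPIV.IsSingularSystem (NPIV.opAZ P (Z 0) (W 0) w dens μ) lam e f)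
    (ι : ℝ) (hι : 2 ≤ ι)
    (hsource : Summable fun j =>
      ‖inner 𝕜 (e j) (NPIV.toL2 (NPIV.densMeasure dens) fun z => (φ₀ z : 𝕜))‖ ^ 2
        / lam j ^ (2 * ι))
    (g : Lp 𝕜 2 (NPIV.densMeasure dens)) (γ : ℝ) (hγ : 2 ≤ γ)
    (hg : Summable fun j => ‖inner 𝕜 (e j) g‖ ^ 2 / lam j ^ (2 * γ)) :
    -- `ψ` is `(A_Z* A_Z)⁻¹ g`
    ∃ ψ : Lp 𝕜 2 (NPIV.densMeasure dens),
      (∀ ψ' : Lp 𝕜 2 (NPIV.densMeasure dens),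
        ContinuousLinearMap.adjoint (NPIV.opAZ P (Z 0) (W 0) w dens μ)
          (NPIV.opAZ P (Z 0) (W 0) w dens μ ψ') = g ↔ ψ' = ψ) ∧
      TendstoInMeasure P
        (fun (n : ℕ) s =>
          ((√(n : ℝ) : ℝ) : 𝕜) * inner 𝕜 g
            (NPIV.phiHat w K dens μ a (m n) (h n) n
                (fun i => Y i s) (fun i => Z i s) (fun i => W i s)
              - NPIV.toL2 (NPIV.densMeasure dens) fun z => (φ₀ z : 𝕜))
          - (((√(n : ℝ))⁻¹ : ℝ) : 𝕜) * ∑ i ∈ Finset.range n,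
              ((Y i s - φ₀ (Z i s) : ℝ) : 𝕜) *
                inner 𝕜 ψ (ContinuousLinearMap.adjoint (NPIV.opAZ P (Z 0) (W 0) w dens μ)
                  (NPIV.toL2 μ fun t => w (inner ℝ (W i s) t))))
        atTop (fun _ => 0) := by
  have hwc : Continuous w := continuousOn_univ.1 hw_an.continuousOn
  obtain ⟨C₀, hC₀⟩ := hw_bdd
  -- The constant is raised to be nonnegative, as the bounds `C f` require; the given one may be
  -- negative if `T` imposes no constraint through `w`.
  have hC : ∀ᵐ s ∂P, ∀ t ∈ T, ‖w (inner ℝ (W 0 s) t)‖ ≤ max C₀ 0 := by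
    filter_upwards [hC₀] with s hs t ht using (hs t ht).trans (le_max_left _ _)
  obtain ⟨χ, hχ⟩ := hsvd.exists_normal_eq hinj hι _ hsource
  obtain ⟨ψ, hψ⟩ := hsvd.exists_normal_eq hinj hγ _ hg
  refine ⟨ψ, fun ψ' => ⟨fun hψ' => NPIV.normal_injective hinj (hψ'.trans hψ.symm),
    fun hψ' => hψ' ▸ hψ⟩, ?_⟩
  -- Integrability gives only almost everywhere strong measurability of `K`. A measurable version
  -- leaves the estimated operator, and hence the estimator, unchanged, because `K` enters only
  -- through integrals in `z`; the two conditions on `K` with weight `1/dens` transfer likewise.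
  obtain ⟨K', hK'm, hKK'⟩ := hK.2.1.aestronglyMeasurable
  have hscale : ∀ n (x : NPIV.Euc p), ∀ᵐ z, K ((h n)⁻¹ • (z - x)) = K' ((h n)⁻¹ • (z - x)) :=
    fun n x => NPIV.ae_comp_scale_sub (hh n) hKK' x
  have hlim := NPIV.tendstoInMeasure_estimator_error P Y Z W hY hZ hW hindep hident hY2 hwc
    (le_max_right _ _) hC μ hμ hdens hfZ hZ_law hφ₀ hU_int hU hρ hfZ_2 hfZ_1 hυ hφ₀_B hυ' hk hk_B
    hK'm.measurable (hK.momentKernel hKK')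
    (hK_sq.congr (by filter_upwards [hKK'] with u hu; rw [hu])) hh (m := m) ?_ ?_
    hrate₁ hrate₂ hrate₃ hrate₄ ha ha' hχ (ψ := ψ)
  · rw [hψ] at hlim
    have hphi : ∀ n y z v, NPIV.phiHat w K dens μ a (m n) (h n) n y z v
        = NPIV.phiHat w K' dens μ a (m n) (h n) n y z v := fun n y z v => by
      rw [NPIV.phiHat, NPIV.phiHat, NPIV.opAZHat_congr_kernel (hh n) hKK']
    simp_rw [hphi]
    exact hlim
  · filter_upwards [hK_dens] with n hn i hi
    filter_upwards [hn i hi] with s hs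
    refine lt_of_eq_of_lt (lintegral_congr_ae ?_) hs
    filter_upwards [hscale n (Z i s)] with z hz
    rw [hz]
  · intro r hr
    obtain ⟨c, hc⟩ := hK_tail r hr
    refine ⟨c, hc.mono fun n hn => ?_⟩
    rw [NPIV.tailMass_eq_lintegral (hZ 0) hZ_law hK'm.measurable hdens.1 (hh n)]
    refine le_of_eq_of_le (lintegral_congr fun s => lintegral_congr_ae ?_) hn
    filter_upwards [ae_restrict_of_ae (hscale n (Z 0 s))] with z hz
    rw [hz]
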